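/- Let $(M,\omega)$ be a symplectic manifold, $C\subset M$ a coisotropic submanifold with induced presymplectic form $\omega_C=\iota^*\omega$, and suppose that $K=\ker\omega_C=TC^{\omega}$ admits an involutive complement: a smooth involutive subbundle $G\subset TC$ with $TC=K\oplus G$. Let $\pi\colon E\to C$ be the vector bundle $E=K^*$, let $j\colon E\hookrightarrow T^*C$ be the embedding that extends a linear form on $K_x$ by zero on $G_x$, and let $(U,\Omega)$ be the local symplectic model defined by $G$: $\Omega=\pi^*\omega_C+j^*\omega_{T^*C}$, where $\omega_{T^*C}=\sum_i dq_i\wedge dp_i$ is the canonical symplectic form, and $U\subset E$ is an open neighbourhood of the zero section on which $\Omega$ is nondegenerate. Let $\Pi$ be the Poisson bivector field of $(U,\Omega)$, i.e. $\Pi^\sharp=-(\Omega^\sharp)^{-1}$ with $\Omega^\sharp v=\Omega(v,\cdot)$ and $\Pi^\sharp\xi=\Pi(\xi,\cdot)$, let $[\cdot,\cdot]$ be the Schouten–Nijenhuis bracket of multivector fields, and let $P$ be the map from multivector fields on $U$ to $\Gamma(\wedge E)$ given by restriction to the zero section followed by the projection $\wedge TE|_C\to\wedge E$ along $TC$. The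 structure maps of Oh and Park's $L_\infty[1]$-algebra on $\Gamma(\wedge E)[1]$ are, for $k\ge 1$, $$\lambda_k(a_1,\dots,a_k)=P\big([[\dots[\Pi,a_1],\dots],a_k]\big),\qquad a_i\in\Gamma(\wedge E),$$ where sections of $\wedge E$ are regarded as vertical multivector fields on $E$ that are constant along the fibres. Then these are well-defined multilinear maps on $\Gamma(\wedge E)$ and $\lambda_k=0$ for all $k>2$. Moreover, $\Gamma(\wedge E)=\bigoplus_k\Gamma(\wedge^kE)$, graded by $k$, is a differential graded Lie algebra with differential $da=\lambda_1(a)$ and bracket $[a,b]=(-1)^{k}\lambda_2(a,b)$ for $a\in\Gamma(\wedge^kE)$: $d$ has degree $1$ and squares to zero, the bracket has degree $0$ and is graded antisymmetric, $d$ is a graded derivation of the bracket, and the graded Jacobi identity holds. -/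

import Mathlib

open scoped Manifold ContDiff DirectSum Nat

noncomputable section

namespace OhPark

/-! ### Differential forms on boundaryless manifolds -/

section Forms

variable {V : Type*} [NormedAddCommGroup V] [NormedSpace ℝ V]
  {H : Type*} [TopologicalSpace H] (I : ModelWithCorners ℝ V H)
  (M : Type*) [TopologicalSpace M] [ChartedSpace H M]

/-- A (not necessarily smooth) differential form of degree `k` on `M`. -/
abbrev DiffForm (k : ℕ) : Type _ := ∀ x : M, (TangentSpace I x) [⋀^Fin k]→L[ℝ] ℝ

variable {V' : Type*} [NormedAddCommGroup V'] [NormedSpace ℝ V']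
  {H' : Type*} [TopologicalSpace H'] (I' : ModelWithCorners ℝ V' H')
  {M' : Type*} [TopologicalSpace M'] [ChartedSpace H' M']

variable {I M}

namespace DiffForm

/-- The pull-back of a form `α` along a map `f`, with values `α_{f x}(df v₁, …, df v_k)`. -/
def pullback {k : ℕ} (f : M' → M) (α : DiffForm I M k) : DiffForm I' M' k :=
  fun x => (α (f x)).compContinuousLinearMap (mfderiv I' I f x)

/-- The expression of a form in the preferred chart at `x₀`; it is meaningful on the target of
that chart. -/
def inChart {k : ℕ} (α : DiffForm I M k) (x₀ : M) : V → V [⋀^Fin k]→L[ℝ] ℝ :=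
  fun y => (α ((extChartAt I x₀).symm y)).compContinuousLinearMap
    (mfderiv 𝓘(ℝ, V) I (extChartAt I x₀).symm y)

/-- A form is smooth if all its chart expressions are. -/
def IsSmooth {k : ℕ} (α : DiffForm I M k) : Prop :=
  ∀ x₀ : M, ContDiffOn ℝ ∞ (α.inChart x₀) (extChartAt I x₀).target

/-- The exterior derivative, computed at each point in the preferred chart there. -/
def d {k : ℕ} (α : DiffForm I M k) : DiffForm I M (k + 1) :=
  fun x => (extDeriv (α.inChart x) (extChartAt I x x)).compContinuousLinearMap
    (mfderiv I 𝓘(ℝ, V) (extChartAt I x) x)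

/-- A two-form is nondegenerate at `x` if only the zero vector pairs to zero with all others. -/
def NondegenerateAt (α : DiffForm I M 2) (x : M) : Prop :=
  ∀ v : TangentSpace I x, (∀ w : TangentSpace I x, α x ![v, w] = 0) → v = 0

/-- A symplectic form: a smooth, closed, nondegenerate two-form. -/
structure IsSymplectic (α : DiffForm I M 2) : Prop where
  smooth : α.IsSmooth
  closed : α.d = 0
  nondegenerate : ∀ x, α.NondegenerateAt x

/-- The kernel of a two-form: at `x`, the vectors `v` with `α_x(v, ·) = 0`. -/
def ker (α : DiffForm I M 2) (x : M) : Submodule ℝ (TangentSpace I x) where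
  carrier := {v | ∀ w : TangentSpace I x, α x ![v, w] = 0}
  zero_mem' := fun w => (α x).map_coord_zero 0 rfl
  add_mem' := by
    intro a b ha hb w
    have h := (α x).map_update_add ![0, w] 0 a b
    have e : ∀ c : TangentSpace I x, Function.update ![0, w] 0 c = ![c, w] := by
      intro c; ext i; fin_cases i <;> simp
    rw [e, e, e] at h
    rw [h, ha w, hb w, add_zero]
  smul_mem' := by
    intro c a ha w
    have h := (α x).map_update_smul ![0, w] 0 c a
    have e : ∀ c : TangentSpace I x, Function.update ![0, w] 0 c = ![c, w] := by
      intro c; ext i; fin_cases i <;> simp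
    rw [e, e] at h
    rw [h, ha w, smul_zero]

/-- The (immersed) submanifold `ι : M' → M` is coisotropic with respect to `α`: at each of its
points, the `α`-orthogonal of its tangent space is contained in its tangent space. -/
def IsCoisotropic (α : DiffForm I M 2) (ι : M' → M) : Prop :=
  ∀ (x : M') (v : TangentSpace I (ι x)),
    (∀ u : TangentSpace I' x, α (ι x) ![v, mfderiv I' I ι x u] = 0) →
      ∃ u : TangentSpace I' x, mfderiv I' I ι x u = v

end DiffForm

end Forms

/-! ### Distributions -/

/-- The model space of `n`-dimensional manifolds. -/
abbrev Eu (n : ℕ) : Type := EuclideanSpace ℝ (Fin n)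

section Distributions

variable {n : ℕ} {C : Type*} [TopologicalSpace C] [ChartedSpace (Eu n) C]

instance instFiniteDimensionalTangent (x : C) : FiniteDimensional ℝ (TangentSpace (𝓡 n) x) :=
  inferInstanceAs (FiniteDimensional ℝ (Eu n))

instance instT2SpaceTangent (x : C) : T2Space (TangentSpace (𝓡 n) x) :=
  inferInstanceAs (T2Space (Eu n))

variable [IsManifold (𝓡 n) ∞ C]

variable (n C) in
/-- Smooth vector fields on `C`. -/
abbrev VecField : Type _ :=
  Cₛ^∞⟮𝓡 n; Eu n, (TangentSpace (𝓡 n) : C → Type _)⟯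

/-- `Γ(D)`: the smooth vector fields with values in `D`. -/
def sections (D : ∀ x : C, Submodule ℝ (TangentSpace (𝓡 n) x)) :
    Submodule ℝ (VecField n C) where
  carrier := {X | ∀ x, X x ∈ D x}
  zero_mem' := fun x => (D x).zero_mem
  add_mem' := fun ha hb x => (D x).add_mem (ha x) (hb x)
  smul_mem' := fun c _ ha x => (D x).smul_mem c (ha x)

/-- `D` is a smooth subbundle of `TC`: its rank is locally constant, and each of its vectors is a
value of a smooth vector field with values in `D`. -/
structure IsSubbundle (D : ∀ x : C, Submodule ℝ (TangentSpace (𝓡 n) x)) : Prop where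
  rank : IsLocallyConstant fun x => Module.finrank ℝ (D x)
  smooth : ∀ x, ∀ v ∈ D x, ∃ X ∈ sections D, X x = v

/-- `D` is involutive: the Lie bracket of two sections of `D` is again one. -/
def IsInvolutive (D : ∀ x : C, Submodule ℝ (TangentSpace (𝓡 n) x)) : Prop :=
  ∀ X ∈ sections D, ∀ Y ∈ sections D, ∀ x, VectorField.mlieBracket (𝓡 n) X Y x ∈ D x

/-- `Γ(⋀^k K*)`: the families of alternating `k`-linear forms on the spaces `K_x` which take
smooth values on smooth sections of `K`. -/
def foliatedForms (K : ∀ x : C, Submodule ℝ (TangentSpace (𝓡 n) x)) (k : ℕ) :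
    Submodule ℝ (∀ x : C, (K x) [⋀^Fin k]→ₗ[ℝ] ℝ) where
  carrier := {ξ | ∀ X : Fin k → sections K,
    ContMDiff (𝓡 n) 𝓘(ℝ, ℝ) ∞ fun x => ξ x fun i => ⟨(X i).1 x, (X i).2 x⟩}
  zero_mem' := fun _ => contMDiff_const
  add_mem' := fun ha hb X => (ha X).add (hb X)
  smul_mem' := fun c _ ha X =>
    (contDiff_const_smul c).contMDiff.comp (ha X)

/-- The graded vector space `Γ(⋀ K*)`. -/
abbrev FoliatedForms (K : ∀ x : C, Submodule ℝ (TangentSpace (𝓡 n) x)) : Type _ :=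
  ⨁ k : ℕ, foliatedForms K k

end Distributions

/-! ### The cotangent bundle and its canonical symplectic form -/

section Cotangent

variable (n : ℕ) (C : Type*) [TopologicalSpace C] [ChartedSpace (Eu n) C]
  [IsManifold (𝓡 n) ∞ C]

/-- The cotangent bundle `T*C`. -/
abbrev Cotangent : Type _ :=
  Bundle.TotalSpace (Eu n →L[ℝ] ℝ) (fun x : C => TangentSpace (𝓡 n) x →L[ℝ] ℝ)

/-- The tautological one-form on `T*C`, `θ_p(v) = p(dπ v)`; in coordinates `∑ p_i dq_i`. -/
def tautologicalForm : DiffForm ((𝓡 n).prod 𝓘(ℝ, Eu n →L[ℝ] ℝ)) (Cotangent n C) 1 :=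
  fun p => ContinuousAlternatingMap.ofSubsingleton ℝ _ ℝ 0
    (p.2.comp (mfderiv ((𝓡 n).prod 𝓘(ℝ, Eu n →L[ℝ] ℝ)) (𝓡 n)
      (Bundle.TotalSpace.proj : Cotangent n C → C) p))

/-- The canonical symplectic form `-dθ` on `T*C`; in coordinates `∑ dq_i ∧ dp_i`. -/
def canonicalForm : DiffForm ((𝓡 n).prod 𝓘(ℝ, Eu n →L[ℝ] ℝ)) (Cotangent n C) 2 :=
  fun p => -(tautologicalForm n C).d p

end Cotangent

/-! ### Multivector fields as operators on functions

A multivector field `Q` of degree `p` on a manifold is represented by the multiderivation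
`(f₁, …, f_p) ↦ Q(df₁, …, df_p)` of smooth functions. -/

section Multivector

/-- Operators on functions with a component of each arity. -/
abbrev MultiOp (N : Type*) : Type _ := ∀ p : ℕ, (Fin p → N → ℝ) → N → ℝ

variable {N : Type*}

/-- The insertion of `Q` (of arity `q`) into `P` (of arity `a + 1`): the sum over all
`(q, a)`-shuffles `σ` of `sign σ • P(Q(f_{σ 1}, …, f_{σ q}), f_{σ (q+1)}, …, f_{σ (q+a)})`,
written as a normalized sum over all permutations. -/
def insertion {a q r : ℕ} (h : q + a = r) (P : (Fin (a + 1) → N → ℝ) → N → ℝ)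
    (Q : (Fin q → N → ℝ) → N → ℝ) (f : Fin r → N → ℝ) : N → ℝ :=
  ((q ! * a ! : ℕ) : ℝ)⁻¹ • ∑ s : Equiv.Perm (Fin r), ((Equiv.Perm.sign s : ℤ) : ℝ) •
    P (Fin.cons (Q fun i => f (s (Fin.cast h (Fin.castAdd a i))))
      fun j => f (s (Fin.cast h (Fin.natAdd q j))))

/-- The Schouten-Nijenhuis bracket, in terms of multiderivations: for `P` of degree `p` and `Q` of
degree `q` it is `P ∘ Q - (-1)^((p-1)(q-1)) Q ∘ P`, where `∘` denotes insertion. In particular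
`[X, Y]` is the commutator of vector fields and `[X, f] = X(f)`. -/
def schouten (P Q : MultiOp N) : MultiOp N := fun r f =>
  ∑ x : {x : ℕ × ℕ // x ∈ Finset.HasAntidiagonal.antidiagonal r},
    (insertion (Finset.HasAntidiagonal.mem_antidiagonal.1 x.2) (P (x.1.2 + 1)) (Q x.1.1) f -
      (-1 : ℝ) ^ (x.1.2 * (x.1.1 + 1)) •
        insertion (Finset.HasAntidiagonal.mem_antidiagonal.1 x.2) (Q (x.1.2 + 1)) (P x.1.1) f)

end Multivector

section Poisson

variable {V : Type*} [NormedAddCommGroup V] [NormedSpace ℝ V]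
  {H : Type*} [TopologicalSpace H] {I : ModelWithCorners ℝ V H}
  {N : Type*} [TopologicalSpace N] [ChartedSpace H N]

/-- The vector `Π♯(df)` at `e`, where `Π♯ = -(Ω♯)⁻¹` and `Ω♯ v = Ω(v, ·)`; it is meaningful where
`Ω` is nondegenerate. -/
def hamiltonianVector (Om : DiffForm I N 2) (f : N → ℝ) (e : N) : TangentSpace I e :=
  Classical.epsilon fun v => ∀ w : TangentSpace I e,
    Om e ![v, w] = -(mfderiv I 𝓘(ℝ, ℝ) f e w : ℝ)

open Classical in
/-- The Poisson bivector field `Π` on `U` of a two-form `Ω` which is nondegenerate on `U`, as a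
biderivation: `Π(df, dg) = dg(Π♯ df)`. -/
def poissonBivector (Om : DiffForm I N 2) (U : Set N) : MultiOp N
  | 2, f => fun e =>
      if e ∈ U then (mfderiv I 𝓘(ℝ, ℝ) (f 1) e (hamiltonianVector Om (f 0) e) : ℝ) else 0
  | _, _ => 0

end Poisson

/-! ### The local symplectic model and the derived brackets -/

section Model

variable {n : ℕ} {C : Type*} [TopologicalSpace C] [ChartedSpace (Eu n) C]
  [IsManifold (𝓡 n) ∞ C]
  {F : Type*} [NormedAddCommGroup F] [NormedSpace ℝ F]
  {E : C → Type*} [TopologicalSpace (Bundle.TotalSpace F E)]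
  [∀ x, AddCommGroup (E x)] [∀ x, Module ℝ (E x)] [∀ x, TopologicalSpace (E x)]
  [FiberBundle F E] [VectorBundle ℝ F E]
  {K : ∀ x : C, Submodule ℝ (TangentSpace (𝓡 n) x)}

/-- The fibrewise linear function on `E` given by a section `X` of `K`, under `Φ : E ≅ K*`. -/
def linearFunction (Φ : ∀ x, E x ≃ₗ[ℝ] Module.Dual ℝ (K x)) (X : sections K) :
    Bundle.TotalSpace F E → ℝ :=
  fun e => Φ e.proj e.2 ⟨X.1 e.proj, X.2 e.proj⟩

variable (F) in
/-- The fibrewise linear isomorphism `Φ : E → K*` is smooth, that is, an isomorphism of smooth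
vector bundles: smooth sections of `K` give smooth functions on `E`. -/
def IsSmoothIso (Φ : ∀ x, E x ≃ₗ[ℝ] Module.Dual ℝ (K x)) : Prop :=
  ∀ X : sections K,
    ContMDiff ((𝓡 n).prod 𝓘(ℝ, F)) 𝓘(ℝ, ℝ) ∞ (linearFunction (F := F) Φ X)

/-- The embedding `j : E ≅ K* → T*C` determined by a complement `G` of `K`: it extends a linear
form on `K_x` by zero on `G_x`. -/
def toCotangent (Φ : ∀ x, E x ≃ₗ[ℝ] Module.Dual ℝ (K x))
    {G : ∀ x : C, Submodule ℝ (TangentSpace (𝓡 n) x)} (hKG : ∀ x, IsCompl (K x) (G x)) :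
    Bundle.TotalSpace F E → Cotangent n C :=
  fun e => ⟨e.proj, LinearMap.toContinuousLinearMap
    ((Φ e.proj e.2).comp ((K e.proj).projectionOnto (G e.proj) (hKG e.proj)))⟩

/-- The two-form `Ω = π*α + j*ω_{T*C}` on `E` of the local symplectic model of `(C, α)`. -/
def modelForm (α : DiffForm (𝓡 n) C 2) (Φ : ∀ x, E x ≃ₗ[ℝ] Module.Dual ℝ (K x))
    {G : ∀ x : C, Submodule ℝ (TangentSpace (𝓡 n) x)} (hKG : ∀ x, IsCompl (K x) (G x)) :
    DiffForm ((𝓡 n).prod 𝓘(ℝ, F)) (Bundle.TotalSpace F E) 2 :=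
  fun e => DiffForm.pullback ((𝓡 n).prod 𝓘(ℝ, F)) Bundle.TotalSpace.proj α e +
    DiffForm.pullback ((𝓡 n).prod 𝓘(ℝ, F)) (toCotangent Φ hKG) (canonicalForm n C) e

/-- The derivative at `e` of the restriction of `f` to the fibre of `E` through `e` (the fibre is
identified with `F` by a local trivialization, in order to differentiate). -/
def fibreDeriv (f : Bundle.TotalSpace F E → ℝ) (e : Bundle.TotalSpace F E) :
    Module.Dual ℝ (E e.proj) :=
  let L : E e.proj ≃L[ℝ] F := (trivializationAt F E e.proj).continuousLinearEquivAt ℝ e.proj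
    (FiberBundle.mem_baseSet_trivializationAt' e.proj)
  (fderiv ℝ (fun y : F => f ⟨e.proj, L.symm y⟩) (L e.2)).toLinearMap.comp L.toLinearEquiv.toLinearMap

/-- The fibre derivative, as an element of `K_x ≅ K_x** ≅ E_x*`. -/
def fibreGradient (Φ : ∀ x, E x ≃ₗ[ℝ] Module.Dual ℝ (K x)) (f : Bundle.TotalSpace F E → ℝ)
    (e : Bundle.TotalSpace F E) : K e.proj :=
  (Module.evalEquiv ℝ (K e.proj)).symm
    ((fibreDeriv f e).comp (Φ e.proj).symm.toLinearMap)

/-- An element of `Γ(⋀ E) = Γ(⋀ K*)` as a vertical multivector field on `E` that is constant along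
the fibres. -/
def verticalLift (Φ : ∀ x, E x ≃ₗ[ℝ] Module.Dual ℝ (K x)) (ξ : FoliatedForms K) :
    MultiOp (Bundle.TotalSpace F E) :=
  fun p f e => (ξ p).1 e.proj fun i => fibreGradient Φ (f i) e

/-- The iterated bracket `[[…[Q, a₁], …], a_m]`, for elements `a_i` of `Γ(⋀ E)`. -/
def iteratedBracket (Φ : ∀ x, E x ≃ₗ[ℝ] Module.Dual ℝ (K x))
    (Q : MultiOp (Bundle.TotalSpace F E)) {m : ℕ} (a : Fin m → FoliatedForms K) :
    MultiOp (Bundle.TotalSpace F E) :=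
  (List.ofFn a).foldl (fun R ξ => schouten R (verticalLift Φ ξ)) Q

/-- `ξ ∈ Γ(⋀ E)` is the projection `P(Q)` of the multivector field `Q` on `E`: restriction to the
zero section followed by the projection `⋀ TE|_C → ⋀ E` along `TC`. On sections
`X₁, …, X_k` of `K = E*` it is the restriction to the zero section of `Q(dℓ₁, …, dℓ_k)`, where
`ℓ_i` is the fibrewise linear function of `X_i`. -/
def IsProjection (Φ : ∀ x, E x ≃ₗ[ℝ] Module.Dual ℝ (K x))
    (Q : MultiOp (Bundle.TotalSpace F E)) (ξ : FoliatedForms K) : Prop :=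
  ∀ (k : ℕ) (X : Fin k → sections K) (x : C),
    (ξ k).1 x (fun i => ⟨(X i).1 x, (X i).2 x⟩) =
      Q k (fun i => linearFunction Φ (X i)) ⟨x, 0⟩

/-- The structure maps of the `L_∞[1]`-algebra of Oh and Park on `Γ(⋀ E)[1]`: for `m ≥ 1`,
`λ_m(a₁, …, a_m) = P([[…[Π, a₁], …], a_m])`. -/
def IsOhParkAlgebra (Φ : ∀ x, E x ≃ₗ[ℝ] Module.Dual ℝ (K x))
    (Pi : MultiOp (Bundle.TotalSpace F E))
    (lam : ∀ m : ℕ, MultilinearMap ℝ (fun _ : Fin m => FoliatedForms K) (FoliatedForms K)) :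
    Prop :=
  ∀ m : ℕ, 1 ≤ m → ∀ a : Fin m → FoliatedForms K,
    IsProjection Φ (iteratedBracket Φ Pi a) (lam m a)

end Model

/-! ### Differential graded Lie algebras -/

section DGLA

variable {L : ℕ → Type*} [∀ k, AddCommGroup (L k)] [∀ k, Module ℝ (L k)]

/-- `(⨁ L_k, d, [·,·])` is a differential graded Lie algebra. -/
structure IsDGLA (d : (⨁ k, L k) →ₗ[ℝ] ⨁ k, L k)
    (br : (⨁ k, L k) →ₗ[ℝ] (⨁ k, L k) →ₗ[ℝ] ⨁ k, L k) : Prop where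
  degree_d : ∀ k (a : L k), ∃ b : L (k + 1), d (.lof ℝ ℕ L k a) = .lof ℝ ℕ L (k + 1) b
  degree_bracket : ∀ k l (a : L k) (b : L l), ∃ c : L (k + l),
    br (.lof ℝ ℕ L k a) (.lof ℝ ℕ L l b) = .lof ℝ ℕ L (k + l) c
  d_d : ∀ a, d (d a) = 0
  antisymm : ∀ k l (a : L k) (b : L l),
    br (.lof ℝ ℕ L k a) (.lof ℝ ℕ L l b) =
      -((-1 : ℝ) ^ (k * l) • br (.lof ℝ ℕ L l b) (.lof ℝ ℕ L k a))
  leibniz : ∀ k (a : L k) (b : ⨁ k, L k),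
    d (br (.lof ℝ ℕ L k a) b) =
      br (d (.lof ℝ ℕ L k a)) b + (-1 : ℝ) ^ k • br (.lof ℝ ℕ L k a) (d b)
  jacobi : ∀ k l (a : L k) (b : L l) (c : ⨁ k, L k),
    br (.lof ℝ ℕ L k a) (br (.lof ℝ ℕ L l b) c) =
      br (br (.lof ℝ ℕ L k a) (.lof ℝ ℕ L l b)) c +
        (-1 : ℝ) ^ (k * l) • br (.lof ℝ ℕ L l b) (br (.lof ℝ ℕ L k a) c)

/-- The sign `(-1)^k` in degree `k`. -/
def degreeSign : (⨁ k, L k) →ₗ[ℝ] ⨁ k, L k :=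
  DirectSum.lmap fun k => (-1 : ℝ) ^ k • LinearMap.id

/-- The differential of a graded space, from the unary bracket of an `L_∞[1]`-algebra structure on
its shift. -/
def differential (lam : MultilinearMap ℝ (fun _ : Fin 1 => ⨁ k, L k) (⨁ k, L k)) :
    (⨁ k, L k) →ₗ[ℝ] ⨁ k, L k where
  toFun a := lam fun _ => a
  map_add' a b := by
    have h := lam.map_update_add (fun _ => 0) 0 a b
    have e : ∀ c : ⨁ k, L k, Function.update (fun _ : Fin 1 => (0 : ⨁ k, L k)) 0 c =
        fun _ => c := by
      intro c; funext i; rw [Subsingleton.elim i 0]; simp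
    rwa [e, e, e] at h
  map_smul' r a := by
    have h := lam.map_update_smul (fun _ => 0) 0 r a
    have e : ∀ c : ⨁ k, L k, Function.update (fun _ : Fin 1 => (0 : ⨁ k, L k)) 0 c =
        fun _ => c := by
      intro c; funext i; rw [Subsingleton.elim i 0]; simp
    rwa [e, e] at h

/-- The bracket `[a, b] = (-1)^k λ₂(a, b)`, for `a` of degree `k`, on a graded space, from the
binary bracket `λ₂` of an `L_∞[1]`-algebra structure on its shift. -/
def shiftedBracket (lam : MultilinearMap ℝ (fun _ : Fin 2 => ⨁ k, L k) (⨁ k, L k)) :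
    (⨁ k, L k) →ₗ[ℝ] (⨁ k, L k) →ₗ[ℝ] ⨁ k, L k :=
  have e0 : ∀ b c : ⨁ k, L k, Function.update ![0, b] 0 c = ![c, b] := by
    intro b c; funext i; fin_cases i <;> simp
  have e1 : ∀ b c : ⨁ k, L k, Function.update ![b, 0] 1 c = ![b, c] := by
    intro b c; funext i; fin_cases i <;> simp
  LinearMap.mk₂ ℝ (fun a b => lam ![degreeSign a, b])
    (fun a a' b => by
      have h := lam.map_update_add ![0, b] 0 (degreeSign a) (degreeSign a')
      rw [e0, e0, e0] at h
      rw [map_add, h])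
    (fun r a b => by
      have h := lam.map_update_smul ![0, b] 0 r (degreeSign a)
      rw [e0, e0] at h
      rw [map_smul, h])
    (fun a b b' => by
      have h := lam.map_update_add ![degreeSign a, 0] 1 b b'
      rwa [e1, e1, e1] at h)
    (fun r a b => by
      have h := lam.map_update_smul ![degreeSign a, 0] 1 r b
      rwa [e1, e1] at h)

end DGLA

end OhPark

end

open OhPark

open scoped Manifold ContDiff DirectSum Nat

set_option linter.unusedSectionVars false

namespace OhPark

/-! ### Graded operations on lists -/

section ListOp

variable {A : Type*} [CommRing A] [Algebra ℝ A]

/-! The proof counts degrees along the fibres of `E`. Write `α` for the presymplectic form and `ℓ_A`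
for the fibrewise linear function of the `K`-component of a vector field `A` on `C`. For lifts `w`,
`w'` of `A`, `B` to `E`, the local model satisfies `Ω(w, w') = α(A, B) - (w ℓ_B - w' ℓ_A - ℓ_[A,B])`
(`modelForm_apply`). If `A` and `B` lie in `G`, all three linear functions vanish by involutivity.
Hence `Ω` is nondegenerate on all of `E`, and the Hamiltonian vectors of the generating functions
can be found explicitly. For functions `f`, `g` on `C` and sections `X`, `Z` of `K`, the bracket
`{f, g}` is a function on `C`, `{f, ℓ_X}` has fibre degree at most one, and `{ℓ_X, ℓ_Z}` has fibre
degree at most two and no constant term (`poisson_basic_basic`, `poisson_basic_linear`,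
`poisson_linear_linear`).

Say that a multivector field has degree `c` if its value on `k` functions from `C` and any number of
linear functions has fibre degree at most `c - k`. Then `Π` has degree 2, the sections of `⋀ E` have
degree 0, the Schouten bracket of degrees `c` and `c'` has degree `c + c' - 1`, and a field of
negative degree is zero (`Deg.br`, `Deg.eq_zero`). So sections of `⋀ E` commute, and `[[[Π, a], b],
c] = 0`, which kills `λ_k` for `k > 2`. Moreover `[[Π, a], b]` has degree 0 and therefore equals the
vertical field of its projection `λ₂(a, b)` (`br_br_eq`).

The axioms of a differential graded Lie algebra are then computations with derived brackets, from
the graded Jacobi identity and `[Π, Π] = 0` (`isDGLA`). The field `[Π, a]` agrees with `λ₁(a)` only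
modulo fields tangent to the zero section. These are closed under the bracket, include `Π`, and
project to zero, so the error never contributes.

Multivector fields are treated as multiderivations of the algebra of functions that are, locally
over `C`, polynomial along the fibres (`polyAlgebra`), and multiderivations as functions of lists.
Sums over shuffles become recursions on the first argument, and the Jacobi identity follows from a
graded pre-Lie identity (`assoc_symm`). `Represents.schouten` translates back to sums over
permutations. The identity `[Π, Π] = 0` is a chart computation from `dΩ = 0` (`poisson_jacobi`). The
projections exist because the value at a point of the zero section depends on the sections of `K`
only through their values there (`apply_linear_congr`). -/

/-- Operations on `A` with a component of each arity. -/
abbrev ListOp (A : Type*) : Type _ := List A → A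

namespace ListOp

/-- Insertion of a first argument. -/
def fix (v : A) (Q : ListOp A) : ListOp A := fun t => Q (v :: t)

/-- The sign `(-1)^p` in arity `p`. -/
def tw (Q : ListOp A) : ListOp A := fun t => (-1 : ℝ) ^ t.length • Q t

/-- The even part. -/
def ev (Q : ListOp A) : ListOp A := fun t => if Even t.length then Q t else 0

/-- The odd part. -/
def od (Q : ListOp A) : ListOp A := fun t => if Even t.length then 0 else Q t

/-- The insertion of `Q` into `P`, a signed sum over shuffles, by recursion on the arguments. -/
def ins : List A → ListOp A → ListOp A → A
  | [], P, Q => P [Q []]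
  -- Either `v` is the first argument of `Q`, or it belongs to `P`. In the second case it passes the
  -- arguments of `Q`, which gives the sign in `tw Q`, and `fix v P` puts it before the slot of `Q`
  -- instead of after it, which gives the minus sign.
  | v :: t, P, Q => ins t P (fix v Q) - ins t (fix v P) (tw Q)

/-- The exterior product of operations. -/
def wedge : List A → ListOp A → ListOp A → A
  | [], P, Q => P [] * Q []
  | v :: t, P, Q => wedge t (fix v P) Q + wedge t (tw P) (fix v Q)

/-- The composition product. -/
def comp (P Q : ListOp A) : ListOp A := fun t => ins t P Q

/-- The graded bracket. -/
def br (P Q : ListOp A) : ListOp A := comp P Q - comp (od Q) P + comp (ev Q) (tw P)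

/-- `Q` is alternating and multilinear. -/
structure AltLin (Q : ListOp A) : Prop where
  alt : ∀ s u v t, Q (s ++ u :: v :: t) = -Q (s ++ v :: u :: t)
  add : ∀ u v t, Q ((u + v) :: t) = Q (u :: t) + Q (v :: t)
  smul : ∀ (r : ℝ) v t, Q ((r • v) :: t) = r • Q (v :: t)

/-- `Q` is an alternating multiderivation. -/
structure MultiDer (Q : ListOp A) : Prop extends AltLin Q where
  mul : ∀ u v t, Q ((u * v) :: t) = u * Q (v :: t) + v * Q (u :: t)

/-- `Q` is concentrated in arities of the parity of `p`. -/
def Par (p : ℕ) (Q : ListOp A) : Prop := tw Q = (-1 : ℝ) ^ p • Q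

/-- `Q` vanishes in arities greater than `N`. -/
def Bdd (N : ℤ) (Q : ListOp A) : Prop := ∀ t, N < t.length → Q t = 0

/-- `Q` is concentrated in arity `p`. -/
def Hom (p : ℤ) (Q : ListOp A) : Prop := ∀ t : List A, (t.length : ℤ) ≠ p → Q t = 0

variable {P P' Q Q' R : ListOp A} {v u : A} {t : List A}

lemma fix_apply : fix v Q t = Q (v :: t) := rfl
lemma comp_nil : comp P Q [] = P [Q []] := rfl
lemma comp_cons : comp P Q (v :: t) = comp P (fix v Q) t - comp (fix v P) (tw Q) t := rfl
lemma fix_comp : fix v (comp P Q) = comp P (fix v Q) - comp (fix v P) (tw Q) := rfl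
lemma fix_add : fix v (P + Q) = fix v P + fix v Q := rfl
lemma fix_neg : fix v (-P) = -fix v P := rfl
lemma fix_smul (r : ℝ) : fix v (r • P) = r • fix v P := rfl
lemma tw_add : tw (P + Q) = tw P + tw Q := by funext t; simp [tw]
lemma tw_smul (r : ℝ) : tw (r • P) = r • tw P := by
  funext t; exact smul_comm _ _ _
lemma tw_tw : tw (tw P) = P := by
  funext t; simp [tw, smul_smul, ← mul_pow]
lemma fix_tw : fix v (tw P) = -tw (fix v P) := by
  funext t; simp [tw, fix, pow_succ]

lemma AltLin.fix (h : AltLin Q) (v : A) : AltLin (fix v Q) where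
  alt s a b t := h.alt (v :: s) a b t
  add a b t := by
    have := h.alt []
    simp only [List.nil_append] at this
    simp only [fix_apply]
    rw [this, h.add, this v a, this v b]; ring
  smul r a t := by
    have := h.alt []
    simp only [List.nil_append] at this
    simp only [fix_apply]
    rw [this, h.smul, this v a]; simp

lemma MultiDer.fix (h : MultiDer Q) (v : A) : MultiDer (fix v Q) where
  toAltLin := h.toAltLin.fix v
  mul a b t := by
    have := h.alt []
    simp only [List.nil_append] at this
    simp only [fix_apply]
    rw [this, h.mul, this v a, this v b]; ring

lemma AltLin.add' (h : AltLin P) (h' : AltLin Q) : AltLin (P + Q) where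
  alt s a b t := by simp only [Pi.add_apply]; rw [h.alt, h'.alt]; ring
  add a b t := by simp only [Pi.add_apply]; rw [h.add, h'.add]; ring
  smul r a t := by simp only [Pi.add_apply]; rw [h.smul, h'.smul, smul_add]

lemma AltLin.smul' (h : AltLin P) (r : ℝ) : AltLin (r • P) where
  alt s a b t := by simp only [Pi.smul_apply]; rw [h.alt, smul_neg]
  add a b t := by simp only [Pi.smul_apply]; rw [h.add, smul_add]
  smul r a t := by simp only [Pi.smul_apply]; rw [h.smul, smul_comm]

lemma AltLin.tw (h : AltLin P) : AltLin (tw P) where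
  alt s a b t := by simp only [ListOp.tw]; rw [h.alt]; simp
  add a b t := by simp only [ListOp.tw]; rw [h.add]; simp
  smul r a t := by simp only [ListOp.tw]; rw [h.smul]; exact smul_comm _ _ _

lemma AltLin.ev (h : AltLin P) : AltLin (ev P) where
  alt s a b t := by simp only [ListOp.ev]; rw [h.alt]; simp; split_ifs <;> simp
  add a b t := by simp only [ListOp.ev]; rw [h.add]; simp; split_ifs <;> simp
  smul r a t := by simp only [ListOp.ev]; rw [h.smul]; simp

lemma AltLin.od (h : AltLin P) : AltLin (od P) where
  alt s a b t := by simp only [ListOp.od]; rw [h.alt]; simp; split_ifs <;> simp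
  add a b t := by simp only [ListOp.od]; rw [h.add]; simp; split_ifs <;> simp
  smul r a t := by simp only [ListOp.od]; rw [h.smul]; simp

lemma AltLin.neg (h : AltLin P) : AltLin (-P) := by simpa using h.smul' (-1)

lemma AltLin.sub (h : AltLin P) (h' : AltLin Q) : AltLin (P - Q) := by
  simpa [sub_eq_add_neg] using h.add' h'.neg

lemma AltLin.apply_zero (h : AltLin P) : P (0 :: t) = 0 := by
  simpa using h.smul 0 0 t

lemma AltLin.fix_fix (h : AltLin P) (u v : A) :
    ListOp.fix u (ListOp.fix v P) = -ListOp.fix v (ListOp.fix u P) := by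
  funext t; exact h.alt [] v u t

lemma MultiDer.add' (h : MultiDer P) (h' : MultiDer Q) : MultiDer (P + Q) where
  toAltLin := h.toAltLin.add' h'.toAltLin
  mul a b t := by simp only [Pi.add_apply]; rw [h.mul, h'.mul]; ring

lemma MultiDer.smul' (h : MultiDer P) (r : ℝ) : MultiDer (r • P) where
  toAltLin := h.toAltLin.smul' r
  mul a b t := by simp only [Pi.smul_apply]; rw [h.mul]; simp

lemma MultiDer.neg (h : MultiDer P) : MultiDer (-P) := by simpa using h.smul' (-1)

lemma MultiDer.sub (h : MultiDer P) (h' : MultiDer Q) : MultiDer (P - Q) := by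
  simpa [sub_eq_add_neg] using h.add' h'.neg

/-! #### Linearity of the composition product -/

lemma comp_add_left : comp (P + P') Q = comp P Q + comp P' Q := by
  funext t
  induction t generalizing P P' Q with
  | nil => rfl
  | cons v t ih =>
    simp only [Pi.add_apply, comp_cons, fix_add] at ih ⊢
    rw [ih, ih]; ring

lemma comp_smul_left (r : ℝ) : comp (r • P) Q = r • comp P Q := by
  funext t
  induction t generalizing P Q with
  | nil => rfl
  | cons v t ih =>
    simp only [Pi.smul_apply, comp_cons, fix_smul] at ih ⊢
    rw [ih, ih, smul_sub]

lemma comp_add_right (h : AltLin P) : comp P (Q + Q') = comp P Q + comp P Q' := by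
  funext t
  induction t generalizing P Q Q' with
  | nil => exact h.add _ _ _
  | cons v t ih =>
    simp only [Pi.add_apply, comp_cons, fix_add, tw_add] at ih ⊢
    rw [ih h, ih (h.fix v)]; ring

lemma comp_smul_right (h : AltLin P) (r : ℝ) : comp P (r • Q) = r • comp P Q := by
  funext t
  induction t generalizing P Q with
  | nil => exact h.smul _ _ _
  | cons v t ih =>
    simp only [Pi.smul_apply, comp_cons, fix_smul, tw_smul] at ih ⊢
    rw [ih h, ih (h.fix v), smul_sub]

lemma comp_neg_left : comp (-P) Q = -comp P Q := by
  simpa using comp_smul_left (P := P) (Q := Q) (-1)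

lemma comp_neg_right (h : AltLin P) : comp P (-Q) = -comp P Q := by
  simpa using comp_smul_right (Q := Q) h (-1)

lemma comp_sub_left : comp (P - P') Q = comp P Q - comp P' Q := by
  rw [sub_eq_add_neg, comp_add_left, comp_neg_left, sub_eq_add_neg]

lemma comp_sub_right (h : AltLin P) : comp P (Q - Q') = comp P Q - comp P Q' := by
  rw [sub_eq_add_neg, comp_add_right h, comp_neg_right h, sub_eq_add_neg]

/-- Two adjacent arguments either enter the same operation, which is alternating, or different ones;
the two mixed placements carry opposite signs and are exchanged by the swap. -/
lemma AltLin.comp (hP : AltLin P) (hQ : AltLin Q) : AltLin (comp P Q) where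
  alt s := by
    induction s generalizing P Q with
    | nil =>
      intro u v t
      simp only [List.nil_append]
      have e : ∀ a b : A, ListOp.comp P Q (a :: b :: t) =
          ListOp.comp P (ListOp.fix b (ListOp.fix a Q)) t
          - ListOp.comp (ListOp.fix b P) (ListOp.tw (ListOp.fix a Q)) t
          + ListOp.comp (ListOp.fix a P) (ListOp.tw (ListOp.fix b Q)) t
          + ListOp.comp (ListOp.fix b (ListOp.fix a P)) Q t := by
        intro a b
        rw [comp_cons, comp_cons, comp_cons, fix_tw, comp_neg_right (hP.fix a), tw_tw]
        simp only [Pi.neg_apply]; ring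
      rw [e, e, hQ.fix_fix u v, hP.fix_fix u v, comp_neg_left, comp_neg_right hP]
      simp only [Pi.neg_apply]; ring
    | cons w s ih =>
      intro u v t
      simp only [List.cons_append, comp_cons]
      rw [ih hP (hQ.fix w), ih (hP.fix w) hQ.tw]; ring
  add u v t := by
    have e : ∀ w : ListOp A, ListOp.tw w = ListOp.tw w := fun _ => rfl
    have h1 : ListOp.fix (u + v) Q = ListOp.fix u Q + ListOp.fix v Q := by
      funext t; exact hQ.add u v t
    have h2 : ListOp.fix (u + v) P = ListOp.fix u P + ListOp.fix v P := by
      funext t; exact hP.add u v t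
    simp only [comp_cons]
    rw [h1, h2, comp_add_left, comp_add_right hP]
    simp only [Pi.add_apply]; ring
  smul r v t := by
    have h1 : ListOp.fix (r • v) Q = r • ListOp.fix v Q := by
      funext t; exact hQ.smul r v t
    have h2 : ListOp.fix (r • v) P = r • ListOp.fix v P := by
      funext t; exact hP.smul r v t
    simp only [comp_cons]
    rw [h1, h2, comp_smul_left, comp_smul_right hP]
    simp only [Pi.smul_apply, smul_sub]

/-! #### Parity and arity -/

/-- Only the parity counts, so losing an argument is recorded as `q + 1`, which avoids subtraction.
-/
lemma Par.fix {q : ℕ} (h : Par q Q) (v : A) : Par (q + 1) (fix v Q) := by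
  unfold Par at *
  rw [← neg_inj, ← fix_tw, h, fix_smul, pow_succ]; simp

lemma Par.tw_eq {q : ℕ} (h : Par q Q) : tw Q = (-1 : ℝ) ^ q • Q := h

lemma Par.congr {p q : ℕ} (h : Par q Q) (e : Even (p + q)) : Par p Q := by
  unfold Par at *
  rw [h]
  congr 1
  rcases Nat.even_or_odd p with hp | hp <;> rcases Nat.even_or_odd q with hq | hq <;>
    simp only [hp.neg_one_pow, hq.neg_one_pow] <;> exfalso
  · exact Nat.not_even_iff_odd.2 (hp.add_odd hq) e
  · exact Nat.not_even_iff_odd.2 (hp.add_even hq) e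

lemma Par.smul' {q : ℕ} (h : Par q Q) (r : ℝ) : Par q (r • Q) := by
  unfold Par at *; rw [tw_smul, h, smul_comm]

lemma Par.add' {q : ℕ} (h : Par q Q) (h' : Par q Q') : Par q (Q + Q') := by
  unfold Par at *; rw [tw_add, h, h', smul_add]

lemma Par.neg {q : ℕ} (h : Par q Q) : Par q (-Q) := by simpa using h.smul' (-1)

lemma Par.sub {q : ℕ} (h : Par q Q) (h' : Par q Q') : Par q (Q - Q') := by
  simpa [sub_eq_add_neg] using h.add' h'.neg

lemma Par.nil {q : ℕ} (h : Par q Q) (hq : Odd q) : Q [] = 0 := by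
  have := congrFun h []
  simp only [ListOp.tw, List.length_nil, pow_zero, one_smul, Pi.smul_apply, hq.neg_one_pow,
    neg_smul] at this
  have h2 : (2 : ℝ) • Q [] = 0 := by rw [two_smul]; nth_rw 1 [this]; simp
  simpa using h2

lemma Par.ev_eq {q : ℕ} (h : Par q Q) (hq : Even q) : ev Q = Q ∧ od Q = 0 := by
  have : ∀ t : List A, ¬ Even t.length → Q t = 0 := by
    intro t ht
    have h1 := congrFun h t
    simp only [ListOp.tw, Pi.smul_apply, hq.neg_one_pow,
      (Nat.not_even_iff_odd.1 ht).neg_one_pow, one_smul, neg_smul] at h1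
    have h2 : (2 : ℝ) • Q t = 0 := by rw [two_smul]; nth_rw 1 [← h1]; simp
    simpa using h2
  constructor <;> funext t <;> by_cases ht : Even t.length <;> simp [ev, od, ht, this]

lemma Par.od_eq {q : ℕ} (h : Par q Q) (hq : Odd q) : ev Q = 0 ∧ od Q = Q := by
  have : ∀ t : List A, Even t.length → Q t = 0 := by
    intro t ht
    have h1 := congrFun h t
    simp only [ListOp.tw, Pi.smul_apply, hq.neg_one_pow,
      ht.neg_one_pow, one_smul, neg_smul] at h1
    have h2 : (2 : ℝ) • Q t = 0 := by rw [two_smul]; nth_rw 1 [h1]; simp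
    simpa using h2
  constructor <;> funext t <;> by_cases ht : Even t.length <;> simp [ev, od, ht, this]

lemma Hom.par {p : ℕ} (h : Hom p Q) : Par p Q := by
  funext t
  by_cases ht : t.length = p
  · simp [tw, ht]
  · have := h t (by exact_mod_cast ht)
    simp [tw, this]

lemma Hom.fix {p : ℤ} (h : Hom p Q) (v : A) : Hom (p - 1) (fix v Q) := fun t ht =>
  h _ (by simp only [List.length_cons]; push_cast; omega)

lemma Hom.tw {p : ℤ} (h : Hom p Q) : Hom p (tw Q) := fun t ht => by simp [ListOp.tw, h t ht]

lemma Hom.comp {p q : ℤ} (hP : Hom p P) (hQ : Hom q Q) (hl : AltLin P) :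
    Hom (p + q - 1) (comp P Q) := by
  intro t
  induction t generalizing P Q p q with
  | nil =>
    intro h
    rw [comp_nil]
    by_cases hq : q = 0
    · exact hP _ (by simp only [List.length_nil, List.length_singleton] at *; push_cast at *; omega)
    · rw [hQ [] (by simpa using (Ne.symm hq)), hl.apply_zero]
  | cons v t ih =>
    intro h
    simp only [List.length_cons] at h
    push_cast at h
    rw [comp_cons, ih hP (hQ.fix v) hl (by omega), ih (hP.fix v) hQ.tw (hl.fix v) (by omega),
      sub_zero]

lemma Bdd.fix {p : ℤ} (h : Bdd p Q) (v : A) : Bdd (p - 1) (fix v Q) := fun t ht =>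
  h _ (by simp only [List.length_cons]; push_cast; omega)

lemma Bdd.tw {p : ℤ} (h : Bdd p Q) : Bdd p (tw Q) := fun t ht => by simp [ListOp.tw, h t ht]

lemma Bdd.comp {p q : ℤ} (hP : Bdd p P) (hQ : Bdd q Q) (hl : AltLin P) :
    Bdd (p + q - 1) (comp P Q) := by
  intro t
  induction t generalizing P Q p q with
  | nil =>
    intro h
    rw [comp_nil]
    simp only [List.length_nil] at h
    push_cast at h
    by_cases hq : q < 0
    · rw [hQ [] (by simpa using hq), hl.apply_zero]
    · exact hP _ (by simp only [List.length_singleton]; push_cast; omega)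
  | cons v t ih =>
    intro h
    simp only [List.length_cons] at h
    push_cast at h
    rw [comp_cons, ih hP (hQ.fix v) hl (by omega), ih (hP.fix v) hQ.tw (hl.fix v) (by omega),
      sub_zero]

lemma Par.comp {p q : ℕ} (hP : Par p P) (hQ : Par q Q) (hl : AltLin P) :
    Par (p + q + 1) (comp P Q) := by
  funext t
  induction t generalizing P Q p q with
  | nil =>
    simp only [ListOp.tw, List.length_nil, pow_zero, one_smul, Pi.smul_apply]
    rcases Nat.even_or_odd q with hq | hq
    · rcases Nat.even_or_odd p with hp | hp
      · have h0 : P [Q []] = 0 := (hP.fix (Q [])).nil hp.add_one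
        rw [comp_nil, h0]; simp
      · rw [(hp.add_even hq).add_one.neg_one_pow]; simp
    · rw [comp_nil, hQ.nil hq, hl.apply_zero, smul_zero]
  | cons v t ih =>
    have h1 := ih hP (hQ.fix v) hl
    have h2 := ih (hP.fix v) hQ (hl.fix v)
    simp only [ListOp.tw, Pi.smul_apply, List.length_cons] at h1 h2 ⊢
    rw [comp_cons, hQ.tw_eq, comp_smul_right (hl.fix v), Pi.smul_apply, smul_sub, smul_sub]
    congr 1
    · rw [pow_succ, mul_neg_one, neg_smul, h1, ← neg_smul]
      congr 1; ring
    · rw [pow_succ, mul_neg_one, neg_smul, smul_comm, h2, ← smul_neg, ← neg_smul, smul_comm]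
      congr 2; ring

/-- The sign is `1` for odd `q` and `-(-1)^p` for even `q`. This is why `br` separates the parities
of `Q` and twists `P` in the even part: in that form it makes sense, and is bilinear, for
inhomogeneous operations. -/
lemma br_eq {p q : ℕ} (hP : Par p P) (hQ : Par q Q) (hl : AltLin Q) :
    br P Q = comp P Q - (-1 : ℝ) ^ ((p + 1) * (q + 1)) • comp Q P := by
  unfold br
  rcases Nat.even_or_odd q with hq | hq
  · rw [(hQ.ev_eq hq).1, (hQ.ev_eq hq).2, hP.tw_eq, comp_smul_right hl]
    have : (-1 : ℝ) ^ ((p + 1) * (q + 1)) = -(-1 : ℝ) ^ p := by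
      rw [mul_comm, pow_mul, (hq.add_one).neg_one_pow, pow_succ]; ring
    rw [this]
    have h0 : comp (0 : ListOp A) P = 0 := by simpa using comp_smul_left (P := P) (Q := P) 0
    rw [h0]; module
  · rw [(hQ.od_eq hq).1, (hQ.od_eq hq).2]
    have : (-1 : ℝ) ^ ((p + 1) * (q + 1)) = 1 := by
      rw [mul_comm, pow_mul, (hq.add_one).neg_one_pow, one_pow]
    rw [this]
    have h0 : comp (0 : ListOp A) (tw P) = 0 := by
      simpa using comp_smul_left (P := P) (Q := tw P) 0
    rw [h0]; module

end ListOp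

end ListOp

end OhPark

namespace OhPark

section ListOp

variable {A : Type*} [CommRing A] [Algebra ℝ A]

namespace ListOp

variable {P P' Q Q' R : ListOp A} {v u : A} {t : List A}

/-! #### The Jacobi identity -/

/-- The associator of the composition product. -/
def assoc (P Q R : ListOp A) : ListOp A := comp (comp P Q) R - comp P (comp Q R)

/-- The first argument enters one of the three operations, with the sign of the operations it
passes; both composites in the associator obey this recursion. -/
lemma assoc_cons {q r : ℕ} (hP : AltLin P) (hQ : AltLin Q) (hqQ : Par q Q) (hrR : Par r R) :
    assoc P Q R (v :: t) = assoc P Q (fix v R) t - (-1 : ℝ) ^ r • assoc P (fix v Q) R t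
      + (-1 : ℝ) ^ (q + r) • assoc (fix v P) Q R t := by
  have h1 : fix v (comp P Q) = comp P (fix v Q) - (-1 : ℝ) ^ q • comp (fix v P) Q := by
    rw [fix_comp, hqQ.tw_eq, comp_smul_right (hP.fix v)]
  have h2 : fix v (comp Q R) = comp Q (fix v R) - (-1 : ℝ) ^ r • comp (fix v Q) R := by
    rw [fix_comp, hrR.tw_eq, comp_smul_right (hQ.fix v)]
  have h3 : tw (comp Q R) = (-1 : ℝ) ^ (q + r + 1) • comp Q R := hqQ.comp hrR hQ
  have hPQ := hP.comp hQ
  simp only [assoc, Pi.sub_apply]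
  rw [comp_cons (P := comp P Q), comp_cons (P := P), h2, h1, h3, hrR.tw_eq, comp_sub_right hP,
    comp_smul_right (AltLin.sub (hP.comp (hQ.fix v)) (((hP.fix v).comp hQ).smul' _)),
    comp_sub_left, comp_smul_left, comp_smul_right hP, comp_smul_right (hP.fix v)]
  simp only [Pi.sub_apply, Pi.smul_apply]
  module

/-- Composition is a graded pre-Lie product: only the terms in which `Q` and `R` fill two different
slots of `P` survive in the associator, and these are symmetric up to sign. Without arguments the
associator is `-P [R [], Q []]`, and the recursion does the rest. -/
lemma assoc_symm {q r : ℕ} (hP : AltLin P) (hQ : AltLin Q) (hR : AltLin R) (hqQ : Par q Q)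
    (hrR : Par r R) :
    assoc P Q R = (-1 : ℝ) ^ ((q + 1) * (r + 1)) • assoc P R Q := by
  funext t
  induction t generalizing P Q R q r with
  | nil =>
    have e : ∀ Q R : ListOp A, assoc P Q R [] = -P [R [], Q []] := by
      intro Q R
      simp only [assoc, Pi.sub_apply, comp_nil, comp_cons, fix, tw, List.length_nil, pow_zero,
        one_smul]
      ring
    rw [Pi.smul_apply, e, e]
    rcases Nat.even_or_odd q with hq | hq
    · rcases Nat.even_or_odd r with hr | hr
      · have := hP.alt [] (R []) (Q []) []
        simp only [List.nil_append] at this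
        rw [this, (hq.add_one.mul hr.add_one).neg_one_pow]; simp
      · rw [hrR.nil hr, hP.apply_zero, ← fix_apply (Q := P), (hP.fix (Q [])).apply_zero]; simp
    · rw [hqQ.nil hq, hP.apply_zero, ← fix_apply (Q := P), (hP.fix (R [])).apply_zero]; simp
  | cons v t ih =>
    rw [Pi.smul_apply, assoc_cons hP hQ hqQ hrR, assoc_cons hP hR hrR hqQ,
      ih hP hQ (hR.fix v) hqQ (hrR.fix v), ih hP (hQ.fix v) hR (hqQ.fix v) hrR,
      ih (hP.fix v) hQ hR hqQ hrR]
    simp only [Pi.smul_apply, smul_sub, smul_add, smul_smul, ← pow_add]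
    have e1 : (-1 : ℝ) ^ ((q + 1) * (r + 1 + 1)) = -(-1 : ℝ) ^ ((q + 1) * (r + 1) + q) := by
      rw [show (q + 1) * (r + 1 + 1) = (q + 1) * (r + 1) + q + 1 by ring, pow_succ]; ring
    have e2 : (-1 : ℝ) ^ (r + (q + 1 + 1) * (r + 1)) = -(-1 : ℝ) ^ ((q + 1) * (r + 1)) := by
      rw [show r + (q + 1 + 1) * (r + 1) = (q + 1) * (r + 1) + (2 * r + 1) by ring, pow_add,
        (odd_two_mul_add_one r).neg_one_pow]; ring
    have e3 : (-1 : ℝ) ^ ((q + 1) * (r + 1) + (r + q)) =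
        (-1 : ℝ) ^ (q + r + (q + 1) * (r + 1)) := by congr 1; ring
    rw [e1, e2, e3]
    module

lemma AltLin.br (hP : AltLin P) (hQ : AltLin Q) : AltLin (br P Q) :=
  ((hP.comp hQ).sub (hQ.od.comp hP)).add' (hQ.ev.comp hP.tw)

lemma Par.br {p q : ℕ} (hP : Par p P) (hQ : Par q Q) (hl : AltLin P) (hl' : AltLin Q) :
    Par (p + q + 1) (br P Q) := by
  rw [br_eq hP hQ hl']
  refine (hP.comp hQ hl).sub (Par.smul' ?_ _)
  rw [add_comm p q]
  exact hQ.comp hP hl'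

lemma Hom.br {p q : ℕ} (hP : Hom p P) (hQ : Hom q Q) (hl : AltLin P) (hl' : AltLin Q) :
    Hom (p + q - 1) (br P Q) := by
  intro t ht
  rw [br_eq hP.par hQ.par hl', Pi.sub_apply, Pi.smul_apply, hP.comp hQ hl t ht,
    hQ.comp hP hl' t (by omega)]
  simp

lemma Bdd.br {p q : ℤ} (hP : Bdd p P) (hQ : Bdd q Q) (hl : AltLin P) (hl' : AltLin Q) :
    Bdd (p + q - 1) (br P Q) := by
  intro t ht
  have h1 : Bdd q (od Q) := fun s hs => by simp [od, hQ s hs]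
  have h2 : Bdd q (ev Q) := fun s hs => by simp [ev, hQ s hs]
  simp only [ListOp.br, Pi.add_apply, Pi.sub_apply]
  rw [hP.comp hQ hl t ht, h1.comp hP hl'.od t (by omega), h2.comp hP.tw hl'.ev t (by omega)]
  simp

lemma ev_add : ev (Q + Q') = ev Q + ev Q' := by
  funext t; by_cases h : Even t.length <;> simp [ev, h]

lemma od_add : od (Q + Q') = od Q + od Q' := by
  funext t; by_cases h : Even t.length <;> simp [od, h]

lemma ev_smul (r : ℝ) : ev (r • Q) = r • ev Q := by
  funext t; by_cases h : Even t.length <;> simp [ev, h]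

lemma od_smul (r : ℝ) : od (r • Q) = r • od Q := by
  funext t; by_cases h : Even t.length <;> simp [od, h]

lemma ev_add_od : ev Q + od Q = Q := by
  funext t; by_cases h : Even t.length <;> simp [ev, od, h]

lemma par_ev : Par 0 (ev Q) := by
  funext t; by_cases h : Even t.length <;> simp [ev, tw, h]

lemma par_od : Par 1 (od Q) := by
  funext t; by_cases h : Even t.length <;> simp [od, tw, h]
  rw [(Nat.not_even_iff_odd.1 h).neg_one_pow, neg_one_smul]

lemma br_add_right (hP : AltLin P) :
    br P (Q + Q') = br P Q + br P Q' := by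
  simp only [br, comp_add_right hP, ev_add, od_add, comp_add_left]; abel

lemma br_add_left (hQ : AltLin Q) : br (P + P') Q = br P Q + br P' Q := by
  simp only [br, comp_add_right hQ.od, comp_add_right hQ.ev, tw_add, comp_add_left]; abel

lemma br_smul_right (hP : AltLin P) (r : ℝ) : br P (r • Q) = r • br P Q := by
  simp only [br, comp_smul_right hP, ev_smul, od_smul, comp_smul_left]; module

lemma br_smul_left (hQ : AltLin Q) (r : ℝ) : br (r • P) Q = r • br P Q := by
  simp only [br, comp_smul_right hQ.od, comp_smul_right hQ.ev, tw_smul, comp_smul_left]; module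

lemma br_symm {p q : ℕ} (hP : Par p P) (hQ : Par q Q) (hlP : AltLin P) (hlQ : AltLin Q) :
    br P Q = -((-1 : ℝ) ^ ((p + 1) * (q + 1)) • br Q P) := by
  rw [br_eq hP hQ hlQ, br_eq hQ hP hlP, smul_sub, smul_smul, mul_comm (q + 1), ← pow_add,
    Even.neg_one_pow ⟨_, rfl⟩]
  module

/-- As for every graded pre-Lie product, expanding the commutators leaves six associators, which
cancel in pairs by `assoc_symm`. -/
lemma jacobi {p q r : ℕ} (hP : Par p P) (hQ : Par q Q) (hR : Par r R)
    (lP : AltLin P) (lQ : AltLin Q) (lR : AltLin R) :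
    br P (br Q R) = br (br P Q) R + (-1 : ℝ) ^ ((p + 1) * (q + 1)) • br Q (br P R) := by
  rw [br_eq hP (hQ.br hR lQ lR) (lQ.br lR), br_eq (hP.br hQ lP lQ) hR lR,
    br_eq hQ (hP.br hR lP lR) (lP.br lR), br_eq hQ hR lR, br_eq hP hR lR, br_eq hP hQ lQ]
  have a1 := assoc_symm lP lQ lR hQ hR
  have a2 := assoc_symm lQ lP lR hP hR
  have a3 := assoc_symm lR lP lQ hP hQ
  simp only [assoc] at a1 a2 a3
  simp only [comp_sub_right lP, comp_sub_right lQ, comp_sub_right lR, comp_sub_left,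
    comp_smul_left, comp_smul_right lP, comp_smul_right lQ, comp_smul_right lR]
  rw [show (p + 1) * (q + r + 1 + 1) = (p + 1) * (q + 1) + (p + 1) * (r + 1) by ring,
    show (p + q + 1 + 1) * (r + 1) = (p + 1) * (r + 1) + (q + 1) * (r + 1) by ring,
    show (q + 1) * (p + r + 1 + 1) = (p + 1) * (q + 1) + (q + 1) * (r + 1) by ring, pow_add,
    pow_add, pow_add]
  generalize (-1 : ℝ) ^ ((p + 1) * (r + 1)) = b at *
  generalize (-1 : ℝ) ^ ((q + 1) * (r + 1)) = c at *
  rcases neg_one_pow_eq_or ℝ ((p + 1) * (q + 1)) with ha | ha <;> rw [ha] at a3 ⊢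
  · linear_combination (norm := module) (-1 : ℝ) • a1 + (1 : ℝ) • a2 - (b * c) • a3
  · linear_combination (norm := module) (-1 : ℝ) • a1 - (1 : ℝ) • a2 - (b * c) • a3

end ListOp

end ListOp

end OhPark

namespace OhPark

section ListOp

variable {A : Type*} [CommRing A] [Algebra ℝ A]

namespace ListOp

variable {P P' Q Q' R : ListOp A} {v u : A} {t : List A}

/-! #### The bracket of multiderivations -/

lemma wedge_neg_right : wedge t P (-Q) = -wedge t P Q := by
  induction t generalizing P Q with
  | nil => simp [wedge]
  | cons v t ih => simp only [wedge, fix_neg, ih]; ring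

lemma wedge_smul_left (r : ℝ) : wedge t (r • P) Q = r • wedge t P Q := by
  induction t generalizing P Q with
  | nil => simp [wedge]
  | cons v t ih => simp only [wedge, fix_smul, tw_smul, ih, smul_add]

lemma wedge_comm {p q : ℕ} (hP : Par p P) (hQ : Par q Q) :
    wedge t P Q = (-1 : ℝ) ^ (p * q) • wedge t Q P := by
  induction t generalizing P Q p q with
  | nil =>
    simp only [wedge]
    rcases Nat.even_or_odd p with hp | hp
    · rw [(hp.mul_right q).neg_one_pow, one_smul, mul_comm]
    · rw [hP.nil hp]; simp
  | cons v t ih =>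
    simp only [wedge]
    rw [ih (hP.fix v) hQ, hP.tw_eq, hQ.tw_eq, wedge_smul_left, wedge_smul_left,
      ih hP (hQ.fix v), smul_add, smul_smul, smul_smul, ← pow_add, ← pow_add, add_comm]
    congr 2
    · rw [show p + p * (q + 1) = p * q + 2 * p by ring, pow_add, pow_mul]; simp
    · congr 1; ring

lemma comp_ring_smul_left (f : A) : comp (f • P) Q = f • comp P Q := by
  funext t
  induction t generalizing P Q with
  | nil => rfl
  | cons v t ih =>
    have e : fix v (f • P) = f • fix v P := rfl
    simp only [Pi.smul_apply, comp_cons, smul_eq_mul, e] at ih ⊢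
    rw [ih, ih]; ring

/-- The slot of `P` that holds `f • Q` differentiates either `Q` or the coefficient `f`; the latter
leaves an exterior product of `Q` with `fix f P`. -/
lemma comp_ring_smul_right (hP : MultiDer P) (f : A) :
    comp P (f • Q) t = f * comp P Q t + wedge t Q (fix f P) := by
  induction t generalizing P Q with
  | nil => exact hP.mul f (Q []) []
  | cons v t ih =>
    have e : fix v (f • Q) = f • fix v Q := rfl
    have e' : tw (f • Q) = f • tw Q := by funext t; simp [tw]
    rw [comp_cons, comp_cons, e, e', ih hP, ih (hP.fix v), hP.toAltLin.fix_fix f v,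
      wedge_neg_right]
    simp only [wedge]; ring

/-- A composite of multiderivations is of second order: one factor can be differentiated by the
inner operation and the other by the outer one. The two exterior products measure this failure of
the Leibniz rule. -/
lemma comp_mul (hP : MultiDer P) (hQ : MultiDer Q) :
    comp P Q ((u * v) :: t) = u * comp P Q (v :: t) + v * comp P Q (u :: t)
      + wedge t (fix v Q) (fix u P) + wedge t (fix u Q) (fix v P) := by
  have h : ∀ {Q : ListOp A}, MultiDer Q → fix (u * v) Q = u • fix v Q + v • fix u Q :=
    fun hQ => by funext t; exact hQ.mul u v t
  rw [comp_cons, h hQ, h hP, comp_add_left, comp_add_right hP.toAltLin]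
  simp only [Pi.add_apply, comp_cons, comp_ring_smul_right hP, comp_ring_smul_left, Pi.smul_apply,
    smul_eq_mul]
  ring

lemma MultiDer.ev (h : MultiDer Q) : MultiDer (ev Q) where
  toAltLin := h.toAltLin.ev
  mul a b t := by simp only [ListOp.ev]; rw [h.mul]; simp; split_ifs <;> simp

lemma MultiDer.od (h : MultiDer Q) : MultiDer (od Q) where
  toAltLin := h.toAltLin.od
  mul a b t := by simp only [ListOp.od]; rw [h.mul]; simp; split_ifs <;> simp

/-- The defects of the two composites are the same exterior products in opposite order, so
`wedge_comm` cancels them in the graded commutator. -/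
lemma MultiDer.br_of_par {p q : ℕ} (hP : MultiDer P) (hQ : MultiDer Q) (pP : Par p P)
    (pQ : Par q Q) : MultiDer (br P Q) where
  toAltLin := hP.toAltLin.br hQ.toAltLin
  mul u v t := by
    rw [br_eq pP pQ hQ.toAltLin]
    simp only [Pi.sub_apply, Pi.smul_apply]
    rw [comp_mul hP hQ, comp_mul hQ hP, wedge_comm (pQ.fix v) (pP.fix u),
      wedge_comm (pQ.fix u) (pP.fix v), mul_comm (q + 1)]
    simp only [smul_add, mul_sub, mul_smul_comm]
    ring

lemma MultiDer.br (hP : MultiDer P) (hQ : MultiDer Q) : MultiDer (br P Q) := by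
  rw [← ev_add_od (Q := P), ← ev_add_od (Q := Q), br_add_left (hQ.ev.add' hQ.od).toAltLin,
    br_add_right hP.ev.toAltLin, br_add_right hP.od.toAltLin]
  exact ((hP.ev.br_of_par hQ.ev par_ev par_ev).add' (hP.ev.br_of_par hQ.od par_ev par_od)).add'
    ((hP.od.br_of_par hQ.ev par_od par_ev).add' (hP.od.br_of_par hQ.od par_od par_od))

/-! #### Values on generators -/

/-- The derivation obtained by fixing all arguments but the first. -/
def MultiDer.derivation (h : MultiDer Q) (t : List A) : Derivation ℝ A A :=
  Derivation.mk' (⟨⟨fun v => Q (v :: t), fun u v => h.add u v t⟩, fun r v => h.smul r v t⟩ : A →ₗ[ℝ] A)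
    fun a b => h.mul a b t

lemma MultiDer.derivation_apply (h : MultiDer Q) (t : List A) (v : A) :
    h.derivation t v = Q (v :: t) := rfl

/-- If a derivation maps `S'` to `J` as soon as it maps `S` to `J`, then the same holds for
multiderivations. -/
lemma MultiDer.mem_of_generators {S S' J : Set A}
    (H : ∀ D : Derivation ℝ A A, (∀ s ∈ S, D s ∈ J) → ∀ a ∈ S', D a ∈ J)
    (h : MultiDer Q) (hQ : ∀ t : List A, (∀ x ∈ t, x ∈ S) → Q t ∈ J) :
    ∀ t : List A, (∀ x ∈ t, x ∈ S') → Q t ∈ J := by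
  intro t
  induction t generalizing Q with
  | nil => intro _; exact hQ [] (by simp)
  | cons v t ih =>
    intro ht
    rw [← h.derivation_apply t v]
    refine H _ (fun s hs => ?_) v (ht v (by simp))
    rw [h.derivation_apply, ← fix_apply (Q := Q)]
    refine ih (h.fix s) (fun r hr => hQ _ ?_) (fun x hx => ht x (by simp [hx]))
    simpa using ⟨hs, hr⟩

/-- A system of generators of `A`: the elements of `B` are thought of as functions on the base and
those of `L` as fibrewise linear functions on a vector bundle, `I` as the ideal of the zero
section and `F` as the filtration by the fibrewise degree. -/
structure IsGeneratingSystem (B L : Set A) (I : Submodule ℝ A) (F : ℤ → Submodule ℝ A) : Prop where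
  ext : ∀ D : Derivation ℝ A A, (∀ b ∈ B, D b = 0) → (∀ l ∈ L, D l = 0) → ∀ a, D a = 0
  ideal : ∀ D : Derivation ℝ A A, (∀ l ∈ L, D l ∈ I) → ∀ a ∈ I, D a ∈ I
  filtration : ∀ (D : Derivation ℝ A A) (c : ℤ), (∀ b ∈ B, D b ∈ F (c - 1)) →
    (∀ l ∈ L, D l ∈ F c) → ∀ d, ∀ a ∈ F d, D a ∈ F (c + d - 1)
  neg : ∀ d < 0, F d = ⊥
  linear_mem : ∀ l ∈ L, l ∈ I
  disjoint : ∀ a ∈ F 0, a ∈ I → a = 0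

/-- Lists of `k` elements of `B` and any number of elements of `L`. -/
inductive Mixed (B L : Set A) : ℕ → List A → Prop
  | nil : Mixed B L 0 []
  | basic {b : A} {k : ℕ} {t : List A} : b ∈ B → Mixed B L k t → Mixed B L (k + 1) (b :: t)
  | linear {l : A} {k : ℕ} {t : List A} : l ∈ L → Mixed B L k t → Mixed B L k (l :: t)

/-- The coefficients of `Q` are fibrewise polynomial of degree at most `c`. -/
def Deg (B L : Set A) (F : ℤ → Submodule ℝ A) (c : ℤ) (Q : ListOp A) : Prop :=
  ∀ k t, Mixed B L k t → Q t ∈ F (c - k)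

/-- `Q` is tangent to the zero section. -/
def Tangent (I : Submodule ℝ A) (Q : ListOp A) : Prop :=
  ∀ t : List A, (∀ x ∈ t, x ∈ I) → Q t ∈ I

variable {B L : Set A} {I : Submodule ℝ A} {F : ℤ → Submodule ℝ A} {c c' : ℤ}

lemma exists_mixed (h : ∀ x ∈ t, x ∈ B ∪ L) : ∃ k, Mixed B L k t := by
  induction t with
  | nil => exact ⟨0, .nil⟩
  | cons v t ih =>
    obtain ⟨k, hk⟩ := ih fun x hx => h x (by simp [hx])
    rcases h v (by simp) with hv | hv
    exacts [⟨_, .basic hv hk⟩, ⟨_, .linear hv hk⟩]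

lemma Deg.fix_basic (h : Deg B L F c Q) (hv : v ∈ B) : Deg B L F (c - 1) (fix v Q) := by
  intro k t ht
  have := h _ _ (.basic hv ht)
  rwa [Nat.cast_succ, show c - (k + 1 : ℤ) = c - 1 - k by ring] at this

lemma Deg.fix_linear (h : Deg B L F c Q) (hv : v ∈ L) : Deg B L F c (fix v Q) :=
  fun k t ht => h _ _ (.linear hv ht)

lemma Deg.add' (h : Deg B L F c Q) (h' : Deg B L F c Q') : Deg B L F c (Q + Q') :=
  fun k t ht => (F _).add_mem (h k t ht) (h' k t ht)

lemma Deg.sub (h : Deg B L F c Q) (h' : Deg B L F c Q') : Deg B L F c (Q - Q') :=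
  fun k t ht => (F _).sub_mem (h k t ht) (h' k t ht)

lemma Deg.tw (h : Deg B L F c Q) : Deg B L F c (tw Q) :=
  fun k t ht => (F _).smul_mem _ (h k t ht)

lemma Deg.ev (h : Deg B L F c Q) : Deg B L F c (ev Q) := fun k t ht => by
  simp only [ListOp.ev]; split_ifs
  exacts [h k t ht, (F _).zero_mem]

lemma Deg.od (h : Deg B L F c Q) : Deg B L F c (od Q) := fun k t ht => by
  simp only [ListOp.od]; split_ifs
  exacts [(F _).zero_mem, h k t ht]

/-- Each basic argument lowers by one the bound of the operation that receives it. Once all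
arguments are distributed, a derivation is applied to a coefficient, and the filtration axiom costs
the final `-1`. -/
lemma Deg.comp (hS : IsGeneratingSystem B L I F) (hm : MultiDer P) (hP : Deg B L F c P)
    (hQ : Deg B L F c' Q) : Deg B L F (c + c' - 1) (comp P Q) := by
  intro k t ht
  induction ht generalizing P Q c c' with
  | nil =>
    have := hS.filtration (hm.derivation []) c
      (fun b hb => by simpa [MultiDer.derivation_apply] using hP _ _ (.basic hb .nil))
      (fun l hl => by simpa [MultiDer.derivation_apply] using hP _ _ (.linear hl .nil)) c' (Q [])
      (by simpa using hQ _ _ .nil)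
    simpa [comp_nil, MultiDer.derivation_apply] using this
  | @basic b k t hb ht ih =>
    rw [comp_cons]
    have h1 := ih hm hP (hQ.fix_basic hb)
    have h2 := ih (hm.fix b) (hP.fix_basic hb) hQ.tw
    push_cast
    rw [show c + (c' - 1) - 1 - (k : ℤ) = c + c' - 1 - (k + 1) by ring] at h1
    rw [show c - 1 + c' - 1 - (k : ℤ) = c + c' - 1 - (k + 1) by ring] at h2
    exact (F _).sub_mem h1 h2
  | @linear l k t hl ht ih =>
    rw [comp_cons]
    exact (F _).sub_mem (ih hm hP (hQ.fix_linear hl)) (ih (hm.fix l) (hP.fix_linear hl) hQ.tw)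

lemma Deg.br (hS : IsGeneratingSystem B L I F) (hm : MultiDer P) (hm' : MultiDer Q)
    (hP : Deg B L F c P) (hQ : Deg B L F c' Q) : Deg B L F (c + c' - 1) (br P Q) := by
  have h1 := hP.comp hS hm hQ
  have h2 := hQ.od.comp hS hm'.od hP
  have h3 := hQ.ev.comp hS hm'.ev hP.tw
  rw [add_comm c'] at h2 h3
  exact (h1.sub h2).add' h3

/-- All values on generators lie in a negative, hence trivial, step of the filtration, and they
determine a multiderivation. The vanishing of the higher brackets comes from here. -/
lemma Deg.eq_zero (hS : IsGeneratingSystem B L I F) (hm : MultiDer Q) (hQ : Deg B L F c Q)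
    (hc : c < 0) : Q = 0 := by
  have H : ∀ D : Derivation ℝ A A, (∀ s ∈ B ∪ L, D s ∈ ({0} : Set A)) →
      ∀ a ∈ (Set.univ : Set A), D a ∈ ({0} : Set A) :=
    fun D h a _ => hS.ext D (fun b hb => h b (.inl hb)) (fun l hl => h l (.inr hl)) a
  funext t
  refine hm.mem_of_generators H (fun t ht => ?_) t (by simp)
  obtain ⟨k, hk⟩ := exists_mixed ht
  have := hQ k t hk
  rwa [hS.neg _ (by omega), Submodule.mem_bot] at this

/-- A basic argument pushes the value into a negative step of the filtration. On linear arguments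
alone the value is constant along the fibres and vanishes on the zero section. -/
lemma Deg.eq_zero_of_linear (hS : IsGeneratingSystem B L I F) (hm : MultiDer Q)
    (hQ : Deg B L F 0 Q) (h : ∀ t : List A, (∀ x ∈ t, x ∈ L) → Q t ∈ I) : Q = 0 := by
  -- Once all values on generators are known to be zero, every bound holds; any negative one will
  -- do.
  refine Deg.eq_zero (c := -1) hS hm ?_ (by simp)
  have aux : ∀ (k : ℕ) (t : List A), Mixed B L k t → k = 0 → ∀ x ∈ t, x ∈ L := by
    intro k t ht
    induction ht with
    | nil => simp
    | basic _ _ _ => intro h; simp at h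
    | linear hl _ ih => intro h; simpa using ⟨hl, ih h⟩
  intro k t ht
  have h0 := hQ k t ht
  suffices Q t = 0 by rw [this]; exact Submodule.zero_mem _
  rcases Nat.eq_zero_or_pos k with hk | hk
  · subst hk
    exact hS.disjoint _ (by simpa using h0) (h t (aux 0 t ht rfl))
  · rwa [hS.neg _ (by omega), Submodule.mem_bot] at h0

lemma Tangent.fix (h : Tangent I Q) (hv : v ∈ I) : Tangent I (fix v Q) :=
  fun t ht => h _ (by simpa using ⟨hv, ht⟩)

lemma Tangent.smul' (h : Tangent I Q) (r : ℝ) : Tangent I (r • Q) :=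
  fun t ht => I.smul_mem r (h t ht)

lemma Tangent.add' (h : Tangent I Q) (h' : Tangent I Q') : Tangent I (Q + Q') :=
  fun t ht => I.add_mem (h t ht) (h' t ht)

lemma Tangent.sub (h : Tangent I Q) (h' : Tangent I Q') : Tangent I (Q - Q') :=
  fun t ht => I.sub_mem (h t ht) (h' t ht)

lemma Tangent.tw (h : Tangent I Q) : Tangent I (tw Q) :=
  fun t ht => I.smul_mem _ (h t ht)

lemma Tangent.ev (h : Tangent I Q) : Tangent I (ev Q) := fun t ht => by
  simp only [ListOp.ev]; split_ifs
  exacts [h t ht, I.zero_mem]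

lemma Tangent.od (h : Tangent I Q) : Tangent I (od Q) := fun t ht => by
  simp only [ListOp.od]; split_ifs
  exacts [I.zero_mem, h t ht]

lemma Tangent.comp (hP : Tangent I P) (hQ : Tangent I Q) : Tangent I (comp P Q) := by
  intro t
  induction t generalizing P Q with
  | nil => intro _; exact hP _ (by simpa using hQ [] (by simp))
  | cons v t ih =>
    intro ht
    have hv := ht v (by simp)
    have ht' : ∀ x ∈ t, x ∈ I := fun x hx => ht x (by simp [hx])
    rw [comp_cons]
    exact I.sub_mem (ih hP (hQ.fix hv) ht') (ih (hP.fix hv) hQ.tw ht')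

lemma Tangent.br (hP : Tangent I P) (hQ : Tangent I Q) : Tangent I (br P Q) :=
  ((hP.comp hQ).sub (hQ.od.comp hP)).add' (hQ.ev.comp hP.tw)

/-- For a derivation this is the axiom `ideal`; a multiderivation is treated one slot at a time. -/
lemma Tangent.of_linear (hS : IsGeneratingSystem B L I F) (hm : MultiDer Q)
    (h : ∀ t : List A, (∀ x ∈ t, x ∈ L) → Q t ∈ I) : Tangent I Q :=
  hm.mem_of_generators (S := L) (S' := I) (J := I) (fun D hD => hS.ideal D hD) h

end ListOp

end ListOp

end OhPark

namespace OhPark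

/-! ### Derived brackets of a Poisson bivector on commuting vertical fields. -/

section DerivedBrackets

variable {A : Type*} [CommRing A] [Algebra ℝ A] {L : ℕ → Type*} [∀ k, AddCommGroup (L k)]
  [∀ k, Module ℝ (L k)]

open ListOp

/-- The data from which the derived brackets of a bivector `Λ` on the graded space `⨁ L_k` of
vertical multivector fields are formed. -/
structure IsDerivedBracketData (B Ls : Set A) (I : Submodule ℝ A) (F : ℤ → Submodule ℝ A)
    (Λ : ListOp A) (V : (⨁ k, L k) →ₗ[ℝ] ListOp A) : Prop
    extends IsGeneratingSystem B Ls I F where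
  multiDer : MultiDer Λ
  hom : Hom 2 Λ
  deg : Deg B Ls F 2 Λ
  tangent : Tangent I Λ
  poisson : br Λ Λ = 0
  multiDer_vert : ∀ ξ, MultiDer (V ξ)
  deg_vert : ∀ ξ, Deg B Ls F 0 (V ξ)
  hom_vert : ∀ k (a : L k), Hom k (V (.lof ℝ ℕ L k a))
  homogeneous : ∀ k ξ, (∀ t : List A, (∀ x ∈ t, x ∈ Ls) → t.length ≠ k → V ξ t ∈ I) →
    ∃ a, ξ = .lof ℝ ℕ L k a
  injective : ∀ ξ, (∀ t : List A, (∀ x ∈ t, x ∈ Ls) → V ξ t ∈ I) → ξ = 0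

namespace IsDerivedBracketData

variable {B Ls : Set A} {I : Submodule ℝ A} {F : ℤ → Submodule ℝ A} {Λ : ListOp A}
  {V : (⨁ k, L k) →ₗ[ℝ] ListOp A} (h : IsDerivedBracketData B Ls I F Λ V)

include h

lemma deg_hamiltonian (ξ : ⨁ k, L k) : Deg B Ls F 1 (br Λ (V ξ)) := by
  have := h.deg.br h.toIsGeneratingSystem h.multiDer (h.multiDer_vert ξ) (h.deg_vert ξ)
  norm_num at this; exact this

lemma multiDer_hamiltonian (ξ : ⨁ k, L k) : MultiDer (br Λ (V ξ)) :=
  h.multiDer.br (h.multiDer_vert ξ)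

/-- The degree is `0 + 0 - 1 < 0`: vertical fields that are constant along the fibres commute. -/
lemma br_vert_vert (ξ η : ⨁ k, L k) : br (V ξ) (V η) = 0 := by
  have := (h.deg_vert ξ).br h.toIsGeneratingSystem (h.multiDer_vert ξ) (h.multiDer_vert η)
    (h.deg_vert η)
  exact this.eq_zero h.toIsGeneratingSystem ((h.multiDer_vert ξ).br (h.multiDer_vert η))
    (by norm_num)

lemma deg_br_br (ξ η : ⨁ k, L k) : Deg B Ls F 0 (br (br Λ (V ξ)) (V η)) := by
  have := (h.deg_hamiltonian ξ).br h.toIsGeneratingSystem (h.multiDer_hamiltonian ξ)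
    (h.multiDer_vert η) (h.deg_vert η)
  norm_num at this; exact this

lemma multiDer_br_br (ξ η : ⨁ k, L k) : MultiDer (br (br Λ (V ξ)) (V η)) :=
  (h.multiDer_hamiltonian ξ).br (h.multiDer_vert η)

/-- From degree 2 of `Λ`, every bracket with a vertical field lowers the degree by one; the third
one reaches `-1`. -/
lemma br_br_br (ξ η ζ : ⨁ k, L k) : br (br (br Λ (V ξ)) (V η)) (V ζ) = 0 := by
  have := (h.deg_br_br ξ η).br h.toIsGeneratingSystem (h.multiDer_br_br ξ η)
    (h.multiDer_vert ζ) (h.deg_vert ζ)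
  exact this.eq_zero h.toIsGeneratingSystem ((h.multiDer_br_br ξ η).br (h.multiDer_vert ζ))
    (by norm_num)

/-- The brackets with `Λ` of homogeneous vertical multivector fields satisfy `[Λ, [Λ, a]] = 0`. -/
lemma br_br_self {q : ℕ} {Q : ListOp A} (hQ : AltLin Q) (hp : Par q Q) : br Λ (br Λ Q) = 0 := by
  have j := jacobi h.hom.par h.hom.par hp h.multiDer.toAltLin h.multiDer.toAltLin hQ
  have hz : br (0 : ListOp A) Q = 0 := by
    simpa using br_smul_left (P := (0 : ListOp A)) hQ 0
  rw [h.poisson, hz] at j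
  norm_num at j
  -- The Jacobi sign is `(-1)^((2+1)(2+1)) = -1`, so the double bracket is its own negative.
  have h2 : (2 : ℝ) • br Λ (br Λ Q) = 0 := by
    rw [two_smul]; nth_rw 1 [j]; simp
  simpa using h2

variable {lam₁ : MultilinearMap ℝ (fun _ : Fin 1 => ⨁ k, L k) (⨁ k, L k)}
  {lam₂ : MultilinearMap ℝ (fun _ : Fin 2 => ⨁ k, L k) (⨁ k, L k)}

/-- The difference has degree 0 and its values on linear functions vanish on the zero section. So
the binary bracket is the double bracket itself, not merely a projection of it. -/
lemma br_br_eq (h₂ : ∀ ξ η, ∀ t : List A, (∀ x ∈ t, x ∈ Ls) →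
      br (br Λ (V ξ)) (V η) t - V (lam₂ ![ξ, η]) t ∈ I) (ξ η : ⨁ k, L k) :
    br (br Λ (V ξ)) (V η) = V (lam₂ ![ξ, η]) :=
  sub_eq_zero.1 <| Deg.eq_zero_of_linear h.toIsGeneratingSystem
    ((h.multiDer_br_br ξ η).sub (h.multiDer_vert _)) ((h.deg_br_br ξ η).sub (h.deg_vert _))
    (h₂ ξ η)

/-- The binary bracket is a double bracket exactly, whereas `d` is the bracket with `Λ` up to a
field tangent to the zero section. Tangent fields are closed under the bracket, `Λ` is one of them,
and a vertical field which is tangent is zero, so identities may be proved modulo tangent fields. -/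
theorem isDGLA
    (h₁ : ∀ ξ, ∀ t : List A, (∀ x ∈ t, x ∈ Ls) →
      br Λ (V ξ) t - V (lam₁ fun _ => ξ) t ∈ I)
    (h₂ : ∀ ξ η, ∀ t : List A, (∀ x ∈ t, x ∈ Ls) →
      br (br Λ (V ξ)) (V η) t - V (lam₂ ![ξ, η]) t ∈ I) :
    IsDGLA (differential lam₁) (shiftedBracket lam₂) := by
  have h₂' := h.br_br_eq h₂
  set d := differential lam₁ with hd
  set b := shiftedBracket lam₂ with hb
  have alV : ∀ ξ, AltLin (V ξ) := fun ξ => (h.multiDer_vert ξ).toAltLin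
  have alP := h.multiDer.toAltLin
  have alN : ∀ ξ, AltLin (br Λ (V ξ)) := fun ξ => alP.br (alV ξ)
  have parV : ∀ k (a : L k), Par k (V (.lof ℝ ℕ L k a)) := fun k a => (h.hom_vert k a).par
  have parN : ∀ k (a : L k), Par (k + 1) (br Λ (V (.lof ℝ ℕ L k a))) := fun k a =>
    (h.hom.par.br (parV k a) alP (alV _)).congr ⟨k + 2, by ring⟩
  have sgn : ∀ k (a : L k), degreeSign (.lof ℝ ℕ L k a) = (-1 : ℝ) ^ k • .lof ℝ ℕ L k a := by
    intro k a
    simp [degreeSign, DirectSum.lmap_lof]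
  have Vb : ∀ k (a : L k) (η : ⨁ k, L k), V (b (.lof ℝ ℕ L k a) η) =
      (-1 : ℝ) ^ k • br (br Λ (V (.lof ℝ ℕ L k a))) (V η) := by
    intro k a η
    have : b (.lof ℝ ℕ L k a) η = lam₂ ![degreeSign (.lof ℝ ℕ L k a), η] := rfl
    rw [this, ← h₂', sgn, map_smul, br_smul_right alP, br_smul_left (alV _)]
  have Vd : ∀ ξ, Tangent I (br Λ (V ξ) - V (d ξ)) := fun ξ =>
    Tangent.of_linear h.toIsGeneratingSystem
      ((h.multiDer_hamiltonian ξ).sub (h.multiDer_vert _)) (h₁ ξ)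
  have inj : ∀ ξ η, V ξ = V η → ξ = η := fun ξ η e => by
    refine sub_eq_zero.1 (h.injective _ fun t _ => ?_)
    rw [map_sub, e, sub_self]; exact I.zero_mem
  have injT : ∀ ξ, Tangent I (br Λ (V ξ)) → d ξ = 0 := by
    intro ξ hT
    refine h.injective _ fun t ht => ?_
    have := I.sub_mem (hT t fun x hx => h.linear_mem x (ht x hx)) (h₁ ξ t ht)
    rwa [sub_sub_cancel] at this
  have injV : ∀ ξ η, Tangent I (V ξ - V η) → ξ = η := fun ξ η hT => by
    refine sub_eq_zero.1 (h.injective _ fun t ht => ?_)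
    rw [map_sub]
    exact hT t fun x hx => h.linear_mem x (ht x hx)
  -- The Jacobi identity for `Λ` and two commuting vertical fields.
  have symm : ∀ k l (a : L k) (c : L l),
      br (br Λ (V (.lof ℝ ℕ L k a))) (V (.lof ℝ ℕ L l c)) =
        (-1 : ℝ) ^ ((k + 1) * (l + 1)) • br (br Λ (V (.lof ℝ ℕ L l c))) (V (.lof ℝ ℕ L k a)) := by
    intro k l a c
    have j := jacobi h.hom.par (parV k a) (parV l c) alP (alV _) (alV _)
    have hz : br Λ (0 : ListOp A) = 0 := by simpa using br_smul_right (Q := (0 : ListOp A)) alP 0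
    rw [h.br_vert_vert, hz, br_symm (parV k a) (parN l c) (alV _) (alN _), smul_neg, smul_smul,
      ← sub_eq_add_neg, eq_comm, sub_eq_zero] at j
    rw [j, ← pow_add]
    congr 1
    rw [show (2 + 1) * (k + 1) + (k + 1) * (l + 1 + 1) = (k + 1) * (l + 1) + 2 * (2 * (k + 1)) by
      ring, pow_add, pow_mul _ 2]
    simp
  -- Bracketing with `Λ` carries the derived bracket to the bracket of the Hamiltonian fields,
  -- because `[Λ, [Λ, a]] = 0`.
  have NN : ∀ k l (a : L k) (c : L l), br Λ (V (b (.lof ℝ ℕ L k a) (.lof ℝ ℕ L l c))) =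
      br (br Λ (V (.lof ℝ ℕ L k a))) (br Λ (V (.lof ℝ ℕ L l c))) := by
    intro k l a c
    have j := jacobi h.hom.par (parN k a) (parV l c) alP (alN _) (alV _)
    have hz : ∀ Q : ListOp A, AltLin Q → br (0 : ListOp A) Q = 0 := fun Q hQ => by
      simpa using br_smul_left (P := (0 : ListOp A)) hQ 0
    rw [h.br_br_self (alV _) (parV k a), hz _ (alV _), zero_add] at j
    rw [Vb, br_smul_right alP, j, smul_smul, ← pow_add,
      show k + (2 + 1) * (k + 1 + 1) = 2 * (2 * k + 3) by ring, pow_mul]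
    simp
  have homN : ∀ k (a : L k), Hom ((k + 1 : ℕ) : ℤ) (br Λ (V (.lof ℝ ℕ L k a))) := fun k a => by
    have := h.hom.br (p := 2) (h.hom_vert k a) alP (alV _)
    rwa [show ((2 : ℕ) : ℤ) + k - 1 = ((k + 1 : ℕ) : ℤ) by push_cast; ring] at this
  have degd : ∀ k (a : L k), ∃ a', d (.lof ℝ ℕ L k a) = .lof ℝ ℕ L (k + 1) a' := by
    intro k a
    refine h.homogeneous _ _ fun t ht hk => ?_
    have := h₁ (.lof ℝ ℕ L k a) t ht
    rw [homN k a t (by exact_mod_cast hk), zero_sub] at this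
    exact neg_mem_iff.1 this
  have degb : ∀ k l (a : L k) (c : L l), ∃ c',
      b (.lof ℝ ℕ L k a) (.lof ℝ ℕ L l c) = .lof ℝ ℕ L (k + l) c' := by
    intro k l a c
    refine h.homogeneous _ _ fun t ht hk => ?_
    rw [Vb, Pi.smul_apply, (homN k a).br (h.hom_vert l c) (alN _) (alV _) t
      (by push_cast; omega), smul_zero]
    exact I.zero_mem
  refine ⟨degd, degb, ?_, ?_, ?_, ?_⟩
  · intro ξ
    induction ξ using DirectSum.induction_on with
    | zero => simp
    | add x y hx hy => rw [map_add, map_add, hx, hy, add_zero]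
    | of k a =>
      rw [← DirectSum.lof_eq_of ℝ]
      refine injT _ ?_
      have h0 := h.br_br_self (alV _) (parV k a)
      -- `[Λ, [Λ, a] - V(d a)]` is tangent and its first term is zero, so `[Λ, V(d a)]` is tangent
      -- and projects to zero.
      have h3 := h.tangent.br (Vd (.lof ℝ ℕ L k a))
      rw [sub_eq_add_neg, br_add_right alP, h0, zero_add, ← neg_one_smul ℝ, br_smul_right alP]
        at h3
      simpa using h3.smul' (-1)
  · intro k l a c
    refine inj _ _ ?_
    rw [map_neg, map_smul, Vb, Vb, symm, smul_smul, smul_smul, ← pow_add, ← pow_add, ← neg_smul]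
    congr 1
    rw [show k + (k + 1) * (l + 1) = (k * l + l + 1) + 2 * k by ring, pow_add, pow_mul]
    simp [pow_succ]
  · intro k a η
    induction η using DirectSum.induction_on with
    | zero => simp
    | add x y hx hy => simp only [map_add, hx, hy, smul_add]; abel
    | of l c =>
      rw [← DirectSum.lof_eq_of ℝ]
      refine injV _ _ ?_
      obtain ⟨a', ha'⟩ := degd k a
      set x := DirectSum.lof ℝ ℕ L k a with hx
      set y := DirectSum.lof ℝ ℕ L l c with hy
      have ra := Vd x
      have rb := Vd y
      have rab := Vd (b x y)
      have e1 : V (b (d x) y) = br (V (d x)) (br Λ (V y)) := by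
        rw [ha', Vb, symm, br_symm (parV _ a') (parN l c) (alV _) (alN _), smul_smul, ← pow_add,
          ← neg_smul]
        congr 1
        rw [show (k + 1 + 1) * (l + 1 + 1) = (k + 1 + (k + 1 + 1) * (l + 1)) + 1 by ring, pow_succ]
        ring
      have e2 : (-1 : ℝ) ^ k • V (b x (d y)) = br (br Λ (V x)) (V (d y)) := by
        rw [Vb, smul_smul, ← pow_add, Even.neg_one_pow ⟨k, rfl⟩, one_smul]
      -- Since vertical fields commute, only the two Leibniz terms remain besides the bracket of the
      -- two errors, which is tangent.
      have e3 : br (br Λ (V x)) (br Λ (V y)) = br (br Λ (V x)) (V (d y)) +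
          br (V (d x)) (br Λ (V y)) + br (br Λ (V x) - V (d x)) (br Λ (V y) - V (d y)) := by
        have neg1 : ∀ Q : ListOp A, br (V (d x)) (-Q) = -br (V (d x)) Q := fun Q => by
          simpa using br_smul_right (Q := Q) (alV (d x)) (-1)
        rw [sub_eq_add_neg (br Λ (V x)), sub_eq_add_neg (br Λ (V y)),
          br_add_left ((alN y).add' (alV _).neg), br_add_right (alN x), ← neg_one_smul ℝ (V (d x)),
          br_smul_left ((alN y).add' (alV _).neg), br_add_right (alV _), neg1,
          h.br_vert_vert, ← neg_one_smul ℝ (V (d y)), br_smul_right (alN x)]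
        module
      have e4 := (ra.br rb).sub rab
      rw [NN, e3] at e4
      rw [map_add, map_smul, e1, e2]
      have e5 : V (d (b x y)) - (br (V (d x)) (br Λ (V y)) + br (br Λ (V x)) (V (d y))) =
        br (br Λ (V x) - V (d x)) (br Λ (V y) - V (d y)) -
          (br (br Λ (V x)) (V (d y)) + br (V (d x)) (br Λ (V y)) +
            br (br Λ (V x) - V (d x)) (br Λ (V y) - V (d y)) - V (d (b x y))) := by abel
      rw [e5]; exact e4
  · intro k l a c η
    induction η using DirectSum.induction_on with
    | zero => simp
    | add x y hx hy => simp only [map_add, hx, hy, smul_add]; abel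
    | of r e =>
      rw [← DirectSum.lof_eq_of ℝ]
      refine inj _ _ ?_
      obtain ⟨c', hc'⟩ := degb k l a c
      -- Double brackets being exact, the Jacobi identity is that of the two Hamiltonian fields and
      -- one vertical field.
      have j := jacobi (parN k a) (parN l c) (parV r e) (alN _) (alN _) (alV _)
      have N3 : br (br (br Λ (V (.lof ℝ ℕ L k a))) (br Λ (V (.lof ℝ ℕ L l c))))
          (V (.lof ℝ ℕ L r e)) =
          (-1 : ℝ) ^ (k + l) • V (b (b (.lof ℝ ℕ L k a) (.lof ℝ ℕ L l c)) (.lof ℝ ℕ L r e)) := by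
        rw [← NN, hc', Vb, smul_smul, ← pow_add, Even.neg_one_pow ⟨_, rfl⟩, one_smul]
      have M3 : ∀ k l (a : L k) (c : L l), V (b (.lof ℝ ℕ L k a) (b (.lof ℝ ℕ L l c)
          (.lof ℝ ℕ L r e))) = (-1 : ℝ) ^ (k + l) • br (br Λ (V (.lof ℝ ℕ L k a)))
            (br (br Λ (V (.lof ℝ ℕ L l c))) (V (.lof ℝ ℕ L r e))) := by
        intro k l a c
        rw [Vb, Vb, br_smul_right (alN _), smul_smul, pow_add]
      rw [map_add, map_smul, M3, M3, j, N3, smul_add, smul_smul, smul_smul, smul_smul,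
        ← pow_add, ← pow_add, ← pow_add, Even.neg_one_pow (n := (k + l) + (k + l)) ⟨_, rfl⟩, one_smul,
        show k + l + (k + 1 + 1) * (l + 1 + 1) = k * l + (l + k) + 2 * (k + l + 2) by ring,
        pow_add, pow_mul _ 2]
      simp

end IsDerivedBracketData

end DerivedBrackets

end OhPark

namespace OhPark

/-! ### From the recursion over shuffles to sums over all permutations. -/

section Antisymmetrization

variable {A : Type*} [CommRing A] [Algebra ℝ A]

namespace ListOp

variable {P Q : ListOp A}

lemma AltLin.slot_add (h : AltLin Q) (s : List A) (u v : A) (t : List A) :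
    Q (s ++ (u + v) :: t) = Q (s ++ u :: t) + Q (s ++ v :: t) := by
  induction s generalizing Q with
  | nil => exact h.add u v t
  | cons w s ih => exact ih (h.fix w)

lemma AltLin.slot_smul (h : AltLin Q) (s : List A) (r : ℝ) (v : A) (t : List A) :
    Q (s ++ (r • v) :: t) = r • Q (s ++ v :: t) := by
  induction s generalizing Q with
  | nil => exact h.smul r v t
  | cons w s ih => exact ih (h.fix w)

/-- Adjacent swaps bring the equal entries together; there the value is its own negative. -/
lemma AltLin.repeat_eq_zero (h : AltLin Q) (s m t : List A) (u : A) :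
    Q (s ++ u :: (m ++ u :: t)) = 0 := by
  induction m generalizing s with
  | nil =>
    have h1 := h.alt s u u t
    have h2 : (2 : ℝ) • Q (s ++ u :: u :: t) = 0 := by rw [two_smul]; nth_rw 1 [h1]; simp
    simpa using h2
  | cons w m ih =>
    have h1 := ih (s ++ [w])
    rw [List.cons_append, h.alt]
    simpa using h1

lemma AltLin.eq_zero_of_not_nodup (h : AltLin Q) {t : List A} (ht : ¬ t.Nodup) : Q t = 0 := by
  induction t generalizing Q with
  | nil => simp at ht
  | cons v t ih =>
    by_cases h' : t.Nodup
    · have hv : v ∈ t := by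
        by_contra hv; exact ht (List.nodup_cons.2 ⟨hv, h'⟩)
      obtain ⟨m, r, rfl⟩ := List.append_of_mem hv
      exact h.repeat_eq_zero [] m r v
    · exact ih (h.fix v) h'

lemma ofFn_update_eq {α : Type*} {n : ℕ} (f : Fin n → α) (i : Fin n) (x : α) :
    List.ofFn (Function.update f i x) =
      (List.ofFn f).take i ++ x :: (List.ofFn f).drop (i + 1) := by
  have h := List.set_eq_take_append_cons_drop (l := List.ofFn f) (i := i) (a := x)
  rw [if_pos (by simp)] at h
  rw [← h]
  apply List.ext_getElem (by simp)
  intro k h1 h2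
  simp only [List.getElem_ofFn, List.getElem_set, Function.update_apply, Fin.ext_iff]
  simp only [eq_comm]

/-- The alternating map underlying an alternating multilinear operation, in arity `n`. -/
def AltLin.toAlternatingMap (h : AltLin Q) (n : ℕ) : A [⋀^Fin n]→ₗ[ℝ] A where
  toFun f := Q (List.ofFn f)
  map_update_add' f i x y := by
    rename_i inst
    -- The structure field quantifies over decidability instances; `ofFn_update_eq` uses the
    -- canonical one.
    rw [Subsingleton.elim inst (instDecidableEqFin n)]
    simp only [ofFn_update_eq, h.slot_add]
  map_update_smul' f i r x := by
    rename_i inst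
    rw [Subsingleton.elim inst (instDecidableEqFin n)]
    simp only [ofFn_update_eq, h.slot_smul]
  map_eq_zero_of_eq' f i j hij hne :=
    h.eq_zero_of_not_nodup fun hn => hne (List.nodup_ofFn.1 hn hij)

lemma AltLin.toAlternatingMap_apply (h : AltLin Q) {n : ℕ} (f : Fin n → A) :
    h.toAlternatingMap n f = Q (List.ofFn f) := rfl

/-- The signed sum over all permutations of the arguments. -/
def alternate {r : ℕ} (Φ : (Fin r → A) → A) (f : Fin r → A) : A :=
  ∑ s : Equiv.Perm (Fin r), ((Equiv.Perm.sign s : ℤ) : ℝ) • Φ (f ∘ s)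

lemma alternate_congr {r : ℕ} {Φ Ψ : (Fin r → A) → A} (h : ∀ f, Φ f = Ψ f) (f : Fin r → A) :
    alternate Φ f = alternate Ψ f := by rw [funext h]

lemma alternate_perm {r : ℕ} (Φ : (Fin r → A) → A) (c : Equiv.Perm (Fin r)) (f : Fin r → A) :
    alternate (fun g => Φ (g ∘ c)) f = ((Equiv.Perm.sign c : ℤ) : ℝ) • alternate Φ f := by
  simp only [alternate, Finset.smul_sum]
  refine Fintype.sum_equiv (Equiv.mulRight c) _ _ fun s => ?_
  simp only [Equiv.coe_mulRight, Equiv.Perm.sign_mul, smul_smul, Function.comp_assoc,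
    Equiv.Perm.coe_mul]
  congr 1
  push_cast
  rw [mul_left_comm, ← Int.cast_mul, ← Units.val_mul, Int.units_mul_self]; simp

lemma alternate_of_alternating {r : ℕ} (h : AltLin Q) (f : Fin r → A) :
    alternate (fun g => Q (List.ofFn g)) f = (r ! : ℝ) • Q (List.ofFn f) := by
  have : ∀ s : Equiv.Perm (Fin r), ((Equiv.Perm.sign s : ℤ) : ℝ) • Q (List.ofFn (f ∘ s)) =
      Q (List.ofFn f) := by
    intro s
    have h1 := (h.toAlternatingMap r).map_perm f s
    simp only [h.toAlternatingMap_apply] at h1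
    rw [h1]
    rcases Int.units_eq_one_or (Equiv.Perm.sign s) with e | e <;> rw [e] <;> simp
  simp only [alternate, this]
  simp [Fintype.card_perm, Nat.cast_smul_eq_nsmul]

/-- Antisymmetrization in stages. -/
lemma alternate_stage {r : ℕ} {Φ Ψ : A → (Fin r → A) → A}
    (h : ∀ v f, alternate (Φ v) f = alternate (Ψ v) f) (f : Fin (r + 1) → A) :
    alternate (fun g => Φ (g 0) (Fin.tail g)) f = alternate (fun g => Ψ (g 0) (Fin.tail g)) f := by
  -- Antisymmetrizing the last `r` arguments beforehand only multiplies the result by `r !`, which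
  -- is invertible.
  have key : ∀ Φ : A → (Fin r → A) → A, (r ! : ℝ) • alternate (fun g => Φ (g 0) (Fin.tail g)) f =
      alternate (fun g => alternate (Φ (g 0)) (Fin.tail g)) f := by
    intro Φ
    have e : ∀ s : Equiv.Perm (Fin r), alternate (fun g => Φ (g 0) (Fin.tail g)) f =
        ((Equiv.Perm.sign s : ℤ) : ℝ) • alternate (fun g => Φ (g 0) (Fin.tail g ∘ s)) f := by
      intro s
      -- The permutation `decomposeFin.symm (0, s)` fixes the first index and acts by `s` on the
      -- others, with the same sign.
      have h1 := alternate_perm (fun g => Φ (g 0) (Fin.tail g))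
        (Equiv.Perm.decomposeFin.symm (0, s)) f
      rw [Equiv.Perm.decomposeFin.symm_sign, if_pos rfl, one_mul] at h1
      have h2 : (fun g : Fin (r + 1) → A => Φ (g 0) (Fin.tail g ∘ s)) = fun g =>
          Φ ((g ∘ Equiv.Perm.decomposeFin.symm (0, s)) 0)
            (Fin.tail (g ∘ Equiv.Perm.decomposeFin.symm (0, s))) := by
        funext g
        congr 1
      rw [h2, h1, smul_smul]
      rcases Int.units_eq_one_or (Equiv.Perm.sign s) with e | e <;> rw [e] <;> simp
    have h3 : (r ! : ℝ) • alternate (fun g => Φ (g 0) (Fin.tail g)) f =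
        ∑ s : Equiv.Perm (Fin r), alternate (fun g => Φ (g 0) (Fin.tail g)) f := by
      simp [Fintype.card_perm, Nat.cast_smul_eq_nsmul]
    rw [h3, Finset.sum_congr rfl fun s _ => e s]
    simp only [alternate, Finset.smul_sum]
    rw [Finset.sum_comm]
    exact Finset.sum_congr rfl fun s _ => Finset.sum_congr rfl fun s' _ => smul_comm _ _ _
  have h1 : (r ! : ℝ) • alternate (fun g => Φ (g 0) (Fin.tail g)) f =
      (r ! : ℝ) • alternate (fun g => Ψ (g 0) (Fin.tail g)) f := by
    rw [key, key]; simp only [h]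
  exact smul_right_injective A (by exact_mod_cast r.factorial_ne_zero) h1

lemma alternate_add {r : ℕ} (Φ Ψ : (Fin r → A) → A) (f : Fin r → A) :
    alternate (fun g => Φ g + Ψ g) f = alternate Φ f + alternate Ψ f := by
  simp [alternate, Finset.sum_add_distrib]

lemma alternate_smul {r : ℕ} (c : ℝ) (Φ : (Fin r → A) → A) (f : Fin r → A) :
    alternate (fun g => c • Φ g) f = c • alternate Φ f := by
  simp only [alternate, Finset.smul_sum]
  exact Finset.sum_congr rfl fun s _ => smul_comm _ _ _

lemma alternate_sum {r : ℕ} {ι : Type*} (S : Finset ι) (Φ : ι → (Fin r → A) → A) (f : Fin r → A) :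
    alternate (fun g => ∑ i ∈ S, Φ i g) f = ∑ i ∈ S, alternate (Φ i) f := by
  simp only [alternate, Finset.smul_sum]
  exact Finset.sum_comm

/-- The cycle moves the first entry behind the next `i` ones. It serves to put an argument that
belongs to `P` behind the arguments of `Q`. -/
lemma ofFn_comp_cycleRange {α : Type*} {r : ℕ} (f : Fin (r + 1) → α) (i : Fin (r + 1)) :
    List.ofFn (f ∘ i.cycleRange) =
      (List.ofFn (Fin.tail f)).take i ++ f 0 :: (List.ofFn (Fin.tail f)).drop i := by
  apply List.ext_getElem
  · simp; omega
  intro k h1 h2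
  simp only [List.length_ofFn] at h1
  rw [List.getElem_ofFn, List.getElem_append]
  simp only [List.length_take, List.length_ofFn, Function.comp_apply]
  have hi : min (i : ℕ) r = i := by omega
  split_ifs with h
  · rw [hi] at h
    rw [List.getElem_take, List.getElem_ofFn, Fin.tail]
    congr 1
    ext
    rw [Fin.coe_cycleRange_of_lt (by exact h)]; rfl
  · rw [List.getElem_cons]
    split_ifs with h'
    · rw [hi] at h h'
      rw [Fin.cycleRange_of_eq (by ext; simp; omega)]
    · rw [hi] at h h'
      rw [List.getElem_drop, List.getElem_ofFn, Fin.tail, Fin.cycleRange_of_gt]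
      · congr 1; ext; simp; omega
      · simp only [Fin.lt_def]; omega

/-- The composition product as a signed sum over permutations. -/
lemma alternate_comp (hP : AltLin P) {r : ℕ} (f : Fin r → A) :
    alternate (fun g => comp P Q (List.ofFn g)) f =
      ∑ x ∈ Finset.HasAntidiagonal.antidiagonal r, r.choose x.1 •
        alternate (fun g => P (Q ((List.ofFn g).take x.1) :: (List.ofFn g).drop x.1)) f := by
  induction r generalizing P Q with
  | zero => simp [comp_nil]
  | succ r ih =>
    set T : ℕ → A := fun k =>
      alternate (fun g => P (Q ((List.ofFn g).take k) :: (List.ofFn g).drop k)) f with hT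
    -- Pascal's rule matches the recursion of `comp`: the first argument enters either `P` or `Q`.
    rw [Finset.sum_antidiagonal_choose_succ_nsmul (fun i _ => T i)]
    have e1 : ∀ g : Fin (r + 1) → A, comp P Q (List.ofFn g) =
        comp P (fix (g 0) Q) (List.ofFn (Fin.tail g)) +
          (-1 : ℝ) • comp (fix (g 0) P) (tw Q) (List.ofFn (Fin.tail g)) := by
      intro g
      rw [List.ofFn_succ, comp_cons, neg_one_smul, sub_eq_add_neg]; rfl
    rw [alternate_congr e1, alternate_add, alternate_smul, add_comm]
    congr 1
    · rw [alternate_stage (Φ := fun v g => comp (fix v P) (tw Q) (List.ofFn g))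
        (Ψ := fun v g => ∑ x ∈ Finset.HasAntidiagonal.antidiagonal r, (r.choose x.1 : ℝ) •
          fix v P (tw Q ((List.ofFn g).take x.1) :: (List.ofFn g).drop x.1))
        (fun v g => by
          rw [ih (hP.fix v), alternate_sum]
          exact Finset.sum_congr rfl fun x _ => by rw [alternate_smul, Nat.cast_smul_eq_nsmul]),
        alternate_sum, Finset.smul_sum]
      refine Finset.sum_congr rfl fun x hx => ?_
      have hx' := Finset.HasAntidiagonal.mem_antidiagonal.1 hx
      rw [alternate_smul, Nat.cast_smul_eq_nsmul, smul_comm]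
      congr 1
      -- The argument given to `P` has to pass the `x.1` arguments of `Q`: the sign of this cycle
      -- cancels that of `tw`, and moving it past the slot of `Q` cancels the sign `-1` in the
      -- recursion.
      let i : Fin (r + 1) := ⟨x.1, by omega⟩
      have e2 : ∀ g : Fin (r + 1) → A,
          fix (g 0) P (tw Q ((List.ofFn (Fin.tail g)).take x.1) ::
            (List.ofFn (Fin.tail g)).drop x.1) = (-(-1 : ℝ) ^ x.1) •
          (fun g : Fin (r + 1) → A => P (Q ((List.ofFn g).take x.1) :: (List.ofFn g).drop x.1))
            (g ∘ i.cycleRange) := by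
        intro g
        have l1 : ((List.ofFn (Fin.tail g)).take x.1).length = x.1 := by simp; omega
        have hl := ofFn_comp_cycleRange g i
        simp only [i] at hl ⊢
        simp only [hl]
        rw [List.take_left' l1, List.drop_left' l1]
        have h1 := hP.alt [] (g 0) (tw Q ((List.ofFn (Fin.tail g)).take x.1))
          ((List.ofFn (Fin.tail g)).drop x.1)
        simp only [List.nil_append] at h1
        rw [fix_apply, h1, tw, l1, hP.smul, neg_smul]
      have e4 := alternate_perm (fun g : Fin (r + 1) → A =>
        P (Q ((List.ofFn g).take x.1) :: (List.ofFn g).drop x.1)) i.cycleRange f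
      rw [alternate_congr e2, alternate_smul]
      refine (congrArg _ (congrArg _ e4)).trans ?_
      rw [Fin.sign_cycleRange, smul_smul, smul_smul]
      have e3 : (-1 : ℝ) * -(-1 : ℝ) ^ x.1 * (((-1) ^ x.1 : ℤˣ) : ℤ) = 1 := by
        push_cast
        rw [neg_one_mul, neg_neg, ← pow_add, Even.neg_one_pow ⟨_, rfl⟩]
      rw [show ((i : ℕ)) = x.1 from rfl, e3, one_smul]
    · rw [alternate_stage (Φ := fun v g => comp P (fix v Q) (List.ofFn g))
        (Ψ := fun v g => ∑ x ∈ Finset.HasAntidiagonal.antidiagonal r, (r.choose x.1 : ℝ) •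
          P (fix v Q ((List.ofFn g).take x.1) :: (List.ofFn g).drop x.1))
        (fun v g => by
          rw [ih hP, alternate_sum]
          exact Finset.sum_congr rfl fun x _ => by rw [alternate_smul, Nat.cast_smul_eq_nsmul]),
        alternate_sum]
      refine Finset.sum_congr rfl fun x hx => ?_
      have hx' := Finset.HasAntidiagonal.mem_antidiagonal.1 hx
      rw [alternate_smul, Nat.cast_smul_eq_nsmul]
      rw [show r.choose x.2 = r.choose x.1 from Nat.choose_symm_of_eq_add (by omega)]
      congr 1
      refine alternate_congr (fun g => ?_) f
      rw [List.ofFn_succ, List.take_succ_cons, List.drop_succ_cons]; rfl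

/-- The composite is already alternating, so `alternate` multiplies it by `r !`; dividing turns the
binomial coefficients into the normalization of `insertion`. -/
lemma comp_ofFn (hP : AltLin P) (hQ : AltLin Q) {r : ℕ} (f : Fin r → A) :
    comp P Q (List.ofFn f) = ∑ x ∈ Finset.HasAntidiagonal.antidiagonal r, ((x.1 ! * x.2 ! : ℕ) : ℝ)⁻¹ •
      alternate (fun g => P (Q ((List.ofFn g).take x.1) :: (List.ofFn g).drop x.1)) f := by
  have h := alternate_comp (Q := Q) hP f
  rw [alternate_of_alternating (hP.comp hQ)] at h
  have h0 : (r ! : ℝ) ≠ 0 := by exact_mod_cast r.factorial_ne_zero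
  rw [(eq_inv_smul_iff₀ h0).2 h, Finset.smul_sum]
  refine Finset.sum_congr rfl fun x hx => ?_
  have hx' := Finset.HasAntidiagonal.mem_antidiagonal.1 hx
  rw [← Nat.cast_smul_eq_nsmul ℝ, smul_smul]
  congr 1
  have h1 := Nat.choose_mul_factorial_mul_factorial (n := r) (k := x.1) (by omega)
  rw [show r - x.1 = x.2 by omega] at h1
  have h2 : (r.choose x.1 : ℝ) * (x.1 ! : ℝ) * (x.2 ! : ℝ) = r ! := by exact_mod_cast h1
  have h3 : (x.1 ! : ℝ) ≠ 0 := by exact_mod_cast x.1.factorial_ne_zero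
  have h4 : (x.2 ! : ℝ) ≠ 0 := by exact_mod_cast x.2.factorial_ne_zero
  rw [← h2]
  push_cast
  have h5 : (r.choose x.1 : ℝ) ≠ 0 := by
    intro h6; rw [h6] at h2; simp at h2; exact h0 h2.symm
  field_simp

end ListOp

end Antisymmetrization

end OhPark

namespace OhPark

/-! ### Operators on all functions compared with operations on a subalgebra. -/

section Representation

open ListOp

variable {N : Type*} {A : Subalgebra ℝ (N → ℝ)} {U : Set N}

/-- On functions in `A`, the operator `Q` agrees over `U` with the operation `q`, and the values
of `Q` over `U` only depend on the arguments over `U`. -/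
structure Represents (U : Set N) (Q : MultiOp N) (q : ListOp A) : Prop where
  localized : ∀ p (f g : Fin p → N → ℝ), (∀ i, Set.EqOn (f i) (g i) U) → Set.EqOn (Q p f) (Q p g) U
  eq : ∀ p (f : Fin p → A), Set.EqOn (Q p fun i => (f i : N → ℝ)) (q (List.ofFn f)) U

variable {P Q : MultiOp N} {p q : ListOp A}

lemma insertion_congr {a k r : ℕ} (e : k + a = r)
    {P P' : (Fin (a + 1) → N → ℝ) → N → ℝ} {Q Q' : (Fin k → N → ℝ) → N → ℝ}
    (hP : ∀ f g, (∀ i, Set.EqOn (f i) (g i) U) → Set.EqOn (P f) (P' g) U)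
    (hQ : ∀ f g, (∀ i, Set.EqOn (f i) (g i) U) → Set.EqOn (Q f) (Q' g) U)
    (f g : Fin r → N → ℝ) (h : ∀ i, Set.EqOn (f i) (g i) U) :
    Set.EqOn (insertion e P Q f) (insertion e P' Q' g) U := by
  intro x hx
  simp only [insertion, Pi.smul_apply, Finset.sum_apply]
  congr 1
  refine Finset.sum_congr rfl fun s _ => ?_
  congr 1
  refine hP _ _ (fun i => ?_) hx
  refine Fin.cases ?_ (fun j => ?_) i
  · simp only [Fin.cons_zero]
    exact hQ _ _ fun i => h _
  · simp only [Fin.cons_succ]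
    exact h _

lemma insertion_represents (hP : Represents U P p) (hQ : Represents U Q q) {a k r : ℕ}
    (e : k + a = r) (f : Fin r → A) {x : N} (hx : x ∈ U) :
    insertion e (P (a + 1)) (Q k) (fun i => (f i : N → ℝ)) x =
      ((((k ! * a ! : ℕ) : ℝ)⁻¹ • alternate
        (fun g => p (q ((List.ofFn g).take k) :: (List.ofFn g).drop k)) f : A) : N → ℝ) x := by
  have hs : ∀ (ι : Type) (s : Finset ι) (F : ι → A) (y : N),
      ((∑ i ∈ s, F i : A) : N → ℝ) y = ∑ i ∈ s, (F i : N → ℝ) y := by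
    intro ι s F y
    rw [AddSubmonoidClass.coe_finsetSum, Finset.sum_apply]
  simp only [insertion, alternate, Pi.smul_apply, Finset.sum_apply, SetLike.val_smul, hs]
  congr 1
  refine Finset.sum_congr rfl fun s _ => ?_
  congr 1
  have e1 : (List.ofFn (f ∘ s)).take k =
      List.ofFn fun i => f (s (Fin.cast e (Fin.castAdd a i))) := by
    apply List.ext_getElem
    · simp; omega
    · intro i h1 h2; simp
  have e2 : (List.ofFn (f ∘ s)).drop k =
      List.ofFn fun j => f (s (Fin.cast e (Fin.natAdd k j))) := by
    apply List.ext_getElem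
    · simp; omega
    · intro i h1 h2; simp
  rw [e1, e2]
  have h1 := hQ.eq k fun i => f (s (Fin.cast e (Fin.castAdd a i)))
  have h2 := hP.eq (a + 1) (Fin.cons (q (List.ofFn fun i => f (s (Fin.cast e (Fin.castAdd a i)))))
    fun j => f (s (Fin.cast e (Fin.natAdd k j))))
  rw [List.ofFn_succ] at h2
  simp only [Fin.cons_zero, Fin.cons_succ] at h2
  rw [← h2 hx]
  -- The inner function is only known to agree over `U` with an element of `A`; locality of the
  -- outer operator allows the replacement.
  refine hP.localized _ _ _ (fun i => ?_) hx
  refine Fin.cases ?_ (fun j => ?_) i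
  · simpa only [Fin.cons_zero] using h1
  · simp only [Fin.cons_succ]
    exact Set.eqOn_refl _ _

theorem Represents.schouten (hP : Represents U P p) (hQ : Represents U Q q) (lp : AltLin p)
    (lq : AltLin q) : Represents U (schouten P Q) (br p q) where
  localized r f g h x hx := by
    simp only [OhPark.schouten, Finset.sum_apply, Pi.sub_apply, Pi.smul_apply]
    refine Finset.sum_congr rfl fun y _ => ?_
    rw [insertion_congr _ (hP.localized _) (hQ.localized _) f g h hx,
      insertion_congr _ (hQ.localized _) (hP.localized _) f g h hx]
  eq r f x hx := by
    simp only [OhPark.schouten, Finset.sum_apply, Pi.sub_apply, Pi.smul_apply]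
    have hs : ∀ (ι : Type) (s : Finset ι) (F : ι → A) (y : N),
        ((∑ i ∈ s, F i : A) : N → ℝ) y = ∑ i ∈ s, (F i : N → ℝ) y := by
      intro ι s F y
      rw [AddSubmonoidClass.coe_finsetSum, Finset.sum_apply]
    simp only [insertion_represents hP hQ _ f hx, insertion_represents hQ hP _ f hx]
    rw [Finset.sum_coe_sort (Finset.HasAntidiagonal.antidiagonal r) (fun y : ℕ × ℕ =>
      ((((y.1 ! * y.2 ! : ℕ) : ℝ)⁻¹ • alternate
        (fun g => p (q ((List.ofFn g).take y.1) :: (List.ofFn g).drop y.1)) f : A) : N → ℝ) x -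
      (-1 : ℝ) ^ (y.2 * (y.1 + 1)) • ((((y.1 ! * y.2 ! : ℕ) : ℝ)⁻¹ • alternate
        (fun g => q (p ((List.ofFn g).take y.1) :: (List.ofFn g).drop y.1)) f : A) : N → ℝ) x)]
    have hb : br p q (List.ofFn f) = comp p q (List.ofFn f) - comp (od q) p (List.ofFn f) +
      comp (ev q) (tw p) (List.ofFn f) := rfl
    rw [hb, comp_ofFn lp lq, comp_ofFn lq.od lp, comp_ofFn lq.ev lp.tw, ← Finset.sum_sub_distrib,
      ← Finset.sum_add_distrib, hs]
    refine Finset.sum_congr rfl fun y hy => ?_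
    have hy' := Finset.HasAntidiagonal.mem_antidiagonal.1 hy
    -- Here `q` has arity `y.2 + 1` and `p` has arity `y.1`. The sign is `1` when `q` is odd and
    -- `-(-1)^y.1` when it is even, as in the parity splitting of `br`.
    have key : (-1 : ℝ) ^ (y.2 * (y.1 + 1)) • alternate
          (fun g => q (p ((List.ofFn g).take y.1) :: (List.ofFn g).drop y.1)) f =
        alternate (fun g => od q (p ((List.ofFn g).take y.1) :: (List.ofFn g).drop y.1)) f -
        alternate (fun g => ev q (tw p ((List.ofFn g).take y.1) :: (List.ofFn g).drop y.1)) f := by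
      have l1 : ∀ g : Fin r → A, ((List.ofFn g).drop y.1).length = y.2 := by
        intro g; simp; omega
      have l2 : ∀ g : Fin r → A, ((List.ofFn g).take y.1).length = y.1 := by
        intro g; simp; omega
      have z : alternate (fun _ : Fin r → A => (0 : A)) f = 0 := by simp [alternate]
      rcases Nat.even_or_odd y.2 with h2 | h2
      · have h2' : ¬ Even (y.2 + 1) := Nat.not_even_iff_odd.2 h2.add_one
        simp only [od, ev, List.length_cons, l1, h2', if_false, z, sub_zero,
          (h2.mul_right _).neg_one_pow, one_smul]
      · have h2' : Even (y.2 + 1) := h2.add_one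
        simp only [od, ev, List.length_cons, l1, h2', if_true, z, zero_sub, tw, l2, lq.smul,
          alternate_smul]
        rw [pow_mul, h2.neg_one_pow, pow_succ]; simp
    have key' := congrArg (fun a : A => (((y.1 ! * y.2 ! : ℕ) : ℝ)⁻¹ • (a : N → ℝ)) x) key
    simp only [SetLike.val_smul, Pi.smul_apply, AddSubgroupClass.coe_sub, Pi.sub_apply,
      smul_sub] at key'
    simp only [SetLike.val_smul, Pi.smul_apply, AddSubgroupClass.coe_sub, Pi.sub_apply,
      Subalgebra.coe_add, Pi.add_apply]
    rw [smul_comm, key']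
    ring

end Representation

end OhPark

namespace OhPark

theorem two_le_infty : (2 : WithTop ℕ∞) ≤ ∞ :=
  WithTop.coe_le_coe.2 (le_top : (2 : ℕ∞) ≤ ⊤)

/-! ### Differentials and differential forms in charts. -/

section Charts

variable {V : Type*} [NormedAddCommGroup V] [NormedSpace ℝ V]
  {H : Type*} [TopologicalSpace H] {I : ModelWithCorners ℝ V H}
  {N : Type*} [TopologicalSpace N] [ChartedSpace H N]
  {V' : Type*} [NormedAddCommGroup V'] [NormedSpace ℝ V']
  {H' : Type*} [TopologicalSpace H'] {I' : ModelWithCorners ℝ V' H'}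
  {N' : Type*} [TopologicalSpace N'] [ChartedSpace H' N']
  {W : Type*} [NormedAddCommGroup W] [NormedSpace ℝ W]
  {W' : Type*} [NormedAddCommGroup W'] [NormedSpace ℝ W']

theorem mvfderiv_comp_apply {f : N → W} {x : N} {g : W → W'} (hg : DifferentiableAt ℝ g (f x))
    (hf : MDifferentiableAt I 𝓘(ℝ, W) f x) (v : TangentSpace I x) :
    mvfderiv I (g ∘ f) x v = fderiv ℝ g (f x) (mvfderiv I f x v) := by
  unfold mvfderiv
  rw [mfderiv_comp x hg.mdifferentiableAt hf, mfderiv_eq_fderiv]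
  rfl

theorem mvfderiv_comp_mfderiv {f : N' → N} {x : N'} {g : N → W}
    (hg : MDifferentiableAt I 𝓘(ℝ, W) g (f x)) (hf : MDifferentiableAt I' I f x)
    (v : TangentSpace I' x) :
    mvfderiv I' (g ∘ f) x v = mvfderiv I g (f x) (mfderiv I' I f x v) := by
  unfold mvfderiv
  rw [mfderiv_comp x hg hf]
  rfl

theorem mvfderiv_congr {f g : N → W} {x : N} (h : f =ᶠ[nhds x] g) :
    mvfderiv I f x = mvfderiv I g x := by
  ext v
  unfold mvfderiv
  change (mfderiv I 𝓘(ℝ, W) f x v : W) = (mfderiv I 𝓘(ℝ, W) g x v : W)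
  rw [h.mfderiv_eq]
  rfl

theorem mvfderiv_eq_fderiv {f : V → W} {y : V} :
    (mvfderiv 𝓘(ℝ, V) f y : V →L[ℝ] W) = fderiv ℝ f y := by
  unfold mvfderiv
  rw [mfderiv_eq_fderiv]
  rfl

variable [I.Boundaryless] [IsManifold I 1 N]

theorem mdifferentiableAt_extChartAt_symm' {x : N} {y : V} (hy : y ∈ (extChartAt I x).target) :
    MDifferentiableAt 𝓘(ℝ, V) I (extChartAt I x).symm y := by
  have h := mdifferentiableWithinAt_extChartAt_symm hy
  rwa [I.range_eq_univ, mdifferentiableWithinAt_univ] at h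

theorem mfderiv_symm_mvfderiv {x y : N} (hy : y ∈ (extChartAt I x).source)
    (v : TangentSpace I y) :
    mfderiv 𝓘(ℝ, V) I (extChartAt I x).symm (extChartAt I x y)
      (mvfderiv I (extChartAt I x) y v) =
      (v : V) := by
  have h := mfderivWithin_extChartAt_symm_comp_mfderiv_extChartAt' (I := I) hy
  rw [I.range_eq_univ, mfderivWithin_univ] at h
  exact congrArg (fun L => L v) h

theorem mvfderiv_mfderiv_symm {x : N} {y : V} (hy : y ∈ (extChartAt I x).target) (v : V) :
    mvfderiv I (extChartAt I x) ((extChartAt I x).symm y)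
      (mfderiv 𝓘(ℝ, V) I (extChartAt I x).symm y v) = v := by
  have h := mfderiv_extChartAt_comp_mfderivWithin_extChartAt_symm (I := I) hy
  rw [I.range_eq_univ, mfderivWithin_univ] at h
  exact congrArg (fun L => L v) h

theorem mvfderiv_eq_fderiv_chart {x y : N} (hy : y ∈ (extChartAt I x).source) {f : N → W}
    (hf : MDifferentiableAt I 𝓘(ℝ, W) f y) (v : TangentSpace I y) :
    mvfderiv I f y v = fderiv ℝ (f ∘ (extChartAt I x).symm) (extChartAt I x y)
      (mvfderiv I (extChartAt I x) y v) := by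
  have hy' := (extChartAt I x).map_source hy
  have hl := (extChartAt I x).left_inv hy
  rw [← mvfderiv_eq_fderiv]
  refine Eq.trans ?_ (mvfderiv_comp_mfderiv (I := I) (I' := 𝓘(ℝ, V)) (by rwa [hl])
    (mdifferentiableAt_extChartAt_symm' hy') (mvfderiv I (extChartAt I x) y v)).symm
  have h := mfderiv_symm_mvfderiv hy v
  -- The round trip through the chart returns `y` only up to a proved equality, so the base point is
  -- generalized in order to compare tangent vectors.
  have : ∀ z : N, z = y → ∀ u : V, u = v →
     mvfderiv I f y v = mvfderiv I f z (u : TangentSpace I z) := by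
    rintro z rfl u rfl; rfl
  exact this _ hl _ h

theorem mvfderiv_chart_injective {x y : N} (hy : y ∈ (extChartAt I x).source)
    {v w : TangentSpace I y}
    (h : mvfderiv I (extChartAt I x) y v = mvfderiv I (extChartAt I x) y w) : v = w := by
  rw [← show _ = v from mfderiv_symm_mvfderiv hy v, h]
  exact mfderiv_symm_mvfderiv hy w

namespace DiffForm

theorem apply_eq_inChart {k : ℕ} (α : DiffForm I N k) {x y : N}
    (hy : y ∈ (extChartAt I x).source) (v : Fin k → TangentSpace I y) :
    α y v = α.inChart x (extChartAt I x y) fun i => mvfderiv I (extChartAt I x) y (v i) := by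
  have hl := (extChartAt I x).left_inv hy
  have : ∀ z : N, z = y → ∀ u : Fin k → V, (∀ i, u i = v i) →
     α y v = α z (fun i => (u i : TangentSpace I z)) := by
    rintro z rfl u hu
    congr 1
    funext i
    exact (hu i).symm
  exact this _ hl _ fun i => mfderiv_symm_mvfderiv hy (v i)

theorem inChart_apply {k : ℕ} (α : DiffForm I N k) (x : N) (y : V) (v : Fin k → V) :
    α.inChart x y v = α ((extChartAt I x).symm y)
      (fun i => mfderiv 𝓘(ℝ, V) I (extChartAt I x).symm y (v i)) := rfl

theorem inChart_pullback {k : ℕ} (α : DiffForm I N k) {f : N' → N}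
    [I'.Boundaryless] [IsManifold I' 1 N'] {x' : N'} {x : N} {y : V'}
    (hy : y ∈ (extChartAt I' x').target) (hf : MDifferentiableAt I' I f ((extChartAt I' x').symm y))
    (hx : f ((extChartAt I' x').symm y) ∈ (extChartAt I x).source) :
    (α.pullback I' f).inChart x' y =
      (α.inChart x (extChartAt I x (f ((extChartAt I' x').symm y)))).compContinuousLinearMap
        (fderiv ℝ (extChartAt I x ∘ f ∘ (extChartAt I' x').symm) y) := by
  ext v
  rw [inChart_apply]
  change α _ (fun i => mfderiv I' I f _ (mfderiv 𝓘(ℝ, V') I' (extChartAt I' x').symm y (v i))) = _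
  rw [apply_eq_inChart α hx]
  change _ = α.inChart x _ (fun i => fderiv ℝ (extChartAt I x ∘ f ∘ (extChartAt I' x').symm) y (v i))
  congr 1
  funext i
  have h1 := mdifferentiableAt_extChartAt_symm' (I := I') hy
  have h2 : MDifferentiableAt I 𝓘(ℝ, V) (extChartAt I x) (f ((extChartAt I' x').symm y)) :=
    mdifferentiableAt_extChartAt (by simpa using hx)
  rw [← mvfderiv_eq_fderiv]
  have h3 := mvfderiv_comp_mfderiv (I := I) (I' := 𝓘(ℝ, V')) (x := y) (f := f ∘ (extChartAt I' x').symm) h2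
    (hf.comp y h1) (v i)
  refine Eq.trans ?_ h3.symm
  rw [mfderiv_comp y hf h1]
  rfl

/-- The closedness condition on a chart expression. -/
theorem extDeriv_inChart_eq_zero {k : ℕ} {α : DiffForm I N k} (h : α.d = 0) (x : N) :
    extDeriv (α.inChart x) (extChartAt I x x) = 0 := by
  have h1 := congrFun h x
  ext v
  have h2 := congrArg (fun β => β v) h1
  have h3 : ∀ u : V, mvfderiv I (extChartAt I x) x u = u := fun u =>
    congrArg (fun L => L u) (mfderiv_extChartAt_self (I := I) (x := x))
  have h4 : α.d x v = extDeriv (α.inChart x) (extChartAt I x x)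
    fun i => mvfderiv I (extChartAt I x) x (v i) := rfl
  have h5 : (fun i => mvfderiv I (extChartAt I x) x (v i)) = v := funext fun i => h3 (v i)
  rw [h5] at h4
  exact h4.symm.trans h2

theorem contDiffAt_inChart {k : ℕ} {α : DiffForm I N k} (h : α.IsSmooth) {x y : N}
    (hy : y ∈ (extChartAt I x).source) :
    ContDiffAt ℝ ∞ (α.inChart x) (extChartAt I x y) :=
  (h x).contDiffAt (extChartAt_target_mem_nhds' ((extChartAt I x).map_source hy))

section Pullback

variable [I'.Boundaryless] [IsManifold I' ∞ N'] [IsManifold I ∞ N]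

theorem contDiffAt_chart_comp {f : N' → N} (hf : ContMDiff I' I ∞ f) (x : N') :
    ContDiffAt ℝ ∞ (extChartAt I (f x) ∘ f ∘ (extChartAt I' x).symm) (extChartAt I' x x) := by
  have := (contMDiffAt_iff.1 (hf x)).2
  rwa [I'.range_eq_univ, contDiffWithinAt_univ] at this

theorem inChart_pullback_eventuallyEq {k : ℕ} (α : DiffForm I N k) {f : N' → N}
    (hf : ContMDiff I' I ∞ f) (x : N') :
    (α.pullback I' f).inChart x =ᶠ[nhds (extChartAt I' x x)] fun y =>
      (α.inChart (f x) ((extChartAt I (f x) ∘ f ∘ (extChartAt I' x).symm) y)).compContinuousLinearMap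
        (fderiv ℝ (extChartAt I (f x) ∘ f ∘ (extChartAt I' x).symm) y) := by
  have : IsManifold I' 1 N' := IsManifold.of_le (n := ∞) (by simp)
  have : IsManifold I 1 N := IsManifold.of_le (n := ∞) (by simp)
  have hl := extChartAt_to_inv (I := I') x
  have hc := continuousAt_extChartAt_symm (I := I') x
  have h2 : ∀ᶠ x' in nhds x, f x' ∈ (extChartAt I (f x)).source :=
    hf.continuous.continuousAt.eventually (extChartAt_source_mem_nhds _)
  rw [ContinuousAt, hl] at hc
  filter_upwards [extChartAt_target_mem_nhds (I := I') x, hc.eventually h2] with y h3 h5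
  exact inChart_pullback α h3 (hf.mdifferentiableAt (by simp)) h5

theorem differentiableAt_inChart_pullback {k : ℕ} {α : DiffForm I N k} (hα : α.IsSmooth)
    {f : N' → N} (hf : ContMDiff I' I ∞ f) (x : N') :
    DifferentiableAt ℝ ((α.pullback I' f).inChart x) (extChartAt I' x x) := by
  have : IsManifold I 1 N := IsManifold.of_le (n := ∞) (by simp)
  have he := inChart_pullback_eventuallyEq α hf x
  rw [he.differentiableAt_iff]
  have h := contDiffAt_chart_comp hf x
  refine DifferentiableAt.continuousAlternatingMapCompContinuousLinearMap ?_ ?_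
  · have h1 : DifferentiableAt ℝ (α.inChart (f x))
        ((extChartAt I (f x) ∘ f ∘ (extChartAt I' x).symm) (extChartAt I' x x)) := by
      have := contDiffAt_inChart (I := I) hα (mem_extChartAt_source (I := I) (f x))
      simpa using this.differentiableAt (by simp)
    exact h1.comp _ (h.differentiableAt (by simp))
  · exact (h.fderiv_right (m := 1) (by rw [one_add_one_eq_two]; exact two_le_infty)).differentiableAt (by simp)

/-- The exterior derivative commutes with pull-back along the chart expression of `f`; what remains
is the derivative at `f x` in the chart at `f x`, which is where `d` is computed. -/
theorem extDeriv_inChart_pullback {k : ℕ} {α : DiffForm I N k} (hα : α.IsSmooth) (hd : α.d = 0)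
    {f : N' → N} (hf : ContMDiff I' I ∞ f) (x : N') :
    extDeriv ((α.pullback I' f).inChart x) (extChartAt I' x x) = 0 := by
  have : IsManifold I 1 N := IsManifold.of_le (n := ∞) (by simp)
  have h := contDiffAt_chart_comp hf x
  have h0 : (extChartAt I (f x) ∘ f ∘ (extChartAt I' x).symm) (extChartAt I' x x) =
    extChartAt I (f x) (f x) := by simp
  have he := inChart_pullback_eventuallyEq α hf x
  rw [he.extDeriv_eq, extDeriv_pullback (r := ∞) _ h (by rw [minSmoothness_of_isRCLikeNormedField]; exact two_le_infty),
    h0, extDeriv_inChart_eq_zero hd]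
  · ext; simp
  · rw [h0]
    exact (contDiffAt_inChart (I := I) hα (mem_extChartAt_source (I := I) (f x))).differentiableAt
      (by simp)

end Pullback

end DiffForm

/-- The bilinear map of an alternating two-form. -/
noncomputable def toBilin (V : Type*) [NormedAddCommGroup V] [NormedSpace ℝ V] :
    (V [⋀^Fin 2]→L[ℝ] ℝ) →L[ℝ] V →L[ℝ] V →L[ℝ] ℝ :=
  (ContinuousLinearMap.compL ℝ V (V [×1]→L[ℝ] ℝ) (V →L[ℝ] ℝ)
    (continuousMultilinearCurryFin1 ℝ V ℝ).toLinearIsometry.toContinuousLinearMap).comp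
  ((continuousMultilinearCurryLeftEquiv ℝ (fun _ : Fin 2 => V)
      ℝ).toLinearIsometry.toContinuousLinearMap.comp
    (ContinuousAlternatingMap.toContinuousMultilinearMapLI (𝕜 := ℝ) (E := V) (F := ℝ)
      (ι := Fin 2)).toContinuousLinearMap)

theorem toBilin_apply {V : Type*} [NormedAddCommGroup V] [NormedSpace ℝ V]
    (β : V [⋀^Fin 2]→L[ℝ] ℝ) (u v : V) : toBilin V β u v = β ![u, v] := by
  change β (Fin.cons u (Fin.snoc 0 v)) = _
  congr 1
  funext i
  fin_cases i <;> rfl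

end Charts

end OhPark

namespace OhPark

/-! ### The Jacobi identity of a closed two-form on a vector space. -/

section JacobiIdentity

variable {W : Type*} [NormedAddCommGroup W] [NormedSpace ℝ W]

/-- The Jacobi identity at `y₀` for the Poisson bracket of a two-form `B` on a vector space, which
is differentiable, alternating and closed at `y₀`. -/
theorem jacobi_of_closed {B : W → W →L[ℝ] W →L[ℝ] ℝ} {y₀ : W} (hB : DifferentiableAt ℝ B y₀)
    (halt : ∀ y u v, B y u v = -B y v u)
    (hcl : ∀ u v w, fderiv ℝ B y₀ u v w + fderiv ℝ B y₀ v w u + fderiv ℝ B y₀ w u v = 0)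
    {f : Fin 3 → W → ℝ} (hf : ∀ i, ContDiffAt ℝ 2 (f i) y₀)
    {X : Fin 3 → W → W} (hX : ∀ i, DifferentiableAt ℝ (X i) y₀)
    (hXf : ∀ i, ∀ᶠ y in nhds y₀, ∀ w, B y (X i y) w = -fderiv ℝ (f i) y w) :
    fderiv ℝ (fun y => fderiv ℝ (f 2) y (X 1 y)) y₀ (X 0 y₀) +
      fderiv ℝ (fun y => fderiv ℝ (f 0) y (X 2 y)) y₀ (X 1 y₀) +
      fderiv ℝ (fun y => fderiv ℝ (f 1) y (X 0 y)) y₀ (X 2 y₀) = 0 := by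
  have hd : ∀ i, DifferentiableAt ℝ (fderiv ℝ (f i)) y₀ := fun i =>
    ((hf i).fderiv_right (m := 1) (by norm_num)).differentiableAt (by simp)
  have hsymm : ∀ i u v, fderiv ℝ (fderiv ℝ (f i)) y₀ u v = fderiv ℝ (fderiv ℝ (f i)) y₀ v u :=
    fun i u v => (hf i).isSymmSndFDerivAt (by simp) u v
  -- the derivative of `{f j, f i}`, computed from `df_i (X_j)`
  have h1 : ∀ i j u, fderiv ℝ (fun y => fderiv ℝ (f i) y (X j y)) y₀ u =
      fderiv ℝ (fderiv ℝ (f i)) y₀ u (X j y₀) + fderiv ℝ (f i) y₀ (fderiv ℝ (X j) y₀ u) := by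
    intro i j u
    rw [((hd i).hasFDerivAt.clm_apply (hX j).hasFDerivAt).fderiv]
    simp [add_comm]
  -- the same, computed from `B (X_j, X_i)`
  have h2 : ∀ i j u, fderiv ℝ (fun y => fderiv ℝ (f i) y (X j y)) y₀ u =
      fderiv ℝ B y₀ u (X j y₀) (X i y₀) + B y₀ (fderiv ℝ (X j) y₀ u) (X i y₀) +
        B y₀ (X j y₀) (fderiv ℝ (X i) y₀ u) := by
    intro i j u
    have he : (fun y => fderiv ℝ (f i) y (X j y)) =ᶠ[nhds y₀] fun y => B y (X j y) (X i y) := by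
      filter_upwards [hXf i] with y hy
      rw [halt, hy, neg_neg]
    rw [he.fderiv_eq, ((hB.hasFDerivAt.clm_apply (hX j).hasFDerivAt).clm_apply
      (hX i).hasFDerivAt).fderiv]
    simp; ring
  have h3 : ∀ i u, B y₀ u (X i y₀) = fderiv ℝ (f i) y₀ u := by
    intro i u
    rw [halt, (hXf i).self_of_nhds, neg_neg]
  have h4 : ∀ i u, B y₀ (X i y₀) u = -fderiv ℝ (f i) y₀ u := fun i u => (hXf i).self_of_nhds u
  have e1 := h1 2 1 (X 0 y₀)
  have e2 := h1 0 2 (X 1 y₀)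
  have e3 := h1 1 0 (X 2 y₀)
  have g1 := h2 2 1 (X 0 y₀)
  have g2 := h2 0 2 (X 1 y₀)
  have g3 := h2 1 0 (X 2 y₀)
  have k1 := h1 1 2 (X 0 y₀)
  have k2 := h1 2 0 (X 1 y₀)
  have k3 := h1 0 1 (X 2 y₀)
  have h5 : ∀ i j u, fderiv ℝ (fun y => fderiv ℝ (f i) y (X j y)) y₀ u =
      -fderiv ℝ (fun y => fderiv ℝ (f j) y (X i y)) y₀ u := by
    intro i j u
    have he : (fun y => fderiv ℝ (f i) y (X j y)) =ᶠ[nhds y₀]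
        -fun y => fderiv ℝ (f j) y (X i y) := by
      filter_upwards [hXf i, hXf j] with y hi hj
      have hi' := hi (X j y)
      rw [halt, hj] at hi'
      simp only [Pi.neg_apply]
      linarith
    rw [he.fderiv_eq, fderiv_neg]
    rfl
  have l1 := h5 1 2 (X 0 y₀)
  have l2 := h5 2 0 (X 1 y₀)
  have l3 := h5 0 1 (X 2 y₀)
  simp only [h3, h4] at g1 g2 g3
  have c1 := hcl (X 0 y₀) (X 1 y₀) (X 2 y₀)
  have s1 := hsymm 2 (X 0 y₀) (X 1 y₀)
  have s2 := hsymm 0 (X 1 y₀) (X 2 y₀)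
  have s3 := hsymm 1 (X 2 y₀) (X 0 y₀)
  -- The second derivatives of the functions cancel by symmetry and the derivatives of `B` by
  -- closedness.
  linarith

/-- The vector fields of the Poisson bracket depend differentiably on the point. -/
theorem differentiableAt_inverse_apply [FiniteDimensional ℝ W] {B : W → W →L[ℝ] W →L[ℝ] ℝ}
    {y₀ : W} (hB : DifferentiableAt ℝ B y₀) (hnd : ∀ u, (∀ w, B y₀ u w = 0) → u = 0)
    {ξ : W → W →L[ℝ] ℝ} (hξ : DifferentiableAt ℝ ξ y₀) {X : W → W}
    (hX : ∀ᶠ y in nhds y₀, B y (X y) = ξ y) : DifferentiableAt ℝ X y₀ := by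
  have hinj : Function.Injective (B y₀) := by
    rw [injective_iff_map_eq_zero]
    intro u hu
    exact hnd u fun w => by rw [hu]; rfl
  have hfr : Module.finrank ℝ W = Module.finrank ℝ (W →L[ℝ] ℝ) := by
    rw [← Subspace.dual_finrank_eq]
    exact (LinearMap.toContinuousLinearMap (𝕜 := ℝ) (E := W) (F' := ℝ)).finrank_eq
  let e : W ≃L[ℝ] (W →L[ℝ] ℝ) :=
    (LinearEquiv.ofInjectiveOfFinrankEq (B y₀).toLinearMap hinj hfr).toContinuousLinearEquiv
  have he : (e : W →L[ℝ] (W →L[ℝ] ℝ)) = B y₀ := by ext; rfl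
  have h1 : DifferentiableAt ℝ (fun y => (B y).inverse (ξ y)) y₀ := by
    refine DifferentiableAt.clm_apply ?_ hξ
    have := contDiffAt_map_inverse (𝕜 := ℝ) (n := 1) e
    rw [he] at this
    exact (this.differentiableAt (by simp)).comp _ hB
  refine h1.congr_of_eventuallyEq ?_
  -- Invertible operators form an open set, so near `y₀` the field `X` is the inverse of `B` applied
  -- to `ξ`.
  have h2 : ∀ᶠ y in nhds y₀, B y ∈ Set.range ((↑) : (W ≃L[ℝ] (W →L[ℝ] ℝ)) → _) := by
    refine hB.continuousAt.eventually ?_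
    rw [← he]
    exact e.nhds
  filter_upwards [h2, hX] with y h3 h4
  obtain ⟨e', h3⟩ := h3
  rw [← h4, ← h3, ContinuousLinearMap.inverse_equiv]
  simp

end JacobiIdentity

end OhPark

namespace OhPark

/-! ### Smooth vector fields on the base and their derivations. -/

section VectorFields

variable {n : ℕ} {C : Type*} [TopologicalSpace C] [ChartedSpace (Eu n) C]
  [IsManifold (𝓡 n) ∞ C]
  {W : Type*} [NormedAddCommGroup W] [NormedSpace ℝ W]

/-- Smoothness of a vector field at a point. -/
abbrev SmoothFieldAt (X : ∀ x : C, TangentSpace (𝓡 n) x) (x : C) : Prop :=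
  ContMDiffAt (𝓡 n) ((𝓡 n).prod 𝓘(ℝ, Eu n)) ∞
    (fun x => Bundle.TotalSpace.mk' (Eu n) x (X x)) x

/-- The derivative of a function along a vector field. -/
noncomputable def lieD (X : ∀ x : C, TangentSpace (𝓡 n) x) (f : C → W) (x : C) : W :=
  mvfderiv (𝓡 n) f x (X x)

theorem isManifold_one : IsManifold (𝓡 n) 1 C := IsManifold.of_le (n := ∞) (by simp)

theorem VecField.smoothAt (X : VecField n C) (x : C) : SmoothFieldAt (fun x => X x) x :=
  X.contMDiff x

theorem smoothFieldAt_iff {X : ∀ x : C, TangentSpace (𝓡 n) x} {x₀ x : C}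
    (hx : x ∈ (extChartAt (𝓡 n) x₀).source) :
    SmoothFieldAt X x ↔
      ContMDiffAt (𝓡 n) 𝓘(ℝ, Eu n) ∞ (lieD X (extChartAt (𝓡 n) x₀)) x := by
  have := isManifold_one (n := n) (C := C)
  have hx' : x ∈ (chartAt (Eu n) x₀).source := by simpa using hx
  rw [SmoothFieldAt, Bundle.Trivialization.contMDiffAt_section_iff
    (trivializationAt (Eu n) (TangentSpace (𝓡 n)) x₀) (by simpa using hx')]
  refine Filter.EventuallyEq.contMDiffAt_iff ?_
  filter_upwards [(chartAt (Eu n) x₀).open_source.mem_nhds hx'] with y hy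
  have h := TangentBundle.continuousLinearMapAt_trivializationAt (I := 𝓡 n) (𝕜 := ℝ) hy
  have h2 := congrArg (fun L => L (X y)) h
  refine Eq.trans ?_ h2
  rw [Bundle.Trivialization.continuousLinearMapAt_apply,
    Bundle.Trivialization.coe_linearMapAt_of_mem _ (by simpa using hy)]

theorem contMDiffAt_lieD {X : ∀ x : C, TangentSpace (𝓡 n) x} {f : C → W} {x : C}
    (hX : SmoothFieldAt X x) (hf : ContMDiffAt (𝓡 n) 𝓘(ℝ, W) ∞ f x) :
    ContMDiffAt (𝓡 n) 𝓘(ℝ, W) ∞ (lieD X f) x := by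
  have := isManifold_one (n := n) (C := C)
  have hs := extChartAt_source_mem_nhds (I := 𝓡 n) x
  have h1 := (contMDiffAt_iff.1 hf).2
  rw [(𝓡 n).range_eq_univ, contDiffWithinAt_univ] at h1
  have h2 : ContDiffAt ℝ ∞ (f ∘ (extChartAt (𝓡 n) x).symm) (extChartAt (𝓡 n) x x) := h1
  have h3 : ContDiffAt ℝ ∞ (fderiv ℝ (f ∘ (extChartAt (𝓡 n) x).symm)) (extChartAt (𝓡 n) x x) :=
    h2.fderiv_right (m := ∞) (by simp)
  have h4 : ContMDiffAt (𝓡 n) 𝓘(ℝ, W) ∞ (fun y => fderiv ℝ (f ∘ (extChartAt (𝓡 n) x).symm)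
      (extChartAt (𝓡 n) x y) (lieD X (extChartAt (𝓡 n) x) y)) x :=
    (h3.comp_contMDiffAt (contMDiffAt_extChartAt (n := ∞) (I := 𝓡 n) (x := x))).clm_apply
      ((smoothFieldAt_iff (mem_extChartAt_source x)).1 hX)
  refine h4.congr_of_eventuallyEq ?_
  have h5 : ∀ᶠ y in nhds x, ContMDiffAt (𝓡 n) 𝓘(ℝ, W) 1 f y :=
    (contMDiffAt_iff_contMDiffAt_nhds (by simp)).1 (hf.of_le (by simp))
  filter_upwards [hs, h5] with y hy h6
  exact mvfderiv_eq_fderiv_chart hy (h6.mdifferentiableAt (by simp)) (X y)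

theorem contMDiff_lieD (X : VecField n C) {f : C → W} (hf : ContMDiff (𝓡 n) 𝓘(ℝ, W) ∞ f) :
    ContMDiff (𝓡 n) 𝓘(ℝ, W) ∞ (lieD (fun x => X x) f) :=
  fun x => contMDiffAt_lieD (X.smoothAt x) (hf x)

/-- The bracket of two vector fields. -/
noncomputable def bracket (X Y : VecField n C) : VecField n C :=
  ⟨VectorField.mlieBracket (𝓡 n) X Y, fun x => by
    have : IsManifold (𝓡 n) (minSmoothness ℝ 2) C :=
      IsManifold.of_le (n := ∞) (by rw [minSmoothness_of_isRCLikeNormedField]; exact two_le_infty)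
    have : IsManifold (𝓡 n) ((⊤ : ℕ∞) + 1) C := IsManifold.of_le (n := ∞) (by simp)
    have h := (X.smoothAt x).mlieBracket_vectorField (m := ⊤) (n := ⊤) (Y.smoothAt x) (by simp)
    exact h⟩

variable [T2Space C]

/-- Smooth bump functions. -/
theorem exists_bump {x : C} {U : Set C} (hU : U ∈ nhds x) :
    ∃ f : C → ℝ, ContMDiff (𝓡 n) 𝓘(ℝ, ℝ) ∞ f ∧ (∀ᶠ y in nhds x, f y = 1) ∧ tsupport f ⊆ U := by
  obtain ⟨f, -, hf⟩ := (SmoothBumpFunction.nhds_basis_tsupport (I := 𝓡 n) x).mem_iff.1 hU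
  exact ⟨f, f.contMDiff, f.eventuallyEq_one, hf⟩

theorem exists_smooth_extension {x : C} {f : C → ℝ}
    (hf : ∀ᶠ y in nhds x, ContMDiffAt (𝓡 n) 𝓘(ℝ, ℝ) ∞ f y) :
    ∃ g : C → ℝ, ContMDiff (𝓡 n) 𝓘(ℝ, ℝ) ∞ g ∧ ∀ᶠ y in nhds x, g y = f y := by
  obtain ⟨b, hb, hb1, hbU⟩ := exists_bump (n := n) hf
  refine ⟨fun y => b y • f y, ?_, hb1.mono fun y hy => by simp [hy]⟩
  refine contMDiff_of_tsupport fun y hy => ?_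
  exact (hb y).smul (hbU (closure_mono (fun z hz => by
    contrapose! hz; simp [Function.notMem_support.1 hz]) hy))

/-- Coordinate vector fields near a point. -/
theorem exists_coordinate_fields (x : C) :
    ∃ T : Eu n → VecField n C, ∀ᶠ y in nhds x, ∀ a,
      mvfderiv (𝓡 n) (extChartAt (𝓡 n) x) y (T a y) = a ∧
      T a y = mfderiv 𝓘(ℝ, Eu n) (𝓡 n) (extChartAt (𝓡 n) x).symm (extChartAt (𝓡 n) x y) a := by
  have := isManifold_one (n := n) (C := C)
  have hs := (isOpen_extChartAt_source (I := 𝓡 n) x).mem_nhds (mem_extChartAt_source x)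
  obtain ⟨b, hb, hb1, hbU⟩ := exists_bump (n := n) hs
  -- Outside the chart domain `inverse` may take its default value; the bump function, supported in
  -- the domain, removes it.
  let X (a : Eu n) (y : C) : TangentSpace (𝓡 n) y :=
    (mvfderiv (𝓡 n) (extChartAt (𝓡 n) x) y).inverse a
  have hinv : ∀ y ∈ (extChartAt (𝓡 n) x).source, ∀ a, mvfderiv (𝓡 n) (extChartAt (𝓡 n) x) y (X a y) = a := by
    intro y hy a
    obtain ⟨e, he⟩ := isInvertible_mfderiv_extChartAt (I := 𝓡 n) hy
    have he' : mvfderiv (𝓡 n) (extChartAt (𝓡 n) x) y =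
      (e.trans (NormedSpace.fromTangentSpace _) : _ →L[ℝ] _) := by
      ext v; unfold mvfderiv; rw [← he]; rfl
    simp only [X]
    rw [he', ContinuousLinearMap.inverse_equiv]
    simp
  have hX : ∀ a, ∀ y ∈ (extChartAt (𝓡 n) x).source, SmoothFieldAt (X a) y := by
    intro a y hy
    rw [smoothFieldAt_iff hy]
    refine (contMDiffAt_const (c := a)).congr_of_eventuallyEq ?_
    filter_upwards [(isOpen_extChartAt_source (I := 𝓡 n) x).mem_nhds hy] with z hz
    exact hinv z hz a
  refine ⟨fun a => ⟨b • X a, ContMDiffOn.smul_section_of_tsupport (u := (extChartAt (𝓡 n) x).source)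
    hb.contMDiffOn (isOpen_extChartAt_source x) hbU fun y hy => (hX a y hy).contMDiffWithinAt⟩, ?_⟩
  filter_upwards [hs, hb1] with y hy hb a
  have h1 : (b • X a) y = X a y := by
    change b y • X a y = X a y
    rw [hb, one_smul]
  change mvfderiv (𝓡 n) (extChartAt (𝓡 n) x) y ((b • X a) y) = a ∧ (b • X a) y = _
  rw [h1]
  refine ⟨hinv y hy a, ?_⟩
  have h2 : (X a y : Eu n) = _ := (mfderiv_symm_mvfderiv hy (X a y)).symm
  rw [hinv y hy a] at h2
  exact h2

end VectorFields

end OhPark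

namespace OhPark

/-! ### Two-forms as bilinear forms, and local coordinates on the base. -/

namespace DiffForm

variable {V : Type*} [NormedAddCommGroup V] [NormedSpace ℝ V]
  {H : Type*} [TopologicalSpace H] {I : ModelWithCorners ℝ V H}
  {N : Type*} [TopologicalSpace N] [ChartedSpace H N]

/-- The bilinear form of a two-form at a point. -/
noncomputable def pair (α : DiffForm I N 2) (x : N) :
    TangentSpace I x →ₗ[ℝ] TangentSpace I x →ₗ[ℝ] ℝ :=
  have e0 : ∀ u v : TangentSpace I x, Function.update ![0, v] 0 u = ![u, v] := by
    intro u v; funext i; fin_cases i <;> simp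
  have e1 : ∀ u v : TangentSpace I x, Function.update ![u, 0] 1 v = ![u, v] := by
    intro u v; funext i; fin_cases i <;> simp
  LinearMap.mk₂ ℝ (fun u v => α x ![u, v])
    (fun u u' v => by
      have h := (α x).map_update_add ![0, v] 0 u u'
      rwa [e0, e0, e0] at h)
    (fun c u v => by
      have h := (α x).map_update_smul ![0, v] 0 c u
      rwa [e0, e0] at h)
    (fun u v v' => by
      have h := (α x).map_update_add ![u, 0] 1 v v'
      rwa [e1, e1, e1] at h)
    (fun c u v => by
      have h := (α x).map_update_smul ![u, 0] 1 c v
      rwa [e1, e1] at h)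

theorem pair_swap (α : DiffForm I N 2) (x : N) (u v : TangentSpace I x) :
    α.pair x u v = -α.pair x v u := by
  have h := (α x).map_swap ![v, u] (i := 0) (j := 1) (by decide)
  refine Eq.trans ?_ h
  change (α x) _ = (α x) _
  congr 1
  funext i
  fin_cases i <;> simp

theorem mem_ker_iff {α : DiffForm I N 2} {x : N} {u : TangentSpace I x} :
    u ∈ α.ker x ↔ ∀ v, α.pair x u v = 0 := Iff.rfl

end DiffForm

section Coordinates

variable {n : ℕ} {C : Type*} [TopologicalSpace C] [ChartedSpace (Eu n) C]
  [IsManifold (𝓡 n) ∞ C] [T2Space C]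

/-- Coordinate functions and coordinate vector fields near a point, defined globally. -/
structure IsLocalCoordinates (x : C) (q : Fin n → C → ℝ) (T : Fin n → VecField n C) : Prop where
  smooth : ∀ i, ContMDiff (𝓡 n) 𝓘(ℝ, ℝ) ∞ (q i)
  chart : ∀ᶠ y in nhds x, ∀ i, q i y = extChartAt (𝓡 n) x y i
  dual : ∀ᶠ y in nhds x, ∀ i j, mvfderiv (𝓡 n) (q i) y (T j y) = if j = i then 1 else 0
  expand : ∀ᶠ y in nhds x, ∀ v : TangentSpace (𝓡 n) y,
    v = ∑ i, mvfderiv (𝓡 n) (q i) y v • T i y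

theorem exists_local_coordinates (x : C) :
    ∃ (q : Fin n → C → ℝ) (T : Fin n → VecField n C), IsLocalCoordinates x q T := by
  have := isManifold_one (n := n) (C := C)
  obtain ⟨T, hT⟩ := exists_coordinate_fields (n := n) x
  have hs := (isOpen_extChartAt_source (I := 𝓡 n) x).mem_nhds (mem_extChartAt_source x)
  have hc : ∀ i : Fin n, ∀ y ∈ (extChartAt (𝓡 n) x).source,
      ContMDiffAt (𝓡 n) 𝓘(ℝ, ℝ) ∞ (EuclideanSpace.proj i ∘ extChartAt (𝓡 n) x) y := fun i y hy =>
    (EuclideanSpace.proj (𝕜 := ℝ) i).contMDiff.contMDiffAt.comp y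
      (contMDiffAt_extChartAt' (by rwa [extChartAt_source] at hy))
  choose q hq hqe using fun i : Fin n => exists_smooth_extension (n := n) (x := x)
    (Filter.mem_of_superset hs (hc i))
  refine ⟨q, fun i => T (EuclideanSpace.single i 1), ?_⟩
  suffices hkey : ∀ᶠ y in nhds x,
      (∀ i j, mvfderiv (𝓡 n) (q i) y (T (EuclideanSpace.single j 1) y) = if j = i then 1 else 0) ∧
      ∀ v : TangentSpace (𝓡 n) y,
        v = ∑ i, mvfderiv (𝓡 n) (q i) y v • T (EuclideanSpace.single i 1) y from
    ⟨hq, Filter.eventually_all.2 hqe, hkey.mono fun _ h => h.1, hkey.mono fun _ h => h.2⟩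
  filter_upwards [hT, hs, Filter.eventually_all.2 fun i => (hqe i).eventually_nhds] with y hTy hy hqy
  have hd : ∀ i (v : TangentSpace (𝓡 n) y), mvfderiv (𝓡 n) (q i) y v =
      (mvfderiv (𝓡 n) (extChartAt (𝓡 n) x) y v) i := by
    intro i v
    rw [mvfderiv_congr (hqy i), mvfderiv_comp_apply (EuclideanSpace.proj (𝕜 := ℝ) i).differentiableAt
      (mdifferentiableAt_extChartAt (by rwa [extChartAt_source] at hy)),
      ContinuousLinearMap.fderiv]
    rfl
  constructor
  · intro i j
    rw [hd, (hTy _).1]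
    simp [eq_comm]
  · intro v
    refine mvfderiv_chart_injective (I := 𝓡 n) hy ?_
    simp only [map_sum, map_smul, (hTy _).1, hd]
    ext i
    simp [Finset.sum_apply, Pi.single_apply]

end Coordinates

/-! ### The splitting of the tangent bundle into the kernel and its complement. -/

section Complement

variable {n : ℕ} {C : Type*} [TopologicalSpace C] [ChartedSpace (Eu n) C]
  [IsManifold (𝓡 n) ∞ C]

/-- A closed smooth two-form on `C` with an involutive complement of its kernel. Smoothness and
closedness are given in the form in which they are used. -/
structure IsPolarized (α : DiffForm (𝓡 n) C 2) (G : ∀ x : C, Submodule ℝ (TangentSpace (𝓡 n) x)) :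
    Prop where
  contMDiffAt_pair : ∀ {X Y : ∀ x : C, TangentSpace (𝓡 n) x} {x : C}, SmoothFieldAt X x →
    SmoothFieldAt Y x → ContMDiffAt (𝓡 n) 𝓘(ℝ, ℝ) ∞ (fun x => α.pair x (X x) (Y x)) x
  differentiableAt : ∀ x, DifferentiableAt ℝ (α.inChart x) (extChartAt (𝓡 n) x x)
  closed : ∀ x, extDeriv (α.inChart x) (extChartAt (𝓡 n) x x) = 0
  compl : ∀ x, IsCompl (α.ker x) (G x)
  bundle : IsSubbundle G
  involutive : IsInvolutive G

theorem contMDiffAt_pair_pullback {m : ℕ} {M : Type*} [TopologicalSpace M] [ChartedSpace (Eu m) M]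
    [IsManifold (𝓡 m) ∞ M] {om : DiffForm (𝓡 m) M 2} (hom : om.IsSmooth) {f : C → M}
    (hf : ContMDiff (𝓡 n) (𝓡 m) ∞ f) {X Y : ∀ x : C, TangentSpace (𝓡 n) x} {x : C}
    (hX : SmoothFieldAt X x) (hY : SmoothFieldAt Y x) :
    ContMDiffAt (𝓡 n) 𝓘(ℝ, ℝ) ∞ (fun x => (om.pullback (𝓡 n) f).pair x (X x) (Y x)) x := by
  have := isManifold_one (n := m) (C := M)
  have hg : ContMDiffAt (𝓡 n) 𝓘(ℝ, Eu m) ∞ (extChartAt (𝓡 m) (f x) ∘ f) x :=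
    (contMDiffAt_extChartAt (n := ∞) (I := 𝓡 m)).comp x (hf x)
  have h1 : ContMDiffAt (𝓡 n) 𝓘(ℝ, ℝ) ∞ (fun y => toBilin (Eu m)
      (om.inChart (f x) ((extChartAt (𝓡 m) (f x) ∘ f) y))
      (lieD X (extChartAt (𝓡 m) (f x) ∘ f) y) (lieD Y (extChartAt (𝓡 m) (f x) ∘ f) y)) x := by
    refine ContMDiffAt.clm_apply (ContMDiffAt.clm_apply ?_ (contMDiffAt_lieD hX hg))
      (contMDiffAt_lieD hY hg)
    refine ContDiffAt.comp_contMDiffAt (g := fun y => toBilin (Eu m) (om.inChart (f x) y)) ?_ hg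
    exact (ContinuousLinearMap.contDiff (E := Eu m [⋀^Fin 2]→L[ℝ] ℝ)
      (F := Eu m →L[ℝ] Eu m →L[ℝ] ℝ) (toBilin (Eu m))).contDiffAt.comp _
      (DiffForm.contDiffAt_inChart hom (mem_extChartAt_source (f x)))
  refine h1.congr_of_eventuallyEq ?_
  filter_upwards [hf.continuous.continuousAt.eventually
    (extChartAt_source_mem_nhds (I := 𝓡 m) (f x))] with y hy
  rw [toBilin_apply]
  have h2 : ∀ Z : ∀ x : C, TangentSpace (𝓡 n) x, lieD Z (extChartAt (𝓡 m) (f x) ∘ f) y =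
      mvfderiv (𝓡 m) (extChartAt (𝓡 m) (f x)) (f y) (mfderiv (𝓡 n) (𝓡 m) f y (Z y)) := fun Z =>
    mvfderiv_comp_mfderiv (I := 𝓡 m) (I' := 𝓡 n)
      (mdifferentiableAt_extChartAt (by rwa [extChartAt_source] at hy)) (hf.mdifferentiableAt (by simp)) (Z y)
  rw [h2, h2]
  refine (DiffForm.apply_eq_inChart om hy _).trans ?_
  congr 1
  funext i
  fin_cases i <;> rfl

namespace IsPolarized

variable {α : DiffForm (𝓡 n) C 2} {G : ∀ x : C, Submodule ℝ (TangentSpace (𝓡 n) x)}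
  (h : IsPolarized α G)

include h

/-- `α` is nondegenerate on `G`: the kernel part of a test vector pairs to zero, so a vector of `G`
orthogonal to `G` lies in the kernel as well. -/
theorem eq_zero_of_pair {x : C} {u : TangentSpace (𝓡 n) x} (hu : u ∈ G x)
    (hp : ∀ v ∈ G x, α.pair x u v = 0) : u = 0 := by
  have hk : u ∈ α.ker x := by
    rw [DiffForm.mem_ker_iff]
    intro v
    have hv : v ∈ α.ker x ⊔ G x := by rw [(h.compl x).sup_eq_top]; trivial
    obtain ⟨k, hk, g, hg, rfl⟩ := Submodule.mem_sup.1 hv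
    rw [map_add, hp g hg, add_zero, DiffForm.pair_swap, DiffForm.mem_ker_iff.1 hk, neg_zero]
  exact Submodule.disjoint_def.1 (h.compl x).disjoint u hk hu

/-- A field of vectors in `G` is smooth if its pairings with the sections of `G` are. -/
theorem smoothFieldAt_of_pair {Y : ∀ x : C, TangentSpace (𝓡 n) x} (hY : ∀ x, Y x ∈ G x)
    (hp : ∀ Z ∈ sections G, ContMDiff (𝓡 n) 𝓘(ℝ, ℝ) ∞ fun x => α.pair x (Y x) (Z x)) (x : C) :
    SmoothFieldAt Y x := by
  classical
  set r := Module.finrank ℝ (G x) with hr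
  let b := Module.finBasis ℝ (G x)
  choose Z hZ hZx using fun i => h.bundle.smooth x (b i) (b i).2
  -- The Gram matrix of a frame of `G`. The coefficients of `Y` solve a linear system with this
  -- matrix, with smooth data.
  let A (y : C) : Matrix (Fin r) (Fin r) ℝ := fun i j => α.pair y (Z j y) (Z i y)
  let β (y : C) (i : Fin r) : ℝ := α.pair y (Y y) (Z i y)
  have hA : ∀ i j, ContMDiff (𝓡 n) 𝓘(ℝ, ℝ) ∞ fun y => A y i j := fun i j y =>
    h.contMDiffAt_pair ((Z j).smoothAt y) ((Z i).smoothAt y)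
  have hβ : ∀ i, ContMDiff (𝓡 n) 𝓘(ℝ, ℝ) ∞ fun y => β y i := fun i => hp _ (hZ i)
  have hdet : ∀ B : C → Matrix (Fin r) (Fin r) ℝ,
      (∀ i j, ContMDiff (𝓡 n) 𝓘(ℝ, ℝ) ∞ fun y => B y i j) →
      ContMDiff (𝓡 n) 𝓘(ℝ, ℝ) ∞ fun y => (B y).det := by
    intro B hB
    simp only [Matrix.det_apply]
    refine contMDiff_finsetSum fun σ _ => ?_
    have : ContMDiff (𝓡 n) 𝓘(ℝ, ℝ) ∞ fun y => ∏ i, B y (σ i) i :=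
      contMDiff_finsetProd fun i _ => hB _ _
    exact (contDiff_const_smul (𝕜 := ℝ) (Equiv.Perm.sign σ)).contMDiff.comp this
  have hcr : ∀ i, ContMDiff (𝓡 n) 𝓘(ℝ, ℝ) ∞ fun y => (A y).cramer (β y) i := by
    intro i
    simp only [Matrix.cramer_apply]
    refine hdet _ fun k l => ?_
    by_cases hl : l = i
    · subst hl; simpa [Matrix.updateCol_apply] using hβ k
    · simpa [Matrix.updateCol_apply, hl] using hA k l
  -- a linear relation for the Gram matrix gives one for the fields
  have hrel : ∀ y, ∀ c : Fin r → ℝ, (A y).mulVec c = fun i => α.pair y (∑ j, c j • Z j y) (Z i y) := by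
    intro y c
    funext i
    simp only [Matrix.mulVec, dotProduct, map_sum, LinearMap.sum_apply, map_smul,
      LinearMap.smul_apply, smul_eq_mul, A]
    exact Finset.sum_congr rfl fun j _ => mul_comm _ _
  have hx : (A x).det ≠ 0 := by
    intro h0
    obtain ⟨c, hc, hc0⟩ := Matrix.exists_mulVec_eq_zero_iff.2 h0
    rw [hrel] at hc0
    apply hc
    have hsum : (∑ j, c j • Z j x) = ((∑ j, c j • b j : G x) : TangentSpace (𝓡 n) x) := by
      simp [hZx]
    have h1 : (∑ j, c j • Z j x) = 0 := by
      refine h.eq_zero_of_pair (hsum ▸ Submodule.coe_mem _) fun v hv => ?_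
      obtain ⟨a, ha⟩ : ∃ a : Fin r → ℝ, v = ∑ i, a i • Z i x := by
        refine ⟨b.repr ⟨v, hv⟩, ?_⟩
        calc v = ((∑ i, b.repr ⟨v, hv⟩ i • b i : G x) : TangentSpace (𝓡 n) x) := by
              rw [b.sum_repr]
          _ = _ := by simp only [Submodule.coe_sum, Submodule.coe_smul, hZx]; rfl
      rw [ha, map_sum]
      refine Finset.sum_eq_zero fun i _ => ?_
      rw [map_smul, congrFun hc0 i]
      simp
    rw [hsum] at h1
    have h2 : (∑ j, c j • b j : G x) = 0 := Subtype.ext h1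
    funext j
    exact Fintype.linearIndependent_iff.1 b.linearIndependent c h2 j
  have hne : ∀ᶠ y in nhds x, (A y).det ≠ 0 := (hdet A hA).continuous.continuousAt.eventually_ne hx
  have hrk : ∀ᶠ y in nhds x, Module.finrank ℝ (G y) = r :=
    h.bundle.rank.eventually_eq x
  -- The solution by Cramer's rule, smooth because the determinant does not vanish at `x`. It is
  -- then compared with `Y` by pairing with the frame.
  have hZs : SmoothFieldAt (fun y => ∑ j, ((A y).det⁻¹ * (A y).cramer (β y) j) • Z j y) x := by
    refine ContMDiffAt.sum_section fun j _ => ?_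
    refine ContMDiffAt.smul_section (f := fun y => (A y).det⁻¹ * (A y).cramer (β y) j) ?_
      ((Z j).smoothAt x)
    exact ((hdet A hA x).inv₀ hx).mul (hcr j x)
  refine hZs.congr_of_eventuallyEq ?_
  filter_upwards [hne, hrk] with y hy hry
  congr 1
  rw [← sub_eq_zero]
  have hmem : ∀ c : Fin r → ℝ, ∑ j, c j • Z j y ∈ G y := fun c =>
    Submodule.sum_mem _ fun j _ => Submodule.smul_mem _ _ (hZ j y)
  -- the fields form a basis of `G y`
  have hli : LinearIndependent ℝ fun j => (⟨Z j y, hZ j y⟩ : G y) := by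
    rw [Fintype.linearIndependent_iff]
    intro c hc
    have hc' : ∑ j, c j • Z j y = 0 := by simpa using congrArg Subtype.val hc
    have h1 := hrel y c
    rw [hc'] at h1
    have h2 : (A y).mulVec c = 0 := by rw [h1]; funext i; simp
    exact congrFun (Matrix.eq_zero_of_mulVec_eq_zero hy h2)
  have hspan := hli.span_eq_top_of_card_eq_finrank' (by rw [Fintype.card_fin, hry])
  refine h.eq_zero_of_pair (Submodule.sub_mem _ (hY y) (hmem _)) fun v hv => ?_
  have hv' : (⟨v, hv⟩ : G y) ∈ Submodule.span ℝ (Set.range fun j => (⟨Z j y, hZ j y⟩ : G y)) := by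
    rw [hspan]; trivial
  obtain ⟨a, ha⟩ := (Submodule.mem_span_range_iff_exists_fun ℝ).1 hv'
  have ha' : v = ∑ j, a j • Z j y := by simpa using (congrArg Subtype.val ha).symm
  rw [ha', map_sum]
  refine Finset.sum_eq_zero fun i _ => ?_
  have h3 := congrFun (hrel y fun j => (A y).det⁻¹ * (A y).cramer (β y) j) i
  have h4 : (A y).mulVec (fun j => (A y).det⁻¹ * (A y).cramer (β y) j) = β y := by
    have : (fun j => (A y).det⁻¹ * (A y).cramer (β y) j) = (A y).det⁻¹ • (A y).cramer (β y) := rfl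
    rw [this, Matrix.mulVec_smul, Matrix.mulVec_cramer, smul_smul, inv_mul_cancel₀ hy, one_smul]
  rw [h4] at h3
  rw [map_smul, map_sub, LinearMap.sub_apply, ← h3]
  simp [β]

theorem pair_kernel {x : C} (u v : TangentSpace (𝓡 n) x) (hu : u ∈ α.ker x) :
    α.pair x v u = 0 := by
  rw [DiffForm.pair_swap, DiffForm.mem_ker_iff.1 hu, neg_zero]

theorem projection_add (x : C) (u : TangentSpace (𝓡 n) x) :
    ((α.ker x).projectionOnto (G x) (h.compl x) u : TangentSpace (𝓡 n) x) +
      (G x).projectionOnto (α.ker x) (h.compl x).symm u = u :=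
  Submodule.projection_add_projection_eq_self (h.compl x) u

/-- The component along `G` of a vector field. -/
noncomputable def projG (X : VecField n C) : VecField n C :=
  ⟨fun x => ((G x).projectionOnto (α.ker x) (h.compl x).symm (X x) : TangentSpace (𝓡 n) x),
    h.smoothFieldAt_of_pair (fun x => Submodule.coe_mem _) fun Z hZ x => by
      refine (h.contMDiffAt_pair (X.smoothAt x) (Z.smoothAt x)).congr_of_eventuallyEq
        (Filter.Eventually.of_forall fun y => ?_)
      change α.pair y _ _ = α.pair y _ _
      -- The kernel part of `X` does not contribute to pairings, so those of the `G`-part are the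
      -- smooth pairings of `X`.
      conv_rhs => rw [← h.projection_add y (X y), map_add, LinearMap.add_apply,
        DiffForm.mem_ker_iff.1 (Submodule.coe_mem _), zero_add]⟩

theorem projG_apply (X : VecField n C) (x : C) :
    h.projG X x = ((G x).projectionOnto (α.ker x) (h.compl x).symm (X x) : TangentSpace (𝓡 n) x) :=
  rfl

theorem projG_mem (X : VecField n C) : h.projG X ∈ sections G := fun _ => Submodule.coe_mem _

/-- The component along the kernel of a vector field. -/
noncomputable def projK : VecField n C →ₗ[ℝ] sections α.ker where
  toFun X := ⟨X - h.projG X, fun x => by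
    have e : (X - h.projG X) x = X x - h.projG X x := rfl
    rw [e, projG_apply, sub_eq_iff_eq_add.2 (h.projection_add x (X x)).symm]
    exact Submodule.coe_mem _⟩
  map_add' X Y := by
    ext x : 3
    change (X x + Y x) - _ = (X x - _) + (Y x - _)
    rw [projG_apply, projG_apply, projG_apply]
    rw [show (X + Y) x = X x + Y x from rfl, map_add, Submodule.coe_add]
    abel
  map_smul' c X := by
    ext x : 3
    change c • X x - _ = c • (X x - _)
    rw [projG_apply, projG_apply]
    rw [show (c • X) x = c • X x from rfl, map_smul, Submodule.coe_smul, smul_sub]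

theorem projK_apply (X : VecField n C) (x : C) :
    ((h.projK X).1 x : TangentSpace (𝓡 n) x) =
      (α.ker x).projectionOnto (G x) (h.compl x) (X x) :=
  sub_eq_iff_eq_add.2 (h.projection_add x (X x)).symm

theorem projK_add_projG (X : VecField n C) : (h.projK X).1 + h.projG X = X :=
  sub_add_cancel X _

theorem projK_of_mem (X : sections α.ker) : h.projK X.1 = X := by
  ext x : 3
  rw [projK_apply, Submodule.projectionOnto_apply_of_mem_left _ (X.2 x)]

theorem projK_eq_zero {X : VecField n C} (hX : X ∈ sections G) : h.projK X = 0 := by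
  ext x : 3
  rw [projK_apply, (Submodule.projectionOnto_apply_eq_zero_iff _).2 (hX x)]
  rfl

/-- Every covector field on `G` is the contraction of `α` with a unique field in `G`; this is the
field with values in `G` that corresponds to the differential of `f`. -/
theorem exists_hamiltonian {f : C → ℝ} (hf : ContMDiff (𝓡 n) 𝓘(ℝ, ℝ) ∞ f) :
    ∃ Y ∈ sections G, ∀ x, ∀ u ∈ G x, α.pair x (Y x) u = -mvfderiv (𝓡 n) f x u := by
  have h1 : ∀ x, ∃ v ∈ G x, ∀ u ∈ G x, α.pair x v u = -mvfderiv (𝓡 n) f x u := by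
    intro x
    let L : G x →ₗ[ℝ] Module.Dual ℝ (G x) :=
      (LinearMap.lcomp ℝ ℝ (G x).subtype).comp ((α.pair x).comp (G x).subtype)
    have hL : Function.Injective L := by
      rw [injective_iff_map_eq_zero]
      intro u hu
      exact Subtype.ext (h.eq_zero_of_pair u.2 fun v hv => LinearMap.congr_fun hu ⟨v, hv⟩)
    have hs := (LinearMap.injective_iff_surjective_of_finrank_eq_finrank
      (Subspace.dual_finrank_eq (K := ℝ) (V := G x)).symm).1 hL
    obtain ⟨v, hv⟩ := hs (-((mvfderiv (𝓡 n) f x : _ →L[ℝ] ℝ).toLinearMap.comp (G x).subtype))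
    exact ⟨v, v.2, fun u hu => LinearMap.congr_fun hv ⟨u, hu⟩⟩
  choose Y hY hYu using h1
  refine ⟨⟨Y, h.smoothFieldAt_of_pair hY fun Z hZ x => ?_⟩, hY, hYu⟩
  refine (contMDiffAt_lieD (Z.smoothAt x) (hf x)).neg.congr_of_eventuallyEq
    (Filter.Eventually.of_forall fun y => hYu y _ (hZ y))

/-- The projection along `G` preserves smoothness, so any smooth field through `u` can be projected
to the kernel. In this way the kernel inherits enough sections from `α` and `G`. -/
theorem exists_section [T2Space C] {x : C} {u : TangentSpace (𝓡 n) x} (hu : u ∈ α.ker x) :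
    ∃ X : sections α.ker, X.1 x = u := by
  have := isManifold_one (n := n) (C := C)
  obtain ⟨T, hT⟩ := exists_coordinate_fields (n := n) x
  refine ⟨h.projK (T (mvfderiv (𝓡 n) (extChartAt (𝓡 n) x) x u)), ?_⟩
  have h1 : T (mvfderiv (𝓡 n) (extChartAt (𝓡 n) x) x u) x = u :=
    mvfderiv_chart_injective (mem_extChartAt_source (I := 𝓡 n) x)
      (hT.self_of_nhds (mvfderiv (𝓡 n) (extChartAt (𝓡 n) x) x u)).1
  rw [projK_apply, h1, Submodule.projectionOnto_apply_of_mem_left _ hu]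

end IsPolarized

end Complement

end OhPark

namespace OhPark

/-! ### Charts, projection and vertical vectors of a vector bundle. -/

section BundleCharts

variable {n : ℕ} {C : Type*} [TopologicalSpace C] [ChartedSpace (Eu n) C]
  [IsManifold (𝓡 n) ∞ C]
  {F : Type*} [NormedAddCommGroup F] [NormedSpace ℝ F]
  {E : C → Type*} [TopologicalSpace (Bundle.TotalSpace F E)]
  [∀ x, AddCommGroup (E x)] [∀ x, Module ℝ (E x)] [∀ x, TopologicalSpace (E x)]
  [FiberBundle F E] [VectorBundle ℝ F E] [ContMDiffVectorBundle ∞ F E (𝓡 n)]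
  {W : Type*} [NormedAddCommGroup W] [NormedSpace ℝ W]

variable (n F) in
/-- The model with corners of the total space of a bundle with fibre `F`. -/
noncomputable abbrev bundleModel : ModelWithCorners ℝ (Eu n × F) (ModelProd (Eu n) F) := (𝓡 n).prod 𝓘(ℝ, F)

theorem extChartAt_bundle_apply (e e' : Bundle.TotalSpace F E) :
    extChartAt (bundleModel n F) e e' =
      (extChartAt (𝓡 n) e.proj (trivializationAt F E e.proj e').1,
        (trivializationAt F E e.proj e').2) := by
  rw [FiberBundle.extChartAt]
  rfl

theorem mem_extChartAt_bundle_source {e e' : Bundle.TotalSpace F E} :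
    e' ∈ (extChartAt (bundleModel n F) e).source ↔
      e'.proj ∈ (trivializationAt F E e.proj).baseSet ∧ e'.proj ∈ (extChartAt (𝓡 n) e.proj).source := by
  rw [FiberBundle.extChartAt, PartialEquiv.trans_source, Set.mem_inter_iff]
  have h0 := (trivializationAt F E e.proj).mem_source (x := e')
  constructor
  · rintro ⟨h1, h2⟩
    have h1' := h0.1 h1
    have h2' : (trivializationAt F E e.proj e').1 ∈ (extChartAt (𝓡 n) e.proj).source := h2.1
    rw [(trivializationAt F E e.proj).coe_fst' h1'] at h2'
    exact ⟨h1', h2'⟩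
  · rintro ⟨h1, h2⟩
    refine ⟨h0.2 h1, ?_, trivial⟩
    change (trivializationAt F E e.proj e').1 ∈ (extChartAt (𝓡 n) e.proj).source
    rwa [(trivializationAt F E e.proj).coe_fst' h1]

theorem extChartAt_bundle_fst {e e' : Bundle.TotalSpace F E}
    (h : e' ∈ (extChartAt (bundleModel n F) e).source) :
    (extChartAt (bundleModel n F) e e').1 = extChartAt (𝓡 n) e.proj e'.proj := by
  rw [extChartAt_bundle_apply, (trivializationAt F E e.proj).coe_fst'
    (mem_extChartAt_bundle_source.1 h).1]

/-- The differential of the projection of a bundle. -/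
noncomputable def dproj (e : Bundle.TotalSpace F E) :
    TangentSpace (bundleModel n F) e →L[ℝ] TangentSpace (𝓡 n) e.proj :=
  mfderiv (bundleModel n F) (𝓡 n) (Bundle.TotalSpace.proj : Bundle.TotalSpace F E → C) e

theorem isManifold_bundle : IsManifold (bundleModel n F) 1 (Bundle.TotalSpace F E) :=
  have : IsManifold (bundleModel n F) ∞ (Bundle.TotalSpace F E) := inferInstance
  IsManifold.of_le (n := ∞) (by simp)

theorem mdifferentiableAt_proj' (e : Bundle.TotalSpace F E) :
    MDifferentiableAt (bundleModel n F) (𝓡 n) (Bundle.TotalSpace.proj : Bundle.TotalSpace F E → C) e :=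
  (Bundle.contMDiff_proj (n := 1) E).mdifferentiableAt (by simp)

theorem mvfderiv_comp_proj {f : C → W} {e : Bundle.TotalSpace F E}
    (hf : MDifferentiableAt (𝓡 n) 𝓘(ℝ, W) f e.proj) (w : TangentSpace (bundleModel n F) e) :
    mvfderiv (bundleModel n F) (fun e' : Bundle.TotalSpace F E => f e'.proj) e w =
      mvfderiv (𝓡 n) f e.proj (dproj e w) :=
  mvfderiv_comp_mfderiv hf (mdifferentiableAt_proj' e) w

theorem mvfderiv_extChartAt_bundle_fst {e e' : Bundle.TotalSpace F E}
    (he : e' ∈ (extChartAt (bundleModel n F) e).source) (w : TangentSpace (bundleModel n F) e') :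
    (mvfderiv (bundleModel n F) (extChartAt (bundleModel n F) e) e' w).1 =
      mvfderiv (𝓡 n) (extChartAt (𝓡 n) e.proj) e'.proj (dproj e' w) := by
  have := isManifold_one (n := n) (C := C)
  have := isManifold_bundle (n := n) (F := F) (E := E)
  have h1 : MDifferentiableAt (𝓡 n) 𝓘(ℝ, Eu n) (extChartAt (𝓡 n) e.proj) e'.proj :=
    mdifferentiableAt_extChartAt (by
      have := (mem_extChartAt_bundle_source.1 he).2
      rwa [extChartAt_source] at this)
  have h2 : MDifferentiableAt (bundleModel n F) 𝓘(ℝ, Eu n × F) (extChartAt (bundleModel n F) e) e' :=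
    mdifferentiableAt_extChartAt (by rwa [extChartAt_source] at he)
  rw [← mvfderiv_comp_proj h1]
  have h3 := mvfderiv_comp_apply (I := bundleModel n F) (g := (Prod.fst : Eu n × F → Eu n))
    (f := extChartAt (bundleModel n F) e) (x := e') differentiableAt_fst h2 w
  rw [fderiv_fst] at h3
  refine Eq.trans h3.symm ?_
  have h4 : (Prod.fst ∘ extChartAt (bundleModel n F) e : Bundle.TotalSpace F E → Eu n)
      =ᶠ[nhds e'] fun e'' => extChartAt (𝓡 n) e.proj e''.proj := by
    filter_upwards [(isOpen_extChartAt_source e).mem_nhds he] with z hz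
    exact extChartAt_bundle_fst hz
  rw [mvfderiv_congr h4]

theorem dproj_surjective (e : Bundle.TotalSpace F E) (u : TangentSpace (𝓡 n) e.proj) :
    ∃ w : TangentSpace (bundleModel n F) e, dproj e w = u := by
  have := isManifold_one (n := n) (C := C)
  have := isManifold_bundle (n := n) (F := F) (E := E)
  -- The differential of the preferred chart at its own base point is the identity, so a pair of
  -- coordinates is a tangent vector.
  let w : TangentSpace (bundleModel n F) e :=
    (mvfderiv (𝓡 n) (extChartAt (𝓡 n) e.proj) e.proj u, (0 : F))
  have hw : mvfderiv (bundleModel n F) (extChartAt (bundleModel n F) e) e w = w :=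
    congrArg (fun L => L w) (mfderiv_extChartAt_self (I := bundleModel n F) (x := e))
  refine ⟨w, mvfderiv_chart_injective (mem_extChartAt_source (I := 𝓡 n) e.proj) ?_⟩
  rw [← mvfderiv_extChartAt_bundle_fst (mem_extChartAt_source e) w, hw]

/-- The identification of a fibre with the model fibre. -/
noncomputable def fibreEquiv (x : C) : E x ≃L[ℝ] F :=
  (trivializationAt F E x).continuousLinearEquivAt ℝ x
    (FiberBundle.mem_baseSet_trivializationAt' x)

/-- The inclusion of a fibre. -/
noncomputable def fibreIncl (x : C) (y : F) : Bundle.TotalSpace F E :=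
  ⟨x, (fibreEquiv x).symm y⟩

theorem trivialization_fibreIncl (x : C) (y : F) :
    trivializationAt F E x (fibreIncl x y) = (x, y) := by
  refine Prod.ext ?_ ?_
  · exact (trivializationAt F E x).coe_fst' (FiberBundle.mem_baseSet_trivializationAt' x)
  · exact (fibreEquiv (F := F) (E := E) x).apply_symm_apply y

theorem fibreIncl_fibreEquiv (e : Bundle.TotalSpace F E) :
    fibreIncl e.proj (fibreEquiv e.proj e.2) = e := by
  unfold fibreIncl
  rw [ContinuousLinearEquiv.symm_apply_apply]

theorem contMDiff_fibreIncl (x : C) :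
    ContMDiff 𝓘(ℝ, F) (bundleModel n F) ∞ (fibreIncl (E := E) x : F → Bundle.TotalSpace F E) := by
  intro y
  rw [Bundle.contMDiffAt_totalSpace]
  refine ⟨contMDiffAt_const, ?_⟩
  have : (fun y' : F => (trivializationAt F E (fibreIncl (E := E) x y).proj
      (fibreIncl (E := E) x y')).2) = id := by
    funext y'
    exact congrArg Prod.snd (trivialization_fibreIncl (E := E) x y')
  rw [this]
  exact contMDiffAt_id

/-- The vertical tangent vectors. -/
noncomputable def vert (x : C) (y v : F) :
    TangentSpace (bundleModel n F) (fibreIncl (E := E) x y) :=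
  mfderiv 𝓘(ℝ, F) (bundleModel n F) (fibreIncl (E := E) x) y v

theorem mvfderiv_vert {x : C} {y : F} {f : Bundle.TotalSpace F E → W}
    (hf : MDifferentiableAt (bundleModel n F) 𝓘(ℝ, W) f (fibreIncl x y)) (v : F) :
    mvfderiv (bundleModel n F) f (fibreIncl x y) (vert x y v) =
      fderiv ℝ (fun y' => f (fibreIncl x y')) y v := by
  rw [← mvfderiv_eq_fderiv]
  exact (mvfderiv_comp_mfderiv (I' := 𝓘(ℝ, F)) hf
    ((contMDiff_fibreIncl (n := n) x).mdifferentiableAt (by simp)) v).symm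

theorem dproj_vert (x : C) (y v : F) : dproj (n := n) (fibreIncl (E := E) x y) (vert x y v) = 0 := by
  have h := mfderiv_comp (I := 𝓘(ℝ, F)) (I' := bundleModel n F) (I'' := 𝓡 n) y
    (mdifferentiableAt_proj' (n := n) (fibreIncl (E := E) x y))
    ((contMDiff_fibreIncl (n := n) x).mdifferentiableAt (by simp))
  have h2 : (Bundle.TotalSpace.proj ∘ fibreIncl (E := E) x : F → C) = fun _ => x := rfl
  rw [h2, mfderiv_const] at h
  exact (congrArg (fun L => L v) h).symm

theorem exists_vert {x : C} {y : F} {w : TangentSpace (bundleModel n F) (fibreIncl (E := E) x y)}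
    (hw : dproj (fibreIncl (E := E) x y) w = 0) : ∃ v, w = vert x y v := by
  have := isManifold_one (n := n) (C := C)
  have := isManifold_bundle (n := n) (F := F) (E := E)
  -- The witness is the fibre component in the chart; the base component vanishes on both sides.
  refine ⟨(mvfderiv (bundleModel n F) (extChartAt (bundleModel n F) (fibreIncl (E := E) x y)) (fibreIncl (E := E) x y) w).2,
    mvfderiv_chart_injective (mem_extChartAt_source (I := bundleModel n F) (fibreIncl (E := E) x y)) ?_⟩
  refine Prod.ext ?_ ?_
  · rw [mvfderiv_extChartAt_bundle_fst (mem_extChartAt_source (fibreIncl (E := E) x y)), hw,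
      mvfderiv_extChartAt_bundle_fst (mem_extChartAt_source (fibreIncl (E := E) x y))]
    have := dproj_vert (n := n) (E := E) x y
      (mvfderiv (bundleModel n F) (extChartAt (bundleModel n F) (fibreIncl (E := E) x y)) (fibreIncl (E := E) x y) w).2
    rw [this]
  · have h2 : MDifferentiableAt (bundleModel n F) 𝓘(ℝ, Eu n × F) (extChartAt (bundleModel n F) (fibreIncl (E := E) x y)) (fibreIncl (E := E) x y) :=
      mdifferentiableAt_extChartAt (mem_chart_source _ (fibreIncl (E := E) x y))
    rw [mvfderiv_vert h2]
    have h3 : (fun y' => extChartAt (bundleModel n F) (fibreIncl (E := E) x y) (fibreIncl x y')) =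
        fun y' => (extChartAt (𝓡 n) x x, y') := by
      funext y'
      rw [extChartAt_bundle_apply]
      have := trivialization_fibreIncl (E := E) x y'
      change (extChartAt (𝓡 n) x (trivializationAt F E x (fibreIncl x y')).1, (trivializationAt F E x (fibreIncl x y')).2) = _
      rw [this]
    rw [h3, (hasFDerivAt_prodMk_right (extChartAt (𝓡 n) x x) y).fderiv]
    rfl

end BundleCharts

end OhPark

namespace OhPark

/-! ### The canonical symplectic form in bundle coordinates. -/

section Canonical

variable {n : ℕ} {C : Type*} [TopologicalSpace C] [ChartedSpace (Eu n) C]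
  [IsManifold (𝓡 n) ∞ C]

/-- The trivialization of the cotangent bundle is dual to that of the tangent bundle, which is the
differential of the chart; hence the pairing is preserved. -/
theorem trivialization_cotangent_apply {x : C} {p : Cotangent n C}
    (hp : p.proj ∈ (extChartAt (𝓡 n) x).source) (u : TangentSpace (𝓡 n) p.proj) :
    (trivializationAt (Eu n →L[ℝ] ℝ) (fun x : C => TangentSpace (𝓡 n) x →L[ℝ] ℝ) x p).2
      (mvfderiv (𝓡 n) (extChartAt (𝓡 n) x) p.proj u) = p.2 u := by
  have := isManifold_one (n := n) (C := C)
  have hp' : p.proj ∈ (chartAt (Eu n) x).source := by rwa [extChartAt_source] at hp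
  have h1 := congrArg (fun L => L u)
    (TangentBundle.continuousLinearMapAt_trivializationAt (I := 𝓡 n) (𝕜 := ℝ) hp')
  have h2 : mvfderiv (𝓡 n) (extChartAt (𝓡 n) x) p.proj u =
    (trivializationAt (Eu n) (TangentSpace (𝓡 n)) x).continuousLinearMapAt ℝ p.proj u := h1.symm
  rw [h2, hom_trivializationAt_apply]
  change ((trivializationAt ℝ (Bundle.Trivial C ℝ) x).continuousLinearMapAt ℝ p.proj)
    (p.2 ((trivializationAt (Eu n) (TangentSpace (𝓡 n)) x).symmL ℝ p.proj _)) = _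
  have h3 : (trivializationAt ℝ (Bundle.Trivial C ℝ) x).continuousLinearMapAt ℝ p.proj =
    ContinuousLinearMap.id ℝ ℝ := Bundle.Trivial.continuousLinearMapAt_trivialization ..
  rw [h3]
  change p.2 ((trivializationAt (Eu n) (TangentSpace (𝓡 n)) x).symmL ℝ p.proj _) = _
  rw [Bundle.Trivialization.symmL_continuousLinearMapAt _ (by simpa using hp')]

theorem tautologicalForm_apply {p p' : Cotangent n C}
    (hp : p' ∈ (extChartAt (bundleModel n (Eu n →L[ℝ] ℝ)) p).source)
    (w : Fin 1 → TangentSpace (bundleModel n (Eu n →L[ℝ] ℝ)) p') :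
    tautologicalForm n C p' w = (extChartAt (bundleModel n (Eu n →L[ℝ] ℝ)) p p').2
      (mvfderiv (bundleModel n (Eu n →L[ℝ] ℝ)) (extChartAt (bundleModel n (Eu n →L[ℝ] ℝ)) p)
        p' (w 0)).1 := by
  rw [mvfderiv_extChartAt_bundle_fst hp, extChartAt_bundle_apply]
  exact (trivialization_cotangent_apply (mem_extChartAt_bundle_source.1 hp).2 _).symm

/-- The one-form `(a, b) ↦ q a` at `(y, q)` on a product with a dual space. -/
noncomputable def tautologicalModel (V : Type*) [NormedAddCommGroup V] [NormedSpace ℝ V] :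
    (V × (V →L[ℝ] ℝ)) →L[ℝ] (V × (V →L[ℝ] ℝ)) [⋀^Fin 1]→L[ℝ] ℝ :=
  ((ContinuousAlternatingMap.ofSubsingletonLIE (𝕜 := ℝ) (E := V × (V →L[ℝ] ℝ)) (F := ℝ)
    (0 : Fin 1)).toLinearIsometry.toContinuousLinearMap).comp
    (((ContinuousLinearMap.compL ℝ (V × (V →L[ℝ] ℝ)) V ℝ).flip
      (ContinuousLinearMap.fst ℝ V (V →L[ℝ] ℝ))).comp (ContinuousLinearMap.snd ℝ V (V →L[ℝ] ℝ)))

theorem extDeriv_tautologicalModel {V : Type*} [NormedAddCommGroup V] [NormedSpace ℝ V]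
    (y : V × (V →L[ℝ] ℝ)) (v : Fin 2 → V × (V →L[ℝ] ℝ)) :
    extDeriv (tautologicalModel V) y v = (v 0).2 (v 1).1 - (v 1).2 (v 0).1 := by
  rw [extDeriv_apply (tautologicalModel V).differentiableAt, Fin.sum_univ_two]
  have h : ∀ u : Fin 1 → V × (V →L[ℝ] ℝ), ∀ b,
      fderiv ℝ (fun y => tautologicalModel V y u) y b = b.2 (u 0).1 := by
    intro u b
    have : (fun y => tautologicalModel V y u) = fun y => (((ContinuousLinearMap.apply ℝ ℝ
      (u 0).1).comp (ContinuousLinearMap.snd ℝ V (V →L[ℝ] ℝ)) : _ →L[ℝ] ℝ)) y := rfl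
    rw [this, ContinuousLinearMap.fderiv]
    rfl
  rw [h, h]
  simp [Fin.removeNth]
  ring

/-- In the chart the tautological one-form is the linear model `∑ p_i dq_i`, whose exterior
derivative is constant. -/
theorem canonicalForm_apply (p : Cotangent n C)
    (w : Fin 2 → TangentSpace (bundleModel n (Eu n →L[ℝ] ℝ)) p) :
    canonicalForm n C p w = -(
      (mvfderiv (bundleModel n (Eu n →L[ℝ] ℝ)) (extChartAt (bundleModel n (Eu n →L[ℝ] ℝ)) p) p (w 0)).2
      (mvfderiv (bundleModel n (Eu n →L[ℝ] ℝ)) (extChartAt (bundleModel n (Eu n →L[ℝ] ℝ)) p) p (w 1)).1 -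
      (mvfderiv (bundleModel n (Eu n →L[ℝ] ℝ)) (extChartAt (bundleModel n (Eu n →L[ℝ] ℝ)) p) p (w 1)).2
      (mvfderiv (bundleModel n (Eu n →L[ℝ] ℝ)) (extChartAt (bundleModel n (Eu n →L[ℝ] ℝ)) p) p (w 0)).1) := by
  have := isManifold_one (n := n) (C := C)
  have := isManifold_bundle (n := n) (F := Eu n →L[ℝ] ℝ) (E := fun x : C => TangentSpace (𝓡 n) x →L[ℝ] ℝ)
  have h1 : (tautologicalForm n C).inChart p =ᶠ[nhds (extChartAt (bundleModel n (Eu n →L[ℝ] ℝ)) p p)]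
      tautologicalModel (Eu n) := by
    filter_upwards [extChartAt_target_mem_nhds (I := bundleModel n (Eu n →L[ℝ] ℝ)) p] with y hy
    ext v
    rw [DiffForm.inChart_apply, tautologicalForm_apply ((extChartAt _ p).map_target hy),
      mvfderiv_mfderiv_symm hy, (extChartAt _ p).right_inv hy]
    rfl
  rw [← extDeriv_tautologicalModel (extChartAt (bundleModel n (Eu n →L[ℝ] ℝ)) p p) fun i =>
    mvfderiv (bundleModel n (Eu n →L[ℝ] ℝ)) (extChartAt (bundleModel n (Eu n →L[ℝ] ℝ)) p) p (w i),
    ← h1.extDeriv_eq]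
  rfl

end Canonical

/-! ### The Lie bracket as a commutator of derivations. -/

section Bracket

variable {n : ℕ} {C : Type*} [TopologicalSpace C] [ChartedSpace (Eu n) C]
  [IsManifold (𝓡 n) ∞ C]

/-- In the chart the second derivatives of `f` cancel by symmetry, and the first-order terms form
the Lie bracket of the coordinate expressions. -/
theorem lieD_bracket (X Y : VecField n C) {f : C → ℝ} (hf : ContMDiff (𝓡 n) 𝓘(ℝ, ℝ) ∞ f) (x : C) :
    lieD (bracket X Y) f x = lieD X (lieD Y f) x - lieD Y (lieD X f) x := by
  have := isManifold_one (n := n) (C := C)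
  have hx := mem_extChartAt_source (I := 𝓡 n) x
  set ch := extChartAt (𝓡 n) x with hch
  let y₀ := ch x
  have hl : ch.symm y₀ = x := ch.left_inv hx
  have hfs : ContDiffAt ℝ ∞ (f ∘ ch.symm) y₀ := by
    have := (contMDiffAt_iff.1 (hf x)).2
    rwa [(𝓡 n).range_eq_univ, contDiffWithinAt_univ] at this
  let hat (Z : VecField n C) (y : Eu n) : Eu n := lieD (fun x => Z x) ch (ch.symm y)
  have hhat : ∀ Z, DifferentiableAt ℝ (hat Z) y₀ := by
    intro Z
    have h1 := (contMDiffAt_iff.1 ((smoothFieldAt_iff hx).1 (Z.smoothAt x))).2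
    rw [(𝓡 n).range_eq_univ, contDiffWithinAt_univ] at h1
    exact ContDiffAt.differentiableAt (n := ∞) h1 (by simp)
  -- derivatives of functions in the chart
  have hlie : ∀ (Z : VecField n C) (g : C → ℝ), ContMDiff (𝓡 n) 𝓘(ℝ, ℝ) ∞ g → ∀ y ∈ ch.target,
      lieD (fun x => Z x) g (ch.symm y) = fderiv ℝ (g ∘ ch.symm) y (hat Z y) := by
    intro Z g hg y hy
    have h1 := mvfderiv_eq_fderiv_chart (I := 𝓡 n) (ch.map_target hy)
      (hg.mdifferentiableAt (x := ch.symm y) (by simp)) (Z (ch.symm y))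
    rw [← hch, ch.right_inv hy] at h1
    exact h1
  have hnear : ∀ᶠ y in nhds y₀, y ∈ ch.target := extChartAt_target_mem_nhds (I := 𝓡 n) x
  have htwo : ∀ Z Z' : VecField n C, lieD (fun x => Z x) (lieD (fun x => Z' x) f) x =
      fderiv ℝ (fderiv ℝ (f ∘ ch.symm)) y₀ (hat Z y₀) (hat Z' y₀) +
        fderiv ℝ (f ∘ ch.symm) y₀ (fderiv ℝ (hat Z') y₀ (hat Z y₀)) := by
    intro Z Z'
    have h1 := hlie Z _ (contMDiff_lieD Z' hf) y₀ (ch.map_source hx)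
    rw [hl] at h1
    rw [h1]
    have h2 : (lieD (fun x => Z' x) f ∘ ch.symm) =ᶠ[nhds y₀]
        fun y => fderiv ℝ (f ∘ ch.symm) y (hat Z' y) := by
      filter_upwards [hnear] with y hy
      exact hlie Z' f hf y hy
    have h3 : DifferentiableAt ℝ (fderiv ℝ (f ∘ ch.symm)) y₀ :=
      (hfs.fderiv_right (m := 1) (by rw [one_add_one_eq_two]; exact two_le_infty)).differentiableAt
        (by simp)
    rw [h2.fderiv_eq, (h3.hasFDerivAt.clm_apply (hhat Z').hasFDerivAt).fderiv]
    simp [add_comm]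
  have hsymm := (hfs.of_le two_le_infty).isSymmSndFDerivAt (by simp) (hat X y₀) (hat Y y₀)
  -- the bracket in the chart
  have hpb : ∀ Z : VecField n C, VectorField.mpullbackWithin 𝓘(ℝ, Eu n) (𝓡 n) ch.symm (fun x => Z x)
      (Set.range (𝓡 n)) =ᶠ[nhds y₀] hat Z := by
    intro Z
    filter_upwards [hnear] with y hy
    have h1 := mfderiv_extChartAt_comp_mfderivWithin_extChartAt_symm (I := 𝓡 n) hy
    have h2 := mfderivWithin_extChartAt_symm_comp_mfderiv_extChartAt (I := 𝓡 n) hy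
    rw [VectorField.mpullbackWithin_apply, ContinuousLinearMap.inverse_eq h2 h1]
    rfl
  have hbr : lieD (fun x => bracket X Y x) ch x = VectorField.lieBracket ℝ (hat X) (hat Y) y₀ := by
    have h1 : bracket X Y x = _ := VectorField.mlieBracketWithin_apply (I := 𝓡 n) (V := X) (W := Y)
      (s := Set.univ) (x₀ := x)
    have h2 : ∀ V W : Eu n → Eu n, V =ᶠ[nhds y₀] hat X → W =ᶠ[nhds y₀] hat Y →
        VectorField.lieBracketWithin ℝ V W (ch.symm ⁻¹' Set.univ ∩ Set.range (𝓡 n)) y₀ =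
          VectorField.lieBracket ℝ (hat X) (hat Y) y₀ := by
      intro V W hV hW
      rw [(𝓡 n).range_eq_univ, Set.preimage_univ, Set.univ_inter, VectorField.lieBracketWithin_univ]
      exact hV.lieBracket_vectorField_eq hW
    have h3 : (mfderiv (𝓡 n) 𝓘(ℝ, Eu n) (extChartAt (𝓡 n) x) x).inverse =
        ContinuousLinearMap.id ℝ (Eu n) := by
      have := mfderiv_extChartAt_self (I := 𝓡 n) (x := x)
      exact (congrArg ContinuousLinearMap.inverse this).trans ContinuousLinearMap.inverse_id
    have h4 := h1.trans (congrArg₂ (fun (L : Eu n →L[ℝ] Eu n) (v : Eu n) => L v) h3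
      (h2 _ _ (hpb X) (hpb Y)))
    rw [lieD, h4]
    have h5 : ∀ v : Eu n, mvfderiv (𝓡 n) (extChartAt (𝓡 n) x) x v = v := fun v =>
      congrArg (fun L => L v) (mfderiv_extChartAt_self (I := 𝓡 n) (x := x))
    exact h5 _
  rw [htwo, htwo, hsymm]
  have h1 := hlie (bracket X Y) f hf y₀ (ch.map_source hx)
  rw [hl] at h1
  have h2 : hat (bracket X Y) y₀ = VectorField.lieBracket ℝ (hat X) (hat Y) y₀ := by
    rw [← hbr]; simp only [hat, hl]
  rw [h2, VectorField.lieBracket, map_sub] at h1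
  rw [h1]
  ring

end Bracket

end OhPark

namespace OhPark

section SumRule

variable {V : Type*} [NormedAddCommGroup V] [NormedSpace ℝ V]
  {H : Type*} [TopologicalSpace H] {I : ModelWithCorners ℝ V H}
  {N : Type*} [TopologicalSpace N] [ChartedSpace H N]
  {W : Type*} [NormedAddCommGroup W] [NormedSpace ℝ W]

theorem mvfderiv_sum_smul {ι : Type*} (s : Finset ι) {a : ι → N → ℝ} {g : ι → N → W} {x : N}
    (ha : ∀ i, MDifferentiableAt I 𝓘(ℝ, ℝ) (a i) x) (hg : ∀ i, MDifferentiableAt I 𝓘(ℝ, W) (g i) x)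
    (w : TangentSpace I x) :
    MDifferentiableAt I 𝓘(ℝ, W) (fun y => ∑ i ∈ s, a i y • g i y) x ∧
    mvfderiv I (fun y => ∑ i ∈ s, a i y • g i y) x w =
      ∑ i ∈ s, (mvfderiv I (a i) x w • g i x + a i x • mvfderiv I (g i) x w) := by
  classical
  induction s using Finset.induction_on with
  | empty => 
    simp only [Finset.sum_empty]
    exact ⟨mdifferentiableAt_const, by rw [mvfderiv_const]; rfl⟩
  | insert i s hi ih =>
    simp only [Finset.sum_insert hi]
    have h1 : MDifferentiableAt I 𝓘(ℝ, W) (fun y => a i y • g i y) x := (ha i).smul (hg i)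
    refine ⟨h1.add ih.1, ?_⟩
    have h2 := congrArg (fun L => L w) (mvfderiv_add h1 ih.1)
    have h3 := congrArg (fun L => L w) (mvfderiv_smul (ha i) (hg i))
    refine h2.trans ?_
    rw [← ih.2, add_comm (mvfderiv I (a i) x w • g i x)]
    exact congrArg (· + _) h3

end SumRule

/-! ### The two-form of the local model in terms of vector fields on the base. -/

section ModelForm

variable {n : ℕ} {C : Type*} [TopologicalSpace C] [ChartedSpace (Eu n) C]
  [IsManifold (𝓡 n) ∞ C]
  {F : Type*} [NormedAddCommGroup F] [NormedSpace ℝ F]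
  {E : C → Type*} [TopologicalSpace (Bundle.TotalSpace F E)]
  [∀ x, AddCommGroup (E x)] [∀ x, Module ℝ (E x)] [∀ x, TopologicalSpace (E x)]
  [FiberBundle F E] [VectorBundle ℝ F E] [ContMDiffVectorBundle ∞ F E (𝓡 n)]
  {K : ∀ x : C, Submodule ℝ (TangentSpace (𝓡 n) x)}

theorem IsLocalCoordinates.mvfderiv_chart {x : C} {q : Fin n → C → ℝ} {T : Fin n → VecField n C}
    (hq : IsLocalCoordinates x q T) : ∀ᶠ y in nhds x, ∀ (v : TangentSpace (𝓡 n) y) (i : Fin n),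
      (mvfderiv (𝓡 n) (extChartAt (𝓡 n) x) y v) i = mvfderiv (𝓡 n) (q i) y v := by
  have := isManifold_one (n := n) (C := C)
  filter_upwards [hq.chart.eventually_nhds, (isOpen_extChartAt_source (I := 𝓡 n) x).mem_nhds
    (mem_extChartAt_source x)] with y hy hys v i
  have h1 : q i =ᶠ[nhds y] EuclideanSpace.proj i ∘ extChartAt (𝓡 n) x := hy.mono fun z hz => hz i
  rw [mvfderiv_congr h1, mvfderiv_comp_apply (EuclideanSpace.proj (𝕜 := ℝ) i).differentiableAt
      (mdifferentiableAt_extChartAt (by rwa [extChartAt_source] at hys)),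
      ContinuousLinearMap.fderiv]
  rfl

theorem eventually_proj {e : Bundle.TotalSpace F E} {p : C → Prop} (hp : ∀ᶠ y in nhds e.proj, p y) :
    ∀ᶠ e' in nhds e, p (Bundle.TotalSpace.proj e') :=
  (FiberBundle.continuous_proj F E).continuousAt.eventually hp

/-- The function `ℓ_X` depends linearly on `X`. -/
noncomputable def linearFunctionₗ (Φ : ∀ x, E x ≃ₗ[ℝ] Module.Dual ℝ (K x)) :
    sections K →ₗ[ℝ] Bundle.TotalSpace F E → ℝ where
  toFun X := linearFunction Φ X
  map_add' X Y := funext fun e => (Φ e.proj e.2).map_add ⟨X.1 e.proj, X.2 e.proj⟩ ⟨Y.1 e.proj, Y.2 e.proj⟩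
  map_smul' c X := funext fun e => (Φ e.proj e.2).map_smul c ⟨X.1 e.proj, X.2 e.proj⟩

theorem linearFunctionₗ_apply (Φ : ∀ x, E x ≃ₗ[ℝ] Module.Dual ℝ (K x)) (X : sections K) :
    linearFunctionₗ (F := F) Φ X = linearFunction Φ X := rfl

namespace IsPolarized

variable {α : DiffForm (𝓡 n) C 2} {G : ∀ x : C, Submodule ℝ (TangentSpace (𝓡 n) x)}
  (h : IsPolarized α G) (Φ : ∀ x, E x ≃ₗ[ℝ] Module.Dual ℝ (α.ker x))

/-- The covector `j e`, extending `Φ e` by zero on `G`. -/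
noncomputable def covector (e : Bundle.TotalSpace F E) : TangentSpace (𝓡 n) e.proj →ₗ[ℝ] ℝ :=
  (Φ e.proj e.2).comp ((α.ker e.proj).projectionOnto (G e.proj) (h.compl e.proj))

theorem linearFunction_projK (A : VecField n C) (e : Bundle.TotalSpace F E) :
    linearFunction Φ (h.projK A) e = h.covector Φ e (A e.proj) := by
  change Φ e.proj e.2 _ = Φ e.proj e.2 _
  congr 1
  exact Subtype.ext (h.projK_apply A e.proj)

/-- The left side is the covector `j e` evaluated on `A`, so it depends only on the value of `A` and
is linear over functions. -/
theorem linearFunction_projK_expand {x : C} {q : Fin n → C → ℝ} {T : Fin n → VecField n C}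
    (hq : IsLocalCoordinates x q T) : ∀ᶠ y in nhds x, ∀ (A : VecField n C)
      (e : Bundle.TotalSpace F E), e.proj = y → linearFunction Φ (h.projK A) e =
        ∑ i, mvfderiv (𝓡 n) (q i) e.proj (A e.proj) * linearFunction Φ (h.projK (T i)) e := by
  filter_upwards [hq.expand] with y hy A e he
  subst he
  simp only [linearFunction_projK]
  conv_lhs => rw [hy (A e.proj)]
  simp only [map_sum, map_smul, smul_eq_mul]

variable (hΦ : IsSmoothIso F Φ)
include hΦ

/-- The momentum coordinates of `j e` are its values on the coordinate fields, that is, the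
fibrewise linear functions of their kernel parts. The smoothness of `j` follows. -/
theorem trivialization_toCotangent [T2Space C] {e : Bundle.TotalSpace F E} {q : Fin n → C → ℝ}
    {T : Fin n → VecField n C} (hq : IsLocalCoordinates e.proj q T) : ∀ᶠ e' in nhds e,
      (trivializationAt (Eu n →L[ℝ] ℝ) (fun x : C => TangentSpace (𝓡 n) x →L[ℝ] ℝ) e.proj
        (toCotangent Φ h.compl e')).2 =
      ∑ i, linearFunction Φ (h.projK (T i)) e' • (EuclideanSpace.proj i : Eu n →L[ℝ] ℝ) := by
  have hs := (isOpen_extChartAt_source (I := 𝓡 n) e.proj).mem_nhds (mem_extChartAt_source e.proj)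
  filter_upwards [eventually_proj hq.expand, eventually_proj hq.dual, eventually_proj hs,
    eventually_proj hq.mvfderiv_chart] with e' hex hdu hse hch
  have h1 : ∀ u : TangentSpace (𝓡 n) e'.proj, (trivializationAt (Eu n →L[ℝ] ℝ)
      (fun x : C => TangentSpace (𝓡 n) x →L[ℝ] ℝ) e.proj (toCotangent Φ h.compl e')).2
        (mvfderiv (𝓡 n) (extChartAt (𝓡 n) e.proj) e'.proj u) = h.covector Φ e' u := fun u =>
    trivialization_cotangent_apply (p := toCotangent Φ h.compl e') hse u
  have hsurj : ∀ c : Eu n, mvfderiv (𝓡 n) (extChartAt (𝓡 n) e.proj) e'.proj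
      (∑ i, c i • T i e'.proj) = c := by
    intro c
    ext i
    rw [hch]
    simp only [map_sum, map_smul, hdu]
    simp
  ext c
  have h2 := h1 (∑ i, c i • T i e'.proj)
  rw [hsurj] at h2
  rw [h2]
  simp only [map_sum, map_smul, linearFunction_projK, sum_apply, smul_apply, smul_eq_mul]
  exact Finset.sum_congr rfl fun i _ => mul_comm (c i) _

theorem contMDiffAt_toCotangent [T2Space C] (e : Bundle.TotalSpace F E) :
    ContMDiffAt (bundleModel n F) (bundleModel n (Eu n →L[ℝ] ℝ)) ∞ (toCotangent Φ h.compl) e := by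
  obtain ⟨q, T, hq⟩ := exists_local_coordinates (n := n) e.proj
  rw [Bundle.contMDiffAt_totalSpace]
  refine ⟨Bundle.contMDiffAt_proj E, ?_⟩
  refine ContMDiffAt.congr_of_eventuallyEq ?_ (h.trivialization_toCotangent Φ hΦ hq)
  exact ContMDiffAt.sum fun i _ => (hΦ _ e).smul contMDiffAt_const

/-- Pulling `∑ dq_i ∧ dp_i` back along `j` replaces the momenta by the linear functions of the
kernel parts of the coordinate fields. -/
theorem modelForm_apply_coordinates [T2Space C] {e : Bundle.TotalSpace F E} {q : Fin n → C → ℝ}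
    {T : Fin n → VecField n C} (hq : IsLocalCoordinates e.proj q T)
    (w w' : TangentSpace (bundleModel n F) e) :
    modelForm α Φ h.compl e ![w, w'] = α.pair e.proj (dproj e w) (dproj e w') -
      ((∑ i, mvfderiv (bundleModel n F) (linearFunction Φ (h.projK (T i))) e w *
        mvfderiv (𝓡 n) (q i) e.proj (dproj e w')) -
      ∑ i, mvfderiv (bundleModel n F) (linearFunction Φ (h.projK (T i))) e w' *
        mvfderiv (𝓡 n) (q i) e.proj (dproj e w)) := by
  have := isManifold_one (n := n) (C := C)
  have := isManifold_bundle (n := n) (F := Eu n →L[ℝ] ℝ) (E := fun x : C => TangentSpace (𝓡 n) x →L[ℝ] ℝ)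
  let j : Bundle.TotalSpace F E → Cotangent n C := toCotangent Φ h.compl
  have hj : MDifferentiableAt (bundleModel n F) (bundleModel n (Eu n →L[ℝ] ℝ)) j e :=
    (h.contMDiffAt_toCotangent Φ hΦ e).mdifferentiableAt (by simp)
  let p := j e
  let ch := extChartAt (bundleModel n (Eu n →L[ℝ] ℝ)) p
  have hchd : MDifferentiableAt (bundleModel n (Eu n →L[ℝ] ℝ)) 𝓘(ℝ, Eu n × (Eu n →L[ℝ] ℝ)) ch p :=
    mdifferentiableAt_extChartAt (mem_chart_source _ p)
  let dj (w : TangentSpace (bundleModel n F) e) : TangentSpace (bundleModel n (Eu n →L[ℝ] ℝ)) p :=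
    mfderiv (bundleModel n F) (bundleModel n (Eu n →L[ℝ] ℝ)) j e w
  have hfst : ∀ w, (mvfderiv (bundleModel n (Eu n →L[ℝ] ℝ)) ch p (dj w)).1 =
      mvfderiv (𝓡 n) (extChartAt (𝓡 n) e.proj) e.proj (dproj e w) := by
    intro w
    rw [mvfderiv_extChartAt_bundle_fst (mem_extChartAt_source p)]
    have h1 := mfderiv_comp (I := bundleModel n F) (I' := bundleModel n (Eu n →L[ℝ] ℝ)) (I'' := 𝓡 n) e
      (mdifferentiableAt_proj' (n := n) p) hj
    exact congrArg (fun v => mvfderiv (𝓡 n) (extChartAt (𝓡 n) e.proj) e.proj v)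
      (congrArg (fun L => L w) h1).symm
  have hsnd : ∀ w, (mvfderiv (bundleModel n (Eu n →L[ℝ] ℝ)) ch p (dj w)).2 =
      ∑ i, mvfderiv (bundleModel n F) (linearFunction Φ (h.projK (T i))) e w •
        (EuclideanSpace.proj i : Eu n →L[ℝ] ℝ) := by
    intro w
    have h1 : mvfderiv (bundleModel n F) (ch ∘ j) e w = mvfderiv (bundleModel n (Eu n →L[ℝ] ℝ)) ch p (dj w) :=
      mvfderiv_comp_mfderiv (f := j) (x := e) hchd hj w
    rw [← h1]
    have h2 := mvfderiv_comp_apply (I := bundleModel n F)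
      (g := (Prod.snd : Eu n × (Eu n →L[ℝ] ℝ) → (Eu n →L[ℝ] ℝ)))
      (f := ch ∘ j) (x := e) differentiableAt_snd (hchd.comp e hj) w
    rw [fderiv_snd] at h2
    refine Eq.trans h2.symm ?_
    have h3 : (Prod.snd ∘ (ch ∘ j) : Bundle.TotalSpace F E → (Eu n →L[ℝ] ℝ)) =ᶠ[nhds e]
        fun e' => ∑ i, linearFunction Φ (h.projK (T i)) e' • (EuclideanSpace.proj i : Eu n →L[ℝ] ℝ) := by
      filter_upwards [h.trivialization_toCotangent Φ hΦ hq] with e' he'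
      rw [← he']
      exact congrArg Prod.snd (extChartAt_bundle_apply p (j e'))
    rw [mvfderiv_congr h3]
    have h4 := (mvfderiv_sum_smul (I := bundleModel n F) Finset.univ (x := e)
      (a := fun i => linearFunction Φ (h.projK (T i)))
      (g := fun i _ => (EuclideanSpace.proj i : Eu n →L[ℝ] ℝ))
      (fun i => (hΦ _ e).mdifferentiableAt (by simp)) (fun i => mdifferentiableAt_const) w).2
    rw [h4]
    refine Finset.sum_congr rfl fun i _ => ?_
    rw [mvfderiv_const]
    exact (congrArg (_ + ·) (smul_zero _)).trans (add_zero _)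
  have hval : ∀ w w', (mvfderiv (bundleModel n (Eu n →L[ℝ] ℝ)) ch p (dj w)).2
      (mvfderiv (bundleModel n (Eu n →L[ℝ] ℝ)) ch p (dj w')).1 =
      ∑ i, mvfderiv (bundleModel n F) (linearFunction Φ (h.projK (T i))) e w *
        mvfderiv (𝓡 n) (q i) e.proj (dproj e w') := by
    intro w w'
    rw [hfst, hsnd]
    simp only [sum_apply, smul_apply, smul_eq_mul,
      ← hq.mvfderiv_chart.self_of_nhds]
    rfl
  have h1 : modelForm α Φ h.compl e ![w, w'] = α e.proj ![dproj e w, dproj e w'] +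
      canonicalForm n C p ![dj w, dj w'] := by
    refine congrArg₂ (· + ·) (congrArg (α e.proj) ?_) (congrArg (canonicalForm n C p) ?_) <;>
    · funext i
      fin_cases i <;> rfl
  rw [h1, canonicalForm_apply, ← hval w w', ← hval w' w]
  rfl

/-- The form of the local model, in terms of vector fields on the base. -/
theorem modelForm_apply [T2Space C] {e : Bundle.TotalSpace F E} (A B : VecField n C)
    {w w' : TangentSpace (bundleModel n F) e} (hw : dproj e w = A e.proj)
    (hw' : dproj e w' = B e.proj) :
    modelForm α Φ h.compl e ![w, w'] = α.pair e.proj (A e.proj) (B e.proj) -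
      (mvfderiv (bundleModel n F) (linearFunction Φ (h.projK B)) e w -
        mvfderiv (bundleModel n F) (linearFunction Φ (h.projK A)) e w' -
        linearFunction Φ (h.projK (bracket A B)) e) := by
  obtain ⟨q, T, hq⟩ := exists_local_coordinates (n := n) e.proj
  have hl : ∀ (A : VecField n C) i, ContMDiff (𝓡 n) 𝓘(ℝ, ℝ) ∞ (lieD (fun x => A x) (q i)) := fun A i =>
    contMDiff_lieD A (hq.smooth i)
  -- The Leibniz rule for `ℓ_A = ∑ A(q_i) ℓ_(T_i)`, along a lift of `D`.
  have hexp : ∀ (A D : VecField n C) (w : TangentSpace (bundleModel n F) e), dproj e w = D e.proj →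
      mvfderiv (bundleModel n F) (linearFunction Φ (h.projK A)) e w =
        ∑ i, (lieD (fun x => D x) (lieD (fun x => A x) (q i)) e.proj *
          linearFunction Φ (h.projK (T i)) e +
        mvfderiv (bundleModel n F) (linearFunction Φ (h.projK (T i))) e w *
          mvfderiv (𝓡 n) (q i) e.proj (A e.proj)) := by
    intro A D w hw
    have h1 : linearFunction Φ (h.projK A) =ᶠ[nhds e] fun e' =>
        ∑ i, lieD (fun x => A x) (q i) e'.proj • linearFunction Φ (h.projK (T i)) e' := by
      filter_upwards [eventually_proj (e := e) (h.linearFunction_projK_expand (F := F) Φ hq)] with e' he'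
      exact he' A e' rfl
    have h2 := (mvfderiv_sum_smul (I := bundleModel n F) Finset.univ (x := e)
      (a := fun i (e' : Bundle.TotalSpace F E) => lieD (fun x => A x) (q i) e'.proj)
      (g := fun i => linearFunction Φ (h.projK (T i)))
      (fun i => ((hl A i).mdifferentiableAt (by simp)).comp e (mdifferentiableAt_proj' (F := F) e))
      (fun i => (hΦ _ e).mdifferentiableAt (by simp)) w).2
    rw [mvfderiv_congr h1, h2]
    refine Finset.sum_congr rfl fun i _ => ?_
    rw [mvfderiv_comp_proj ((hl A i).mdifferentiableAt (by simp)), hw, mul_comm (mvfderiv _ _ _ _)]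
    rfl
  rw [h.modelForm_apply_coordinates Φ hΦ hq, hexp B A w hw, hexp A B w' hw',
    (h.linearFunction_projK_expand Φ hq).self_of_nhds (bracket A B) e rfl, hw, hw']
  -- The derivatives of the coefficients `A(q_i)` and `B(q_i)` combine to the components of `[A,
  -- B]`.
  have h2 : ∀ i, mvfderiv (𝓡 n) (q i) e.proj (bracket A B e.proj) =
      lieD (fun x => A x) (lieD (fun x => B x) (q i)) e.proj -
      lieD (fun x => B x) (lieD (fun x => A x) (q i)) e.proj := fun i =>
    lieD_bracket A B (hq.smooth i) e.proj
  simp only [h2, Finset.sum_add_distrib, sub_mul, Finset.sum_sub_distrib]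
  ring

end IsPolarized

end ModelForm

end OhPark

namespace OhPark

section BracketAlgebra

variable {n : ℕ} {C : Type*} [TopologicalSpace C] [ChartedSpace (Eu n) C]
  [IsManifold (𝓡 n) ∞ C]

theorem bracket_swap (X Y : VecField n C) : bracket X Y = -bracket Y X := by
  ext x : 1
  exact congrFun (VectorField.mlieBracket_swap (I := 𝓡 n) (V := fun x => X x) (W := fun x => Y x)) x

theorem bracket_zero (X : VecField n C) : bracket X 0 = 0 := by
  ext x : 1
  exact congrFun (VectorField.mlieBracket_zero_right (I := 𝓡 n) (W := fun x => X x)) x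

/-- The bracket with a vector field. -/
noncomputable def bracketₗ (Y : VecField n C) : VecField n C →ₗ[ℝ] VecField n C where
  toFun X := bracket X Y
  map_add' X X' := by
    ext x : 1
    exact VectorField.mlieBracket_add_left ((X.smoothAt x).mdifferentiableAt (by simp))
      ((X'.smoothAt x).mdifferentiableAt (by simp))
  map_smul' c X := by
    ext x : 1
    exact VectorField.mlieBracket_const_smul_left ((X.smoothAt x).mdifferentiableAt (by simp))

theorem bracketₗ_apply (X Y : VecField n C) : bracketₗ Y X = bracket X Y := rfl

/-- The value of a vector field at a point. -/
noncomputable def evalₗ (x : C) : VecField n C →ₗ[ℝ] TangentSpace (𝓡 n) x where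
  toFun X := X x
  map_add' _ _ := rfl
  map_smul' _ _ := rfl

theorem vecField_sum_apply {ι : Type*} (s : Finset ι) (X : ι → VecField n C) (x : C) :
    (∑ i ∈ s, X i) x = ∑ i ∈ s, X i x := map_sum (evalₗ x) X s

theorem exists_vecField [T2Space C] (x : C) (u : TangentSpace (𝓡 n) x) : ∃ A : VecField n C, A x = u := by
  obtain ⟨T, hT⟩ := exists_coordinate_fields (n := n) x
  exact ⟨T (mvfderiv (𝓡 n) (extChartAt (𝓡 n) x) x u),
    mvfderiv_chart_injective (mem_extChartAt_source (I := 𝓡 n) x)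
      (hT.self_of_nhds (mvfderiv (𝓡 n) (extChartAt (𝓡 n) x) x u)).1⟩

end BracketAlgebra

/-! ### Nondegeneracy of the model form and Poisson brackets of generators. -/

section Hamiltonian

variable {n : ℕ} {C : Type*} [TopologicalSpace C] [ChartedSpace (Eu n) C]
  [IsManifold (𝓡 n) ∞ C] [T2Space C]
  {F : Type*} [NormedAddCommGroup F] [NormedSpace ℝ F] [FiniteDimensional ℝ F]
  {E : C → Type*} [TopologicalSpace (Bundle.TotalSpace F E)]
  [∀ x, AddCommGroup (E x)] [∀ x, Module ℝ (E x)] [∀ x, TopologicalSpace (E x)]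
  [FiberBundle F E] [VectorBundle ℝ F E] [ContMDiffVectorBundle ∞ F E (𝓡 n)]

theorem fderiv_linearFunction_fibreIncl {K : ∀ x : C, Submodule ℝ (TangentSpace (𝓡 n) x)}
    (Φ : ∀ x, E x ≃ₗ[ℝ] Module.Dual ℝ (K x)) (X : sections K) (x : C) (y v : F) :
    fderiv ℝ (fun y' => linearFunction Φ X (fibreIncl x y')) y v =
      Φ x ((fibreEquiv (F := F) x).symm v) ⟨X.1 x, X.2 x⟩ := by
  let L : F →ₗ[ℝ] ℝ := (LinearMap.applyₗ (⟨X.1 x, X.2 x⟩ : K x)).comp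
    ((Φ x).toLinearMap.comp (fibreEquiv (F := F) x).symm.toLinearEquiv.toLinearMap)
  have h1 : (fun y' => linearFunction Φ X (fibreIncl x y')) = LinearMap.toContinuousLinearMap L := rfl
  rw [h1, ContinuousLinearMap.fderiv]
  rfl

namespace IsPolarized

variable {α : DiffForm (𝓡 n) C 2} {G : ∀ x : C, Submodule ℝ (TangentSpace (𝓡 n) x)}
  (h : IsPolarized α G) (Φ : ∀ x, E x ≃ₗ[ℝ] Module.Dual ℝ (α.ker x)) (hΦ : IsSmoothIso F Φ)

include h hΦ

theorem exists_vertical (e : Bundle.TotalSpace F E) (ξ : Module.Dual ℝ (α.ker e.proj)) :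
    ∃ w : TangentSpace (bundleModel n F) e, dproj e w = 0 ∧
      ∀ X : sections α.ker, mvfderiv (bundleModel n F) (linearFunction Φ X) e w =
        ξ ⟨X.1 e.proj, X.2 e.proj⟩ := by
  obtain ⟨x, y, rfl⟩ : ∃ x y, e = fibreIncl x y := ⟨_, _, (fibreIncl_fibreEquiv e).symm⟩
  refine ⟨vert x y (fibreEquiv x ((Φ x).symm ξ)), dproj_vert x y _, fun X => ?_⟩
  rw [mvfderiv_vert ((hΦ X _).mdifferentiableAt (by simp)), fderiv_linearFunction_fibreIncl,
    ContinuousLinearEquiv.symm_apply_apply]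
  exact congrArg (fun ζ : Module.Dual ℝ (α.ker x) => ζ ⟨X.1 x, X.2 x⟩) ((Φ x).apply_symm_apply ξ)

theorem eq_zero_of_vertical {e : Bundle.TotalSpace F E} {w : TangentSpace (bundleModel n F) e}
    (hw : dproj e w = 0)
    (hX : ∀ X : sections α.ker, mvfderiv (bundleModel n F) (linearFunction Φ X) e w = 0) : w = 0 := by
  obtain ⟨x, y, rfl⟩ : ∃ x y, e = fibreIncl x y := ⟨_, _, (fibreIncl_fibreEquiv e).symm⟩
  obtain ⟨v, rfl⟩ := exists_vert hw
  have h1 : Φ x ((fibreEquiv (F := F) x).symm v) = 0 := by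
    ext u
    obtain ⟨X, hXu⟩ := h.exists_section u.2
    have h2 := hX X
    rw [mvfderiv_vert ((hΦ X _).mdifferentiableAt (by simp)), fderiv_linearFunction_fibreIncl] at h2
    have h3 : (⟨X.1 x, X.2 x⟩ : α.ker x) = u := Subtype.ext hXu
    rw [← h3]
    exact h2
  have h2 : v = 0 := by simpa using h1
  rw [h2]
  exact map_zero (mfderiv 𝓘(ℝ, F) (bundleModel n F) (fibreIncl (E := E) x) y)

theorem section_eq_zero_of_vertical {e : Bundle.TotalSpace F E} {X : sections α.ker}
    (hX : ∀ w : TangentSpace (bundleModel n F) e, dproj e w = 0 →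
      mvfderiv (bundleModel n F) (linearFunction Φ X) e w = 0) : X.1 e.proj = 0 := by
  have h1 : (⟨X.1 e.proj, X.2 e.proj⟩ : α.ker e.proj) = 0 := by
    refine (Module.forall_dual_apply_eq_zero_iff ℝ _).1 fun ξ => ?_
    obtain ⟨w, hw, hwX⟩ := h.exists_vertical Φ hΦ e ξ
    exact (hwX X).symm.trans (hX w hw)
  exact congrArg Subtype.val h1

/-- A vertical vector lifts the zero field, so one term of `modelForm_apply` is left: vertical
vectors are paired with the kernel part of the base direction. -/
theorem modelForm_apply_vertical {e : Bundle.TotalSpace F E} (A : VecField n C)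
    {v w : TangentSpace (bundleModel n F) e} (hv : dproj e v = A e.proj) (hw : dproj e w = 0) :
    modelForm α Φ h.compl e ![v, w] = mvfderiv (bundleModel n F) (linearFunction Φ (h.projK A)) e w := by
  rw [h.modelForm_apply Φ hΦ A 0 hv hw, bracket_zero]
  have h0 : linearFunction (F := F) Φ (0 : sections α.ker) = 0 :=
    (linearFunctionₗ (F := F) Φ).map_zero
  have h1 : h.projK 0 = 0 := map_zero _
  have h2 : (0 : VecField n C) e.proj = 0 := rfl
  rw [h1, h0, h2, map_zero, mvfderiv_zero]
  simp

theorem modelForm_swap (e : Bundle.TotalSpace F E) (v w : TangentSpace (bundleModel n F) e) :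
    modelForm α Φ h.compl e ![v, w] = -modelForm α Φ h.compl e ![w, v] :=
  (modelForm α Φ h.compl).pair_swap e v w

/-- The two-form of the local model is nondegenerate. -/
theorem modelForm_nondegenerate (e : Bundle.TotalSpace F E) :
    (modelForm α Φ h.compl).NondegenerateAt e := by
  intro v hv
  obtain ⟨A, hA⟩ := exists_vecField e.proj (dproj e v)
  -- Vertical test vectors show that the projection of `v` has no kernel part.
  have hK : (h.projK A).1 e.proj = 0 := h.section_eq_zero_of_vertical Φ hΦ fun w hw => by
    rw [← h.modelForm_apply_vertical Φ hΦ A hA.symm hw, hv w]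
  have hAG : h.projG A e.proj = dproj e v := by
    rw [← hA]
    have h1 := congrArg (fun Z : VecField n C => Z e.proj) (h.projK_add_projG A)
    have h2 : (h.projK A).1 e.proj + h.projG A e.proj = A e.proj := h1
    rwa [hK, zero_add] at h2
  have h0 : linearFunction (F := F) Φ (0 : sections α.ker) = 0 :=
    (linearFunctionₗ (F := F) Φ).map_zero
  -- Against lifts of fields in `G`, involutivity removes the bracket term, and the nondegeneracy of
  -- `α` on `G` applies.
  have hv0 : dproj e v = 0 := by
    rw [← hAG]
    refine h.eq_zero_of_pair (h.projG_mem A e.proj) fun u hu => ?_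
    obtain ⟨B, hB, hBu⟩ := h.bundle.smooth e.proj u hu
    obtain ⟨w, hw⟩ := dproj_surjective (n := n) e u
    have h1 := h.modelForm_apply Φ hΦ (h.projG A) B hAG.symm (hw.trans hBu.symm)
    rw [hv w, h.projK_eq_zero hB, h.projK_eq_zero (h.projG_mem A),
      h.projK_eq_zero (X := bracket (h.projG A) B) (h.involutive _ (h.projG_mem A) _ hB),
      h0, hBu, mvfderiv_zero] at h1
    simpa using h1.symm
  -- Now `v` is vertical, and lifts of sections of the kernel detect it.
  refine h.eq_zero_of_vertical Φ hΦ hv0 fun X => ?_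
  obtain ⟨w, hw⟩ := dproj_surjective (n := n) e (X.1 e.proj)
  rw [← h.projK_of_mem X, ← h.modelForm_apply_vertical Φ hΦ X.1 hw hv0, h.modelForm_swap Φ hΦ,
    hv w, neg_zero]

/-- In finite dimension nondegeneracy makes the defining equation solvable, so the chosen vector
does satisfy it. -/
theorem hamiltonianVector_spec (f : Bundle.TotalSpace F E → ℝ) (e : Bundle.TotalSpace F E)
    (w : TangentSpace (bundleModel n F) e) :
    modelForm α Φ h.compl e ![hamiltonianVector (modelForm α Φ h.compl) f e, w] =
      -mvfderiv (bundleModel n F) f e w := by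
  have : FiniteDimensional ℝ (TangentSpace (bundleModel n F) e) :=
    inferInstanceAs (FiniteDimensional ℝ (Eu n × F))
  let L : TangentSpace (bundleModel n F) e →ₗ[ℝ] Module.Dual ℝ (TangentSpace (bundleModel n F) e) :=
    (modelForm α Φ h.compl).pair e
  have hL : Function.Injective L := by
    rw [injective_iff_map_eq_zero]
    intro u hu
    exact h.modelForm_nondegenerate Φ hΦ e u fun w => LinearMap.congr_fun hu w
  have hs := (LinearMap.injective_iff_surjective_of_finrank_eq_finrank
    (Subspace.dual_finrank_eq (K := ℝ) (V := TangentSpace (bundleModel n F) e)).symm).1 hL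
  obtain ⟨v, hv⟩ := hs (-(mvfderiv (bundleModel n F) f e : _ →L[ℝ] ℝ).toLinearMap)
  exact Classical.epsilon_spec (p := fun v => ∀ w : TangentSpace (bundleModel n F) e,
    modelForm α Φ h.compl e ![v, w] = -(mvfderiv (bundleModel n F) f e w : ℝ))
    ⟨v, fun w => LinearMap.congr_fun hv w⟩ w

omit hΦ h in
/-- The Poisson bracket on functions. -/
noncomputable def poisson (h : IsPolarized α G) (Φ : ∀ x, E x ≃ₗ[ℝ] Module.Dual ℝ (α.ker x))
    (f g : Bundle.TotalSpace F E → ℝ) (e : Bundle.TotalSpace F E) : ℝ :=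
  mvfderiv (bundleModel n F) g e (hamiltonianVector (modelForm α Φ h.compl) f e)

theorem poisson_swap (f g : Bundle.TotalSpace F E → ℝ) (e : Bundle.TotalSpace F E) :
    h.poisson Φ f g e = -h.poisson Φ g f e := by
  have h1 := h.hamiltonianVector_spec Φ hΦ f e (hamiltonianVector (modelForm α Φ h.compl) g e)
  have h2 := h.hamiltonianVector_spec Φ hΦ g e (hamiltonianVector (modelForm α Φ h.compl) f e)
  rw [h.modelForm_swap Φ hΦ, h1, neg_neg] at h2
  unfold poisson
  rw [h2, neg_neg]

section Generators

variable {e : Bundle.TotalSpace F E}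

/-- The function is constant along the fibres, so vertical test vectors exclude a kernel part of the
projection; lifts of fields in `G` determine the rest. -/
theorem dproj_hamiltonianVector_basic {f : C → ℝ} (hf : ContMDiff (𝓡 n) 𝓘(ℝ, ℝ) ∞ f)
    {H : VecField n C} (hH : H ∈ sections G)
    (hHf : ∀ x, ∀ u ∈ G x, α.pair x (H x) u = -mvfderiv (𝓡 n) f x u) (e : Bundle.TotalSpace F E) :
    dproj e (hamiltonianVector (modelForm α Φ h.compl) (fun e => f e.proj) e) = H e.proj := by
  have spec := h.hamiltonianVector_spec Φ hΦ (fun e => f e.proj) e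
  let v := hamiltonianVector (modelForm α Φ h.compl) (fun e => f e.proj) e
  have hdf : ∀ w, mvfderiv (bundleModel n F) (fun e : Bundle.TotalSpace F E => f e.proj) e w =
      mvfderiv (𝓡 n) f e.proj (dproj e w) := fun w =>
    mvfderiv_comp_proj (hf.mdifferentiableAt (by simp)) w
  have h0 : linearFunction (F := F) Φ (0 : sections α.ker) = 0 :=
    (linearFunctionₗ (F := F) Φ).map_zero
  obtain ⟨A, hA⟩ := exists_vecField e.proj (dproj e v)
  have hK : (h.projK A).1 e.proj = 0 := h.section_eq_zero_of_vertical Φ hΦ fun w hw => by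
    rw [← h.modelForm_apply_vertical Φ hΦ A hA.symm hw, spec w, hdf, hw, map_zero, neg_zero]
  have hAG : h.projG A e.proj = dproj e v := by
    rw [← hA]
    have h2 : (h.projK A).1 e.proj + h.projG A e.proj = A e.proj :=
      congrArg (fun Z : VecField n C => Z e.proj) (h.projK_add_projG A)
    rwa [hK, zero_add] at h2
  change dproj e v = _
  rw [← hAG, ← sub_eq_zero]
  refine h.eq_zero_of_pair (Submodule.sub_mem _ (h.projG_mem A e.proj) (hH e.proj)) fun u hu => ?_
  obtain ⟨B, hB, hBu⟩ := h.bundle.smooth e.proj u hu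
  obtain ⟨w, hw⟩ := dproj_surjective (n := n) e u
  have h1 := h.modelForm_apply Φ hΦ (h.projG A) B hAG.symm (hw.trans hBu.symm)
  rw [spec w, h.projK_eq_zero hB, h.projK_eq_zero (h.projG_mem A),
    h.projK_eq_zero (X := bracket (h.projG A) B) (h.involutive _ (h.projG_mem A) _ hB),
    h0, hBu, mvfderiv_zero, hdf, hw] at h1
  rw [map_sub, LinearMap.sub_apply, hHf e.proj u hu, h1]
  simp

theorem poisson_basic_basic {f g : C → ℝ} (hf : ContMDiff (𝓡 n) 𝓘(ℝ, ℝ) ∞ f)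
    (hg : ContMDiff (𝓡 n) 𝓘(ℝ, ℝ) ∞ g) {H : VecField n C} (hH : H ∈ sections G)
    (hHf : ∀ x, ∀ u ∈ G x, α.pair x (H x) u = -mvfderiv (𝓡 n) f x u) (e : Bundle.TotalSpace F E) :
    h.poisson Φ (fun e => f e.proj) (fun e => g e.proj) e = lieD (fun x => H x) g e.proj := by
  unfold poisson
  rw [mvfderiv_comp_proj (hg.mdifferentiableAt (by simp)),
    h.dproj_hamiltonianVector_basic Φ hΦ hf hH hHf]
  rfl

/-- Pair the Hamiltonian vector of `f` with a lift of `X`: the `α` term drops out because `X` lies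
in the kernel, and the bracket term is linear along the fibres. -/
theorem poisson_basic_linear {f : C → ℝ} (hf : ContMDiff (𝓡 n) 𝓘(ℝ, ℝ) ∞ f)
    {H : VecField n C} (hH : H ∈ sections G)
    (hHf : ∀ x, ∀ u ∈ G x, α.pair x (H x) u = -mvfderiv (𝓡 n) f x u)
    (X : sections α.ker) (e : Bundle.TotalSpace F E) :
    h.poisson Φ (fun e => f e.proj) (linearFunction Φ X) e =
      lieD (fun x => X.1 x) f e.proj + linearFunction Φ (h.projK (bracket H X.1)) e := by
  have spec := h.hamiltonianVector_spec Φ hΦ (fun e => f e.proj) e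
  have hd := h.dproj_hamiltonianVector_basic Φ hΦ hf hH hHf e
  obtain ⟨w, hw⟩ := dproj_surjective (n := n) e (X.1 e.proj)
  have h0 : linearFunction (F := F) Φ (0 : sections α.ker) = 0 :=
    (linearFunctionₗ (F := F) Φ).map_zero
  have h1 := h.modelForm_apply Φ hΦ H X.1 hd hw
  rw [spec w, h.projK_eq_zero hH, h.projK_of_mem, h0, mvfderiv_zero, 
    mvfderiv_comp_proj (hf.mdifferentiableAt (by simp)), hw, h.pair_kernel _ _ (X.2 e.proj)] at h1
  unfold poisson lieD
  simp only [zero_apply, sub_zero] at h1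
  linarith

/-- The Hamiltonian vector of `ℓ_X` projects to `-X` plus a vector of `G`. Pairing with lifts of the
`H_i` gives the coordinates of that vector as linear functions: by involutivity these equations are
not coupled, so no inverse matrix appears. A second pairing, with a lift of `Z`, makes the bracket
quadratic. -/
theorem poisson_linear_linear {x : C} {q : Fin n → C → ℝ} {T : Fin n → VecField n C}
    (hq : IsLocalCoordinates x q T) {H : Fin n → VecField n C} (hH : ∀ i, H i ∈ sections G)
    (hHf : ∀ i x, ∀ u ∈ G x, α.pair x (H i x) u = -mvfderiv (𝓡 n) (q i) x u) :
    ∀ᶠ y in nhds x, ∀ e : Bundle.TotalSpace F E, e.proj = y → ∀ X Z : sections α.ker,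
    h.poisson Φ (linearFunction Φ X) (linearFunction Φ Z) e =
      -linearFunction Φ (h.projK (bracket X.1 Z.1)) e +
        ∑ i, linearFunction Φ (h.projK (bracket X.1 (H i))) e *
          linearFunction Φ (h.projK (bracket (h.projG (T i)) Z.1)) e := by
  filter_upwards [hq.expand] with y hy e he X Z
  subst he
  have spec := h.hamiltonianVector_spec Φ hΦ (linearFunction Φ X) e
  let v := hamiltonianVector (modelForm α Φ h.compl) (linearFunction Φ X) e
  have h0 : linearFunction (F := F) Φ (0 : sections α.ker) = 0 :=
    (linearFunctionₗ (F := F) Φ).map_zero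
  obtain ⟨A₀, hA₀⟩ := exists_vecField e.proj (dproj e v)
  have hd : ∀ X : sections α.ker, MDifferentiableAt (bundleModel n F) 𝓘(ℝ, ℝ) (linearFunction Φ X) e :=
    fun X => (hΦ X e).mdifferentiableAt (by simp)
  have hK : (h.projK A₀ + X).1 e.proj = 0 := h.section_eq_zero_of_vertical Φ hΦ fun w hw => by
    have h1 := mvfderiv_add (hd (h.projK A₀)) (hd X)
    have h2 : linearFunction Φ (h.projK A₀ + X) = linearFunction (F := F) Φ (h.projK A₀) +
      linearFunction Φ X := (linearFunctionₗ Φ).map_add _ _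
    rw [h2, h1]
    refine Eq.trans (b := mvfderiv (bundleModel n F) (linearFunction Φ (h.projK A₀)) e w +
      mvfderiv (bundleModel n F) (linearFunction Φ X) e w) rfl ?_
    rw [← h.modelForm_apply_vertical Φ hΦ A₀ hA₀.symm hw, spec w]
    exact neg_add_cancel _
  -- Coefficients frozen at `e`: the field `Y` has the required value there, stays in `G`, and its
  -- brackets expand linearly.
  let c (i : Fin n) : ℝ := mvfderiv (𝓡 n) (q i) e.proj (h.projG A₀ e.proj)
  let Y : VecField n C := ∑ i, c i • h.projG (T i)
  have hYG : Y ∈ sections G := Submodule.sum_mem _ fun i _ => Submodule.smul_mem _ _ (h.projG_mem _)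
  have hY : Y e.proj = h.projG A₀ e.proj := by
    have h1 : Y e.proj = ∑ i, c i • h.projG (T i) e.proj :=
      (vecField_sum_apply _ _ _).trans (Finset.sum_congr rfl fun i _ => rfl)
    have h2 := congrArg (fun u => ((G e.proj).projectionOnto (α.ker e.proj) (h.compl e.proj).symm u :
      TangentSpace (𝓡 n) e.proj)) (hy (h.projG A₀ e.proj))
    simp only [Submodule.projectionOnto_apply_of_mem_left _ (h.projG_mem A₀ e.proj), map_sum,
      map_smul, Submodule.coe_sum, Submodule.coe_smul] at h2
    rw [h1, h2]
    rfl
  let A : VecField n C := -X.1 + Y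
  have hA : dproj e v = A e.proj := by
    have h1 : A e.proj = -X.1 e.proj + Y e.proj := rfl
    have h2 : (h.projK A₀).1 e.proj + h.projG A₀ e.proj = A₀ e.proj :=
      congrArg (fun Z : VecField n C => Z e.proj) (h.projK_add_projG A₀)
    have h3 : (h.projK A₀).1 e.proj + X.1 e.proj = 0 := hK
    rw [h1, hY, ← hA₀, ← h2, eq_neg_of_add_eq_zero_left h3]
  have hKA : h.projK A = -X := by
    change h.projK (-X.1 + Y) = _
    rw [map_add, map_neg, h.projK_of_mem, h.projK_eq_zero hYG, add_zero]
  have hlneg : ∀ Z, linearFunction (F := F) Φ (-Z) = -linearFunction Φ Z :=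
    (linearFunctionₗ (F := F) Φ).map_neg
  have hneg : ∀ w, mvfderiv (bundleModel n F) (linearFunction Φ (h.projK A)) e w =
      -mvfderiv (bundleModel n F) (linearFunction Φ X) e w := by
    intro w
    rw [hKA, hlneg, mvfderiv_neg]
    rfl
  have hpA : ∀ u, α.pair e.proj (A e.proj) u = α.pair e.proj (Y e.proj) u := by
    intro u
    have : A e.proj = -X.1 e.proj + Y e.proj := rfl
    rw [this, map_add, map_neg, LinearMap.add_apply, LinearMap.neg_apply,
      DiffForm.mem_ker_iff.1 (X.2 e.proj), neg_zero, zero_add]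
  have hbr : ∀ B : VecField n C, bracket A B = -bracket X.1 B + ∑ i, c i • bracket (h.projG (T i)) B := by
    intro B
    simp only [← bracketₗ_apply, A, Y, map_add, map_neg, map_sum, map_smul]
  have hbr' : ∀ B : VecField n C, linearFunction Φ (h.projK (bracket A B)) e =
      -linearFunction Φ (h.projK (bracket X.1 B)) e +
        ∑ i, c i * linearFunction Φ (h.projK (bracket (h.projG (T i)) B)) e := by
    intro B
    rw [hbr]
    simp only [← linearFunctionₗ_apply, map_add, map_neg, map_sum, map_smul]
    simp
  -- In the pairing with a lift of `H_i`, the derivatives of `ℓ_X` cancel, and the brackets of `H_i`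
  -- with the fields that make up `Y` have no kernel part.
  have hc : ∀ i, c i = linearFunction Φ (h.projK (bracket X.1 (H i))) e := by
    intro i
    obtain ⟨w, hw⟩ := dproj_surjective (n := n) e (H i e.proj)
    have h1 := h.modelForm_apply Φ hΦ A (H i) hA hw
    rw [spec w, hneg, h.projK_eq_zero (hH i), h0, mvfderiv_zero, hpA, hbr', DiffForm.pair_swap,
      hHf i e.proj _ (hYG e.proj), hY, Finset.sum_eq_zero] at h1
    · simp only [zero_apply] at h1
      change -_ = - -c i - _ at h1
      linarith
    · intro j _
      rw [h.projK_eq_zero (X := bracket (h.projG (T j)) (H i))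
        (h.involutive _ (h.projG_mem _) _ (hH i)), h0]
      simp
  obtain ⟨w, hw⟩ := dproj_surjective (n := n) e (Z.1 e.proj)
  have h1 := h.modelForm_apply Φ hΦ A Z.1 hA hw
  rw [spec w, hneg, h.projK_of_mem, hpA, h.pair_kernel _ _ (Z.2 e.proj), hbr'] at h1
  simp only [← hc]
  unfold poisson
  change mvfderiv _ _ _ v = _
  linarith

end Generators

end IsPolarized

end Hamiltonian

end OhPark

namespace OhPark

/-! ### The model form on a vector space. -/

section ModelBilin

variable {V : Type*} [NormedAddCommGroup V] [NormedSpace ℝ V]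

theorem twoForm_swap (β : V [⋀^Fin 2]→L[ℝ] ℝ) (u v : V) : β ![u, v] = -β ![v, u] := by
  have h1 : β (![v, u] ∘ Equiv.swap (0 : Fin 2) 1) = -β ![v, u] :=
    β.map_swap ![v, u] (i := 0) (j := 1) (by decide)
  rw [← h1]
  congr 1
  funext i; fin_cases i <;> simp

theorem differentiableAt_toBilin {V' : Type*} [NormedAddCommGroup V'] [NormedSpace ℝ V'] {a : V' → V [⋀^Fin 2]→L[ℝ] ℝ} {y : V'}
    (ha : DifferentiableAt ℝ a y) : DifferentiableAt ℝ (fun y => toBilin V (a y)) y :=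
  have h := ContinuousLinearMap.contDiff (𝕜 := ℝ) (n := 1) (E := V [⋀^Fin 2]→L[ℝ] ℝ)
    (F := V →L[ℝ] V →L[ℝ] ℝ) (toBilin V)
  DifferentiableAt.comp (g := toBilin V) y (h.differentiable (by simp) (a y)) ha

section Bilinear

variable {P Q R W : Type*} [NormedAddCommGroup P] [NormedSpace ℝ P] [NormedAddCommGroup Q]
  [NormedSpace ℝ Q] [NormedAddCommGroup R] [NormedSpace ℝ R] [NormedAddCommGroup W] [NormedSpace ℝ W]

theorem differentiableAt_bilin_left (L : P →L[ℝ] Q →L[ℝ] R) (c : Q) {u : W → P} {y : W}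
    (hu : DifferentiableAt ℝ u y) : DifferentiableAt ℝ (fun y => L (u y) c) y :=
  (L.flip c).differentiableAt.comp y hu

theorem differentiableAt_bilin_right (L : P →L[ℝ] Q →L[ℝ] R) (c : P) {u : W → Q} {y : W}
    (hu : DifferentiableAt ℝ u y) : DifferentiableAt ℝ (fun y => L c (u y)) y :=
  (L c).differentiableAt.comp y hu

end Bilinear

variable {W : Type*} [NormedAddCommGroup W] [NormedSpace ℝ W] {ι : Type*} [Fintype ι]

/-- The form `P*a + ∑ dx_i ∧ dl_i`. -/
noncomputable def modelBilin (P : W →L[ℝ] V) (x : ι → W →L[ℝ] ℝ) (a : V → V [⋀^Fin 2]→L[ℝ] ℝ)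
    (l : ι → W → ℝ) (y : W) : W →L[ℝ] W →L[ℝ] ℝ :=
  ((ContinuousLinearMap.compL ℝ W V ℝ).flip P).comp ((toBilin V (a (P y))).comp P) -
  ∑ i, (ContinuousLinearMap.smulRightL ℝ W (W →L[ℝ] ℝ) (fderiv ℝ (l i) y) (x i) -
    ContinuousLinearMap.smulRightL ℝ W (W →L[ℝ] ℝ) (x i) (fderiv ℝ (l i) y))

variable {P : W →L[ℝ] V} {x : ι → W →L[ℝ] ℝ} {a : V → V [⋀^Fin 2]→L[ℝ] ℝ} {l : ι → W → ℝ}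

theorem modelBilin_apply (y u v : W) : modelBilin P x a l y u v = a (P y) ![P u, P v] -
    ∑ i, (fderiv ℝ (l i) y u * x i v - x i u * fderiv ℝ (l i) y v) := by
  rw [← toBilin_apply]
  simp only [modelBilin, sub_apply, sum_apply]
  rfl

theorem modelBilin_swap (y u v : W) : modelBilin P x a l y u v = -modelBilin P x a l y v u := by
  rw [modelBilin_apply, modelBilin_apply]
  rw [twoForm_swap, neg_sub, ← sub_eq_zero]
  simp only [Finset.sum_sub_distrib, mul_comm]
  ring

theorem differentiableAt_modelBilin {y : W} (ha : DifferentiableAt ℝ a (P y))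
    (hl : ∀ i, ContDiffAt ℝ 2 (l i) y) : DifferentiableAt ℝ (modelBilin P x a l) y := by
  have hd : ∀ i, DifferentiableAt ℝ (fderiv ℝ (l i)) y := fun i =>
    ((hl i).fderiv_right (m := 1) (by norm_num)).differentiableAt (by simp)
  have h1 := differentiableAt_toBilin (a := fun y : W => a (P y)) (y := y)
    (ha.comp y P.differentiableAt)
  have h2 : DifferentiableAt ℝ (fun y => ((ContinuousLinearMap.compL ℝ W V ℝ).flip P).comp
      ((toBilin V (a (P y))).comp P)) y :=
    (differentiableAt_const _).clm_comp (h1.clm_comp (differentiableAt_const P))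
  have h3 : ∀ i, DifferentiableAt ℝ (fun y =>
      ContinuousLinearMap.smulRightL ℝ W (W →L[ℝ] ℝ) (fderiv ℝ (l i) y) (x i)) y := fun i => by
    have h3 := differentiableAt_bilin_left (P := W →L[ℝ] ℝ) (Q := W →L[ℝ] ℝ) (R := W →L[ℝ] W →L[ℝ] ℝ)
      (ContinuousLinearMap.smulRightL ℝ W (W →L[ℝ] ℝ)) (x i) (hd i)
    exact h3
  have h4 : ∀ i, DifferentiableAt ℝ (fun y =>
      ContinuousLinearMap.smulRightL ℝ W (W →L[ℝ] ℝ) (x i) (fderiv ℝ (l i) y)) y := fun i => by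
    have h4 := differentiableAt_bilin_right (P := W →L[ℝ] ℝ) (Q := W →L[ℝ] ℝ) (R := W →L[ℝ] W →L[ℝ] ℝ)
      (ContinuousLinearMap.smulRightL ℝ W (W →L[ℝ] ℝ)) (x i) (hd i)
    exact h4
  have h5 := DifferentiableAt.fun_sum (u := Finset.univ) fun i _ =>
    DifferentiableAt.fun_sub (𝕜 := ℝ) (E := W) (F := W →L[ℝ] W →L[ℝ] ℝ) (h3 i) (h4 i)
  exact DifferentiableAt.fun_sub (𝕜 := ℝ) (E := W) (F := W →L[ℝ] W →L[ℝ] ℝ) h2 h5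

/-- The `dx_i` are constant and the derivatives of the `dl_i` are symmetric Hessians, so their
cyclic sum vanishes; that of the first summand is `extDeriv a`. -/
theorem modelBilin_closed {y : W} (ha : DifferentiableAt ℝ a (P y))
    (hl : ∀ i, ContDiffAt ℝ 2 (l i) y) (hda : extDeriv a (P y) = 0) (u v w : W) :
    fderiv ℝ (modelBilin P x a l) y u v w + fderiv ℝ (modelBilin P x a l) y v w u +
      fderiv ℝ (modelBilin P x a l) y w u v = 0 := by
  have hd : ∀ i, DifferentiableAt ℝ (fderiv ℝ (l i)) y := fun i =>
    ((hl i).fderiv_right (m := 1) (by norm_num)).differentiableAt (by simp)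
  have hsymm : ∀ i u v, fderiv ℝ (fderiv ℝ (l i)) y u v = fderiv ℝ (fderiv ℝ (l i)) y v u :=
    fun i u v => (hl i).isSymmSndFDerivAt (by simp) u v
  have hB := differentiableAt_modelBilin (x := x) ha hl
  have haa : ∀ v w : V, DifferentiableAt ℝ (fun z => a z ![v, w]) (P y) := fun v w => by
    simp only [← toBilin_apply]
    exact ((differentiableAt_toBilin ha).clm_apply (differentiableAt_const v)).clm_apply
      (differentiableAt_const w)
  have key : ∀ u v w : W, fderiv ℝ (modelBilin P x a l) y u v w =
      fderiv ℝ (fun z => a z ![P v, P w]) (P y) (P u) -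
      ∑ i, (fderiv ℝ (fderiv ℝ (l i)) y u v * x i w - x i v * fderiv ℝ (fderiv ℝ (l i)) y u w) := by
    intro u v w
    have h1 : HasFDerivAt (fun y => modelBilin P x a l y v w) _ y :=
      (hB.hasFDerivAt.clm_apply (hasFDerivAt_const v y)).clm_apply (hasFDerivAt_const w y)
    have h2 : HasFDerivAt (fun y : W => a (P y) ![P v, P w])
      ((fderiv ℝ (fun z => a z ![P v, P w]) (P y)).comp P) y :=
      (haa (P v) (P w)).hasFDerivAt.comp y P.hasFDerivAt
    have h3 : HasFDerivAt (fun y => ∑ i, (fderiv ℝ (l i) y v * x i w - x i v * fderiv ℝ (l i) y w)) _ y :=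
      HasFDerivAt.fun_sum fun i _ =>
        (((hd i).hasFDerivAt.clm_apply (hasFDerivAt_const v y)).mul_const (x i w)).sub
        (((hd i).hasFDerivAt.clm_apply (hasFDerivAt_const w y)).const_mul (x i v))
    have h4 := h2.sub h3
    have h5 : (fun y => modelBilin P x a l y v w) = fun y : W => a (P y) ![P v, P w] -
      ∑ i, (fderiv ℝ (l i) y v * x i w - x i v * fderiv ℝ (l i) y w) := by
      funext y; exact modelBilin_apply y v w
    rw [h5] at h1
    have h6 := congrArg (fun L => L u) (h1.unique h4)
    simp at h6
    rw [h6]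
    simp only [Finset.sum_sub_distrib, mul_comm]
  have hα := congrArg (fun β => β ![P u, P v, P w]) hda
  have hα' : fderiv ℝ (fun z => a z ![P v, P w]) (P y) (P u) + fderiv ℝ (fun z => a z ![P w, P u]) (P y) (P v)
      + fderiv ℝ (fun z => a z ![P u, P v]) (P y) (P w) = 0 := by
    have h1 : extDeriv a (P y) ![P u, P v, P w] = 0 := hα
    rw [extDeriv_apply ha] at h1
    replace h1 := (Fin.sum_univ_three _).symm.trans h1
    have e0 : Fin.removeNth 0 ![P u, P v, P w] = ![P v, P w] := by
      funext i; fin_cases i <;> rfl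
    have e1 : Fin.removeNth 1 ![P u, P v, P w] = ![P u, P w] := by
      funext i; fin_cases i <;> rfl
    have e2 : Fin.removeNth 2 ![P u, P v, P w] = ![P u, P v] := by
      funext i; fin_cases i <;> rfl
    rw [e0, e1, e2] at h1
    have h3 : (fun z => a z ![P w, P u]) = fun z => -a z ![P u, P w] := by
      funext z
      exact twoForm_swap _ _ _
    rw [h3, fderiv_fun_neg, neg_apply]
    simp at h1
    linarith
  rw [key, key, key]
  have h7 : ∑ i, (fderiv ℝ (fderiv ℝ (l i)) y u v * x i w - x i v * fderiv ℝ (fderiv ℝ (l i)) y u w) +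
      ∑ i, (fderiv ℝ (fderiv ℝ (l i)) y v w * x i u - x i w * fderiv ℝ (fderiv ℝ (l i)) y v u) +
      ∑ i, (fderiv ℝ (fderiv ℝ (l i)) y w u * x i v - x i u * fderiv ℝ (fderiv ℝ (l i)) y w v) = 0 := by
    rw [← Finset.sum_add_distrib, ← Finset.sum_add_distrib]
    refine Finset.sum_eq_zero fun i _ => ?_
    rw [hsymm i v u, hsymm i w u, hsymm i w v]
    ring
  linarith

end ModelBilin

/-! ### The Jacobi identity of the Poisson bracket on the bundle. -/

section PoissonJacobi

variable {n : ℕ} {C : Type*} [TopologicalSpace C] [ChartedSpace (Eu n) C]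
  [IsManifold (𝓡 n) ∞ C] [T2Space C]

/-- The components `T_j(q_k)` are locally constant, so the bracket annihilates all coordinate
functions. -/
theorem IsLocalCoordinates.bracket_eq_zero {x : C} {q : Fin n → C → ℝ} {T : Fin n → VecField n C}
    (hq : IsLocalCoordinates x q T) : ∀ᶠ y in nhds x, ∀ i j, bracket (T i) (T j) y = 0 := by
  filter_upwards [hq.dual.eventually_nhds, hq.expand] with y hy hex i j
  rw [hex (bracket (T i) (T j) y)]
  refine Finset.sum_eq_zero fun k _ => ?_
  have h1 : ∀ i j : Fin n, lieD (fun x => T i x) (lieD (fun x => T j x) (q k)) y = 0 := by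
    intro i j
    have : lieD (fun x => T j x) (q k) =ᶠ[nhds y] fun _ => if j = k then (1 : ℝ) else 0 :=
      hy.mono fun z hz => hz k j
    refine (congrArg (fun L => L (T i y)) (mvfderiv_congr this)).trans ?_
    rw [mvfderiv_const]
    rfl
  have h2 : mvfderiv (𝓡 n) (q k) y (bracket (T i) (T j) y) = 0 := by
    have := lieD_bracket (T i) (T j) (hq.smooth k) y
    rw [h1, h1, sub_zero] at this
    exact this
  rw [h2, zero_smul]

variable
  {F : Type*} [NormedAddCommGroup F] [NormedSpace ℝ F] [FiniteDimensional ℝ F]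
  {E : C → Type*} [TopologicalSpace (Bundle.TotalSpace F E)]
  [∀ x, AddCommGroup (E x)] [∀ x, Module ℝ (E x)] [∀ x, TopologicalSpace (E x)]
  [FiberBundle F E] [VectorBundle ℝ F E] [ContMDiffVectorBundle ∞ F E (𝓡 n)]

namespace IsPolarized

variable {α : DiffForm (𝓡 n) C 2} {G : ∀ x : C, Submodule ℝ (TangentSpace (𝓡 n) x)}
  (h : IsPolarized α G) (Φ : ∀ x, E x ≃ₗ[ℝ] Module.Dual ℝ (α.ker x)) (hΦ : IsSmoothIso F Φ)

include h hΦ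

/-- The form of the local model in a chart. -/
theorem modelForm_eq_modelBilin (e : Bundle.TotalSpace F E) {q : Fin n → C → ℝ}
    {T : Fin n → VecField n C} (hq : IsLocalCoordinates e.proj q T) : ∀ᶠ e' in nhds e,
    ∀ w w' : TangentSpace (bundleModel n F) e', modelForm α Φ h.compl e' ![w, w'] =
      modelBilin (ContinuousLinearMap.fst ℝ (Eu n) F)
        (fun i => (EuclideanSpace.proj i : Eu n →L[ℝ] ℝ).comp (ContinuousLinearMap.fst ℝ (Eu n) F))
        (α.inChart e.proj)
        (fun i => linearFunction Φ (h.projK (T i)) ∘ (extChartAt (bundleModel n F) e).symm)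
        (extChartAt (bundleModel n F) e e')
        (mvfderiv (bundleModel n F) (extChartAt (bundleModel n F) e) e' w)
        (mvfderiv (bundleModel n F) (extChartAt (bundleModel n F) e) e' w') := by
  have := isManifold_one (n := n) (C := C)
  have := isManifold_bundle (n := n) (F := F) (E := E)
  filter_upwards [eventually_proj hq.bracket_eq_zero, eventually_proj hq.expand,
    eventually_proj hq.mvfderiv_chart,
    (isOpen_extChartAt_source (I := bundleModel n F) e).mem_nhds (mem_extChartAt_source e)]
    with e' hbr hex hch hs w w'
  have hs' := (mem_extChartAt_bundle_source.1 hs).2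
  let c (w : TangentSpace (bundleModel n F) e') (i : Fin n) : ℝ :=
    mvfderiv (𝓡 n) (q i) e'.proj (dproj e' w)
  -- Constant combinations of commuting fields: the bracket term of `modelForm_apply` vanishes at
  -- `e'`.
  let A (w : TangentSpace (bundleModel n F) e') : VecField n C := ∑ i, c w i • T i
  have hA : ∀ w, dproj e' w = A w e'.proj := fun w => by
    refine (hex (dproj e' w)).trans ?_
    exact (vecField_sum_apply Finset.univ (fun i => c w i • T i) e'.proj).symm
  have hA0 : bracket (A w) (A w') e'.proj = 0 := by
    have h1 : bracket (A w) (A w') = ∑ i, ∑ j, (c w i * c w' j) • bracket (T i) (T j) := by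
      rw [← bracketₗ_apply]
      simp only [A, map_sum, map_smul]
      refine Finset.sum_congr rfl fun i _ => ?_
      rw [bracketₗ_apply, bracket_swap, ← bracketₗ_apply]
      simp only [map_sum, map_smul, ← Finset.sum_neg_distrib, Finset.smul_sum]
      refine Finset.sum_congr rfl fun j _ => ?_
      rw [mul_smul, bracketₗ_apply, bracket_swap (T j), smul_neg]
      simp only [smul_neg, neg_neg]
    rw [h1]
    refine (vecField_sum_apply _ _ _).trans (Finset.sum_eq_zero fun i _ => ?_)
    refine (vecField_sum_apply _ _ _).trans (Finset.sum_eq_zero fun j _ => ?_)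
    exact (congrArg ((c w i * c w' j) • ·) (hbr i j)).trans (smul_zero _)
  have hl : ∀ w w', mvfderiv (bundleModel n F) (linearFunction Φ (h.projK (A w'))) e' w =
      ∑ i, c w' i * mvfderiv (bundleModel n F) (linearFunction Φ (h.projK (T i))) e' w := by
    intro w w'
    have h1 : linearFunction (F := F) Φ (h.projK (A w')) = fun e =>
        ∑ i, c w' i • linearFunction Φ (h.projK (T i)) e := by
      simp only [← linearFunctionₗ_apply, A, map_sum, map_smul]
      funext e
      simp
    rw [h1, (mvfderiv_sum_smul (I := bundleModel n F) Finset.univ (x := e')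
      (a := fun i _ => c w' i) (g := fun i => linearFunction Φ (h.projK (T i)))
      (fun i => mdifferentiableAt_const) (fun i => (hΦ _ e').mdifferentiableAt (by simp)) w).2]
    refine Finset.sum_congr rfl fun i _ => ?_
    rw [mvfderiv_const, zero_apply, zero_smul, zero_add]
    rfl
  rw [h.modelForm_apply Φ hΦ (A w) (A w') (hA w) (hA w'), h.linearFunction_projK, hA0, map_zero,
    hl, hl, ← hA, ← hA]
  refine Eq.trans ?_ (modelBilin_apply _ _ _).symm
  have hd : ∀ i w, mvfderiv (bundleModel n F) (linearFunction Φ (h.projK (T i))) e' w = _ := fun i w =>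
    mvfderiv_eq_fderiv_chart hs ((hΦ (h.projK (T i)) e').mdifferentiableAt (by simp)) w
  have hc : ∀ w i, (mvfderiv (bundleModel n F) (extChartAt (bundleModel n F) e) e' w).1 i = c w i := by
    intro w i
    rw [mvfderiv_extChartAt_bundle_fst hs]
    exact hch _ i
  refine congrArg₂ (· - ·) ?_ ?_
  · change _ = α.inChart e.proj (extChartAt (bundleModel n F) e e').1
      ![(mvfderiv (bundleModel n F) (extChartAt (bundleModel n F) e) e' w).1,
        (mvfderiv (bundleModel n F) (extChartAt (bundleModel n F) e) e' w').1]
    rw [mvfderiv_extChartAt_bundle_fst hs, mvfderiv_extChartAt_bundle_fst hs,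
      extChartAt_bundle_fst hs]
    refine (α.apply_eq_inChart hs' _).trans ?_
    congr 1
    funext i
    fin_cases i <;> rfl
  · rw [sub_zero, ← Finset.sum_sub_distrib]
    refine Finset.sum_congr rfl fun i _ => ?_
    rw [mul_comm (c w' i)]
    exact congrArg₂ (· - ·) (congrArg₂ (· * ·) (hd i w) (hc w' i).symm)
      (congrArg₂ (· * ·) (hc w i).symm (hd i w'))

/-- In the chart at `e` the form is a `modelBilin`, which is closed, and the Hamiltonian fields are
differentiable because operator inversion is. So `jacobi_of_closed` applies. -/
theorem poisson_jacobi {f : Fin 3 → Bundle.TotalSpace F E → ℝ}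
    (hf : ∀ i, ContMDiff (bundleModel n F) 𝓘(ℝ, ℝ) ∞ (f i))
    (hff : ∀ i j, MDifferentiable (bundleModel n F) 𝓘(ℝ, ℝ) (h.poisson Φ (f i) (f j)))
    (e : Bundle.TotalSpace F E) :
    h.poisson Φ (f 0) (h.poisson Φ (f 1) (f 2)) e + h.poisson Φ (f 1) (h.poisson Φ (f 2) (f 0)) e +
      h.poisson Φ (f 2) (h.poisson Φ (f 0) (f 1)) e = 0 := by
  have := isManifold_one (n := n) (C := C)
  have := isManifold_bundle (n := n) (F := F) (E := E)
  obtain ⟨q, T, hq⟩ := exists_local_coordinates (n := n) e.proj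
  have hs := mem_extChartAt_source (I := bundleModel n F) e
  let ch := extChartAt (bundleModel n F) e
  let y₀ := ch e
  have hl₀ : ch.symm y₀ = e := ch.left_inv hs
  have htgt : ∀ᶠ y in nhds y₀, y ∈ ch.target := extChartAt_target_mem_nhds (I := bundleModel n F) e
  have hcont : Filter.Tendsto ch.symm (nhds y₀) (nhds e) := by
    have := continuousAt_extChartAt_symm (I := bundleModel n F) e
    rwa [ContinuousAt, extChartAt_to_inv] at this
  have hsm : ∀ g : Bundle.TotalSpace F E → ℝ, ContMDiff (bundleModel n F) 𝓘(ℝ, ℝ) ∞ g →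
      ContDiffAt ℝ 2 (g ∘ ch.symm) y₀ := by
    intro g hg
    have h1 := (contMDiffAt_iff.1 (hg e)).2
    rw [(bundleModel n F).range_eq_univ, contDiffWithinAt_univ] at h1
    exact ContDiffAt.of_le h1 two_le_infty
  let l := fun i => linearFunction (F := F) Φ (h.projK (T i)) ∘ ch.symm
  let B := modelBilin (ContinuousLinearMap.fst ℝ (Eu n) F)
    (fun i => (EuclideanSpace.proj i : Eu n →L[ℝ] ℝ).comp (ContinuousLinearMap.fst ℝ (Eu n) F))
    (α.inChart e.proj) l
  have hy1 : y₀.1 = extChartAt (𝓡 n) e.proj e.proj := extChartAt_bundle_fst hs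
  have hda : DifferentiableAt ℝ (α.inChart e.proj) y₀.1 := hy1 ▸ h.differentiableAt e.proj
  have hcl : extDeriv (α.inChart e.proj) y₀.1 = 0 := hy1 ▸ h.closed e.proj
  have hlsm : ∀ i, ContDiffAt ℝ 2 (l i) y₀ := fun i => hsm _ (hΦ _)
  have hB : DifferentiableAt ℝ B y₀ := differentiableAt_modelBilin hda hlsm
  let X (i : Fin 3) (y : Eu n × F) : Eu n × F :=
    mvfderiv (bundleModel n F) ch (ch.symm y) (hamiltonianVector (modelForm α Φ h.compl) (f i) (ch.symm y))
  have hform := hcont.eventually (h.modelForm_eq_modelBilin Φ hΦ e hq)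
  have hX : ∀ i, ∀ᶠ y in nhds y₀, ∀ w, B y (X i y) w = -fderiv ℝ (f i ∘ ch.symm) y w := by
    intro i
    filter_upwards [hform, htgt] with y hy hyt w
    have h1 := hy (hamiltonianVector (modelForm α Φ h.compl) (f i) (ch.symm y))
      (mfderiv 𝓘(ℝ, Eu n × F) (bundleModel n F) ch.symm y w)
    rw [h.hamiltonianVector_spec Φ hΦ, mvfderiv_mfderiv_symm hyt,
      mvfderiv_eq_fderiv_chart (ch.map_target hyt) ((hf i _).mdifferentiableAt (by simp)),
      mvfderiv_mfderiv_symm hyt, ch.right_inv hyt] at h1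
    exact h1.symm
  have hnd : ∀ u, (∀ w, B y₀ u w = 0) → u = 0 := by
    intro u hu
    let u' : TangentSpace (bundleModel n F) (ch.symm y₀) :=
      mfderiv 𝓘(ℝ, Eu n × F) (bundleModel n F) ch.symm y₀ u
    have hyt : y₀ ∈ ch.target := htgt.self_of_nhds
    have hu' : mvfderiv (bundleModel n F) ch (ch.symm y₀) u' = u := mvfderiv_mfderiv_symm hyt u
    have h1 : u' = 0 := h.modelForm_nondegenerate Φ hΦ _ u' fun w => by
      rw [hform.self_of_nhds u' w]
      change B (ch (ch.symm y₀)) (mvfderiv (bundleModel n F) ch (ch.symm y₀) u') _ = 0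
      rw [hu', ch.right_inv hyt]
      exact hu _
    rw [← hu', h1, map_zero]
  have hXd : ∀ i, DifferentiableAt ℝ (X i) y₀ := by
    intro i
    refine differentiableAt_inverse_apply hB hnd (ξ := fun y => -fderiv ℝ (f i ∘ ch.symm) y) ?_ ?_
    · exact (((hsm _ (hf i)).fderiv_right (m := 1) (by norm_num)).differentiableAt (by simp)).neg
    · filter_upwards [hX i] with y hy
      exact ContinuousLinearMap.ext hy
  have key := jacobi_of_closed hB modelBilin_swap (modelBilin_closed hda hlsm hcl)
    (fun i => hsm _ (hf i)) hXd hX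
  have hpo : ∀ i (g : Bundle.TotalSpace F E → ℝ), MDifferentiable (bundleModel n F) 𝓘(ℝ, ℝ) g →
      ∀ y ∈ ch.target, h.poisson Φ (f i) g (ch.symm y) = fderiv ℝ (g ∘ ch.symm) y (X i y) := by
    intro i g hg y hy
    have h1 := mvfderiv_eq_fderiv_chart (ch.map_target hy) (hg (ch.symm y))
      (hamiltonianVector (modelForm α Φ h.compl) (f i) (ch.symm y))
    rw [ch.right_inv hy] at h1
    exact h1
  have hpp : ∀ i j k, h.poisson Φ (f i) (h.poisson Φ (f j) (f k)) e =
      fderiv ℝ (fun y => fderiv ℝ (f k ∘ ch.symm) y (X j y)) y₀ (X i y₀) := by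
    intro i j k
    have h1 := hpo i _ (hff j k) y₀ htgt.self_of_nhds
    rw [hl₀] at h1
    rw [h1]
    have h2 : h.poisson Φ (f j) (f k) ∘ ch.symm =ᶠ[nhds y₀]
        fun y => fderiv ℝ (f k ∘ ch.symm) y (X j y) := by
      filter_upwards [htgt] with y hy
      exact hpo j _ ((hf k).mdifferentiable (by simp)) y hy
    rw [h2.fderiv_eq]
  rw [hpp, hpp, hpp]
  exact key

end IsPolarized

end PoissonJacobi

end OhPark

namespace OhPark

/-! ### Functions that are locally polynomial along the fibres. -/

section PolynomialFunctions

variable {n : ℕ} {C : Type*} [TopologicalSpace C] [ChartedSpace (Eu n) C]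
  [IsManifold (𝓡 n) ∞ C]
  {F : Type*} [NormedAddCommGroup F] [NormedSpace ℝ F]
  {E : C → Type*} [TopologicalSpace (Bundle.TotalSpace F E)]
  [∀ x, AddCommGroup (E x)] [∀ x, Module ℝ (E x)] [∀ x, TopologicalSpace (E x)]
  [FiberBundle F E] [VectorBundle ℝ F E] [ContMDiffVectorBundle ∞ F E (𝓡 n)]
  {K : ∀ x : C, Submodule ℝ (TangentSpace (𝓡 n) x)}

/-- Equality of functions on a bundle over a neighbourhood of `x`. -/
def LocEq (x : C) (f g : Bundle.TotalSpace F E → ℝ) : Prop :=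
  ∀ᶠ y in nhds x, ∀ e : Bundle.TotalSpace F E, e.proj = y → f e = g e

theorem LocEq.apply {x : C} {f g : Bundle.TotalSpace F E → ℝ} (h : LocEq x f g)
    {e : Bundle.TotalSpace F E} (he : e.proj = x) : f e = g e :=
  h.self_of_nhds e he

theorem LocEq.eventuallyEq {f g : Bundle.TotalSpace F E → ℝ} {e : Bundle.TotalSpace F E}
    (h : LocEq e.proj f g) : f =ᶠ[nhds e] g :=
  (eventually_proj h).mono fun e' h => h e' rfl

theorem LocEq.add {x : C} {f g f' g' : Bundle.TotalSpace F E → ℝ} (h : LocEq x f g)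
    (h' : LocEq x f' g') : LocEq x (f + f') (g + g') :=
  (h.and h').mono fun _ hy e he => congrArg₂ (· + ·) (hy.1 e he) (hy.2 e he)

theorem LocEq.mul {x : C} {f g f' g' : Bundle.TotalSpace F E → ℝ} (h : LocEq x f g)
    (h' : LocEq x f' g') : LocEq x (f * f') (g * g') :=
  (h.and h').mono fun _ hy e he => congrArg₂ (· * ·) (hy.1 e he) (hy.2 e he)

theorem LocEq.smul {x : C} {f g : Bundle.TotalSpace F E → ℝ} (h : LocEq x f g) (c : ℝ) :
    LocEq x (c • f) (c • g) :=
  h.mono fun _ hy e he => congrArg (c * ·) (hy e he)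

theorem LocEq.refl (x : C) (f : Bundle.TotalSpace F E → ℝ) : LocEq x f f :=
  Filter.Eventually.of_forall fun _ _ _ => rfl

/-- The functions that are constant along the fibres, and the fibrewise linear ones. -/
def polyGenerators (Φ : ∀ x, E x ≃ₗ[ℝ] Module.Dual ℝ (K x)) : Set (Bundle.TotalSpace F E → ℝ) :=
  {g | ∃ f : C → ℝ, ContMDiff (𝓡 n) 𝓘(ℝ, ℝ) ∞ f ∧ g = fun e => f e.proj} ∪
    Set.range (linearFunction Φ)

/-- The smooth functions which, locally over the base, are polynomial along the fibres. -/
def polyAlgebra (Φ : ∀ x, E x ≃ₗ[ℝ] Module.Dual ℝ (K x)) :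
    Subalgebra ℝ (Bundle.TotalSpace F E → ℝ) where
  carrier := {g | ∀ x, ∃ s ∈ Algebra.adjoin ℝ (polyGenerators (F := F) Φ), LocEq x g s}
  mul_mem' := fun ha hb x => by
    obtain ⟨s, hs, h⟩ := ha x
    obtain ⟨s', hs', h'⟩ := hb x
    exact ⟨_, mul_mem hs hs', h.mul h'⟩
  add_mem' := fun ha hb x => by
    obtain ⟨s, hs, h⟩ := ha x
    obtain ⟨s', hs', h'⟩ := hb x
    exact ⟨_, add_mem hs hs', h.add h'⟩
  algebraMap_mem' := fun c x => ⟨_, Subalgebra.algebraMap_mem _ c, LocEq.refl _ _⟩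

variable {Φ : ∀ x, E x ≃ₗ[ℝ] Module.Dual ℝ (K x)}

theorem adjoin_le_polyAlgebra : Algebra.adjoin ℝ (polyGenerators (F := F) Φ) ≤ polyAlgebra Φ :=
  fun s hs _ => ⟨s, hs, LocEq.refl _ _⟩

theorem mem_polyAlgebra_of_local {g : Bundle.TotalSpace F E → ℝ}
    (h : ∀ x, ∃ s ∈ polyAlgebra Φ, LocEq x g s) : g ∈ polyAlgebra Φ := by
  intro x
  obtain ⟨s, hs, hgs⟩ := h x
  obtain ⟨t, ht, hst⟩ := hs x
  exact ⟨t, ht, (hgs.and hst).mono fun _ hy e he => (hy.1 e he).trans (hy.2 e he)⟩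

theorem contMDiff_of_mem_polyAlgebra (hΦ : IsSmoothIso F Φ) {g : Bundle.TotalSpace F E → ℝ}
    (hg : g ∈ polyAlgebra Φ) : ContMDiff (bundleModel n F) 𝓘(ℝ, ℝ) ∞ g := by
  have h1 : ∀ s ∈ Algebra.adjoin ℝ (polyGenerators (F := F) Φ),
      ContMDiff (bundleModel n F) 𝓘(ℝ, ℝ) ∞ s := by
    intro s hs
    induction hs using Algebra.adjoin_induction with
    | mem s hs =>
      rcases hs with ⟨f, hf, rfl⟩ | ⟨X, rfl⟩
      · exact hf.comp (Bundle.contMDiff_proj E)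
      · exact hΦ X
    | algebraMap c => exact contMDiff_const
    | add _ _ _ _ h h' => exact h.add h'
    | mul _ _ _ _ h h' => exact h.mul h'
  intro e
  obtain ⟨s, hs, h⟩ := hg e.proj
  exact (h1 s hs e).congr_of_eventuallyEq h.eventuallyEq

variable (Φ) in
/-- A smooth function on the base, as a function on the bundle. -/
def basicFn (f : C → ℝ) (hf : ContMDiff (𝓡 n) 𝓘(ℝ, ℝ) ∞ f) : polyAlgebra (F := F) Φ :=
  ⟨fun e => f e.proj, adjoin_le_polyAlgebra (Algebra.subset_adjoin (Or.inl ⟨f, hf, rfl⟩))⟩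

variable (F Φ) in
/-- The fibrewise linear functions. -/
noncomputable def linearFn : sections K →ₗ[ℝ] polyAlgebra (F := F) Φ where
  toFun X := ⟨linearFunction Φ X,
    adjoin_le_polyAlgebra (Algebra.subset_adjoin (Or.inr ⟨X, rfl⟩))⟩
  map_add' X Y := Subtype.ext ((linearFunctionₗ Φ).map_add X Y)
  map_smul' c X := Subtype.ext ((linearFunctionₗ Φ).map_smul c X)

variable (F Φ) in
/-- The set of basic functions. -/
def basicSet : Set (polyAlgebra (F := F) Φ) := {a | ∃ f hf, a = basicFn Φ f hf}

variable (F Φ) in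
/-- The set of linear functions. -/
def linearSet : Set (polyAlgebra (F := F) Φ) := Set.range (linearFn F Φ)

variable (F Φ) in
/-- The ideal of functions that vanish on the zero section. -/
def zeroIdeal : Submodule ℝ (polyAlgebra (F := F) Φ) where
  carrier := {a | ∀ x, (a : Bundle.TotalSpace F E → ℝ) ⟨x, 0⟩ = 0}
  zero_mem' := fun _ => rfl
  add_mem' := fun ha hb x => by
    have := congrArg₂ (· + ·) (ha x) (hb x)
    simpa using this
  smul_mem' := fun c a ha x => by
    have := congrArg (c * ·) (ha x)
    simpa using this

variable (F Φ) in
/-- The basic functions as a subspace. -/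
def basicSubmodule : Submodule ℝ (polyAlgebra (F := F) Φ) where
  carrier := basicSet F Φ
  zero_mem' := ⟨fun _ => 0, contMDiff_const, rfl⟩
  add_mem' := by
    rintro _ _ ⟨f, hf, rfl⟩ ⟨g, hg, rfl⟩
    exact ⟨fun x => f x + g x, hf.add hg, rfl⟩
  smul_mem' := by
    rintro c _ ⟨f, hf, rfl⟩
    exact ⟨fun x => c * f x, contMDiff_const.mul hf, rfl⟩

variable (F Φ) in
/-- Functions which are globally polynomial along the fibres, of degree at most `d`. -/
def polySubmodule : ℕ → Submodule ℝ (polyAlgebra (F := F) Φ)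
  | 0 => basicSubmodule F Φ
  | d + 1 => polySubmodule d ⊔ Submodule.span ℝ
      {a | ∃ X, ∃ g ∈ polySubmodule d, a = linearFn F Φ X * g}

theorem polySubmodule_le {d d' : ℕ} (h : d ≤ d') : polySubmodule F Φ d ≤ polySubmodule F Φ d' := by
  induction h with
  | refl => exact le_rfl
  | step _ ih => exact ih.trans le_sup_left

theorem linear_mul_mem {d : ℕ} (X : sections K) {g : polyAlgebra (F := F) Φ}
    (hg : g ∈ polySubmodule F Φ d) : linearFn F Φ X * g ∈ polySubmodule F Φ (d + 1) :=
  Submodule.mem_sup_right (Submodule.subset_span ⟨X, g, hg, rfl⟩)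

theorem polySubmodule_induction {P : ℕ → polyAlgebra (F := F) Φ → Prop}
    (basic : ∀ a ∈ basicSet F Φ, P 0 a)
    (mono : ∀ d a, P d a → P (d + 1) a)
    (add : ∀ d a b, P d a → P d b → P d (a + b))
    (smul : ∀ d (c : ℝ) a, P d a → P d (c • a))
    (linear : ∀ d X, ∀ g ∈ polySubmodule F Φ d, P d g → P (d + 1) (linearFn F Φ X * g)) :
    ∀ d, ∀ a ∈ polySubmodule F Φ d, P d a := by
  have hz : ∀ d, P d 0 := by
    intro d
    induction d with
    | zero => exact basic 0 (basicSubmodule F Φ).zero_mem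
    | succ d ih => exact mono d _ ih
  intro d
  induction d with
  | zero => exact basic
  | succ d ih =>
    intro a ha
    obtain ⟨b, hb, c, hc, rfl⟩ := Submodule.mem_sup.1 ha
    refine add _ _ _ (mono _ _ (ih b hb)) ?_
    clear ha
    induction hc using Submodule.span_induction with
    | mem c hc =>
      obtain ⟨X, g, hg, rfl⟩ := hc
      exact linear d X g hg (ih g hg)
    | zero => exact hz _
    | add _ _ _ _ h h' => exact add _ _ _ h h'
    | smul c _ _ h => exact smul _ c _ h

theorem basic_mul_mem {f : polyAlgebra (F := F) Φ} (hf : f ∈ basicSet F Φ) :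
    ∀ d, ∀ g ∈ polySubmodule F Φ d, f * g ∈ polySubmodule F Φ d := by
  obtain ⟨f, hf, rfl⟩ := hf
  refine polySubmodule_induction (P := fun d g => _ * g ∈ polySubmodule F Φ d) ?_ ?_ ?_ ?_ ?_
  · rintro _ ⟨g, hg, rfl⟩
    exact ⟨fun x => f x * g x, hf.mul hg, rfl⟩
  · exact fun d a h => polySubmodule_le (Nat.le_succ d) h
  · intro d a b h h'; rw [mul_add]; exact add_mem h h'
  · intro d c a h; rw [mul_smul_comm]; exact Submodule.smul_mem _ _ h
  · intro d X g _ h; rw [mul_left_comm]; exact linear_mul_mem X h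

theorem polySubmodule_mul {d' : ℕ} {b : polyAlgebra (F := F) Φ} (hb : b ∈ polySubmodule F Φ d') :
    ∀ d, ∀ a ∈ polySubmodule F Φ d, a * b ∈ polySubmodule F Φ (d + d') := by
  refine polySubmodule_induction (P := fun d a => a * b ∈ polySubmodule F Φ (d + d')) ?_ ?_ ?_ ?_ ?_
  · intro a ha
    rw [zero_add]
    exact basic_mul_mem ha d' b hb
  · exact fun d a h => polySubmodule_le (by omega) h
  · intro d a b h h'; rw [add_mul]; exact add_mem h h'
  · intro d c a h; rw [smul_mul_assoc]; exact Submodule.smul_mem _ _ h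
  · intro d X g _ h
    rw [mul_assoc, Nat.add_right_comm]
    exact linear_mul_mem X h

theorem one_mem_polySubmodule (d : ℕ) : (1 : polyAlgebra (F := F) Φ) ∈ polySubmodule F Φ d :=
  polySubmodule_le (Nat.zero_le d) ⟨fun _ => 1, contMDiff_const, rfl⟩

theorem linear_mem_polySubmodule (X : sections K) : linearFn F Φ X ∈ polySubmodule F Φ 1 := by
  simpa using linear_mul_mem X (one_mem_polySubmodule (F := F) (Φ := Φ) 0)

theorem exists_polySubmodule (a : polyAlgebra (F := F) Φ) (x : C) :
    ∃ d, ∃ s ∈ polySubmodule F Φ d, LocEq x (a : Bundle.TotalSpace F E → ℝ) s := by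
  obtain ⟨s, hs, h⟩ := a.2 x
  suffices h' : ∃ d, ∃ t ∈ polySubmodule F Φ d, (t : Bundle.TotalSpace F E → ℝ) = s by
    obtain ⟨d, t, ht, rfl⟩ := h'
    exact ⟨d, t, ht, h⟩
  clear h
  induction hs using Algebra.adjoin_induction with
  | mem s hs =>
    rcases hs with ⟨f, hf, rfl⟩ | ⟨X, rfl⟩
    · exact ⟨0, basicFn Φ f hf, ⟨f, hf, rfl⟩, rfl⟩
    · exact ⟨1, linearFn F Φ X, linear_mem_polySubmodule X, rfl⟩
  | algebraMap c => exact ⟨0, basicFn Φ (fun _ => c) contMDiff_const, ⟨_, _, rfl⟩, rfl⟩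
  | add _ _ _ _ h h' =>
    obtain ⟨d, t, ht, rfl⟩ := h
    obtain ⟨d', t', ht', rfl⟩ := h'
    exact ⟨max d d', t + t', add_mem (polySubmodule_le (le_max_left _ _) ht)
      (polySubmodule_le (le_max_right _ _) ht'), rfl⟩
  | mul _ _ _ _ h h' =>
    obtain ⟨d, t, ht, rfl⟩ := h
    obtain ⟨d', t', ht', rfl⟩ := h'
    exact ⟨d + d', t * t', polySubmodule_mul ht' d t ht, rfl⟩

variable (F Φ) in
/-- The filtration of the locally polynomial functions by the degree. -/
def polyFiltration (d : ℤ) : Submodule ℝ (polyAlgebra (F := F) Φ) where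
  -- Negative degrees are truncated to zero by `toNat`, so vanishing there has to be imposed
  -- separately.
  carrier := {a | (d < 0 → a = 0) ∧
    ∀ x, ∃ s ∈ polySubmodule F Φ d.toNat, LocEq x (a : Bundle.TotalSpace F E → ℝ) s}
  zero_mem' := ⟨fun _ => rfl, fun x => ⟨0, zero_mem _, LocEq.refl _ _⟩⟩
  add_mem' := by
    rintro a b ⟨ha, ha'⟩ ⟨hb, hb'⟩
    refine ⟨fun h => by rw [ha h, hb h, add_zero], fun x => ?_⟩
    obtain ⟨s, hs, h⟩ := ha' x
    obtain ⟨s', hs', h'⟩ := hb' x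
    exact ⟨s + s', add_mem hs hs', h.add h'⟩
  smul_mem' := by
    rintro c a ⟨ha, ha'⟩
    refine ⟨fun h => by rw [ha h, smul_zero], fun x => ?_⟩
    obtain ⟨s, hs, h⟩ := ha' x
    exact ⟨c • s, Submodule.smul_mem _ _ hs, h.smul c⟩

theorem polyFiltration_neg {d : ℤ} (hd : d < 0) : polyFiltration F Φ d = ⊥ :=
  (Submodule.eq_bot_iff _).2 fun _ ha => ha.1 hd

theorem polySubmodule_le_polyFiltration (d : ℕ) : polySubmodule F Φ d ≤ polyFiltration F Φ d :=
  fun a ha => ⟨fun h => absurd h (by omega), fun x => ⟨a, by simpa using ha, LocEq.refl _ _⟩⟩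

theorem mem_polyFiltration_of_local {a : polyAlgebra (F := F) Φ} {d : ℤ}
    (h : ∀ x, ∃ s ∈ polyFiltration F Φ d, LocEq x (a : Bundle.TotalSpace F E → ℝ) s) :
    a ∈ polyFiltration F Φ d := by
  refine ⟨fun hd => ?_, fun x => ?_⟩
  · ext e
    obtain ⟨s, hs, h⟩ := h e.proj
    rw [h.apply rfl, hs.1 hd]
  · obtain ⟨s, hs, h⟩ := h x
    obtain ⟨t, ht, h'⟩ := hs.2 x
    exact ⟨t, ht, (h.and h').mono fun _ hy e he => (hy.1 e he).trans (hy.2 e he)⟩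

theorem polyFiltration_le {d d' : ℤ} (h : d ≤ d') : polyFiltration F Φ d ≤ polyFiltration F Φ d' := by
  intro a ha
  by_cases hd : d < 0
  · rw [ha.1 hd]; exact zero_mem _
  · refine ⟨fun hd' => absurd hd' (by omega), fun x => ?_⟩
    obtain ⟨s, hs, h'⟩ := ha.2 x
    exact ⟨s, polySubmodule_le (by omega) hs, h'⟩

theorem polyFiltration_mul {d d' : ℤ} {a b : polyAlgebra (F := F) Φ} (ha : a ∈ polyFiltration F Φ d)
    (hb : b ∈ polyFiltration F Φ d') : a * b ∈ polyFiltration F Φ (d + d') := by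
  by_cases hd : d < 0
  · rw [ha.1 hd, zero_mul]; exact zero_mem _
  by_cases hd' : d' < 0
  · rw [hb.1 hd', mul_zero]; exact zero_mem _
  refine ⟨fun h => absurd h (by omega), fun x => ?_⟩
  obtain ⟨s, hs, h⟩ := ha.2 x
  obtain ⟨s', hs', h'⟩ := hb.2 x
  refine ⟨s * s', ?_, h.mul h'⟩
  rw [Int.toNat_add (by omega) (by omega)]
  exact polySubmodule_mul hs' _ s hs

theorem linear_mem_polyFiltration (X : sections K) : linearFn F Φ X ∈ polyFiltration F Φ 1 :=
  polySubmodule_le_polyFiltration 1 (linear_mem_polySubmodule X)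

variable [T2Space C]

/-- Derivations are local: a bump function on the base, supported where the two functions agree,
annihilates their difference, and the Leibniz rule is evaluated at `e`. -/
theorem derivation_apply_eq (D : Derivation ℝ (polyAlgebra (F := F) Φ) (polyAlgebra (F := F) Φ))
    {a b : polyAlgebra (F := F) Φ} {x : C} (h : LocEq x (a : Bundle.TotalSpace F E → ℝ) b)
    {e : Bundle.TotalSpace F E} (he : e.proj = x) :
    (D a : Bundle.TotalSpace F E → ℝ) e = (D b : Bundle.TotalSpace F E → ℝ) e := by
  subst he
  obtain ⟨f, hf, hf1, hfU⟩ := exists_bump (n := n) h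
  have h0 : basicFn Φ f hf * (a - b) = 0 := by
    ext e'
    change f e'.proj * ((a : Bundle.TotalSpace F E → ℝ) e' - (b : Bundle.TotalSpace F E → ℝ) e') = 0
    by_cases hx : e'.proj ∈ tsupport f
    · rw [hfU hx e' rfl, sub_self, mul_zero]
    · rw [image_eq_zero_of_notMem_tsupport hx, zero_mul]
  have h1 := congrArg D h0
  rw [D.leibniz, map_zero, map_sub] at h1
  have h2 := congrArg (fun a : polyAlgebra (F := F) Φ => (a : Bundle.TotalSpace F E → ℝ) e) h1
  have h3 : f e.proj * ((D a : Bundle.TotalSpace F E → ℝ) e - (D b : Bundle.TotalSpace F E → ℝ) e) +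
    ((a : Bundle.TotalSpace F E → ℝ) e - (b : Bundle.TotalSpace F E → ℝ) e) *
      (D (basicFn Φ f hf) : Bundle.TotalSpace F E → ℝ) e = 0 := h2
  rw [hf1.self_of_nhds, h.apply rfl, sub_self, zero_mul, add_zero, one_mul] at h3
  exact sub_eq_zero.1 h3

theorem derivation_locEq (D : Derivation ℝ (polyAlgebra (F := F) Φ) (polyAlgebra (F := F) Φ))
    {a b : polyAlgebra (F := F) Φ} {x : C} (h : LocEq x (a : Bundle.TotalSpace F E → ℝ) b) :
    LocEq x (D a : Bundle.TotalSpace F E → ℝ) (D b) :=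
  h.eventually_nhds.mono fun _ hy _ he => derivation_apply_eq D hy he

/-- The locally polynomial functions are generated by the basic and the linear ones. -/
theorem isGeneratingSystem_poly : ListOp.IsGeneratingSystem (basicSet F Φ) (linearSet F Φ)
    (zeroIdeal F Φ) (polyFiltration F Φ) where
  ext D hB hL a := by
    have h1 : ∀ d, ∀ s ∈ polySubmodule F Φ d, D s = 0 := by
      refine polySubmodule_induction (P := fun _ s => D s = 0) hB (fun _ _ h => h) ?_ ?_ ?_
      · intro _ a b h h'; rw [map_add, h, h', add_zero]
      · intro _ c a h; rw [D.map_smul, h, smul_zero]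
      · intro _ X g _ h
        rw [D.leibniz, h, hL _ ⟨X, rfl⟩, smul_zero, smul_zero, add_zero]
    ext e
    obtain ⟨d, s, hs, h⟩ := exists_polySubmodule a e.proj
    rw [derivation_apply_eq D h rfl, h1 d s hs]
  ideal D hL a ha x := by
    obtain ⟨d, s, hs, h⟩ := exists_polySubmodule a x
    -- Up to its restriction to the zero section, a polynomial function is a sum of multiples of
    -- linear functions, and `D` maps these to functions vanishing at the point.
    have h1 : ∀ d, ∀ s ∈ polySubmodule F Φ d, ∃ f hf,
        (∀ y, (s : Bundle.TotalSpace F E → ℝ) ⟨y, 0⟩ = f y) ∧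
        (D (s - basicFn Φ f hf) : Bundle.TotalSpace F E → ℝ) ⟨x, 0⟩ = 0 := by
      refine polySubmodule_induction ?_ (fun _ _ h => h) ?_ ?_ ?_
      · rintro _ ⟨f, hf, rfl⟩
        exact ⟨f, hf, fun _ => rfl, by rw [sub_self, map_zero]; rfl⟩
      · rintro _ a b ⟨f, hf, h1, h2⟩ ⟨g, hg, h3, h4⟩
        refine ⟨fun y => f y + g y, hf.add hg, fun y => congrArg₂ (· + ·) (h1 y) (h3 y), ?_⟩
        have e1 : a + b - basicFn Φ (fun y => f y + g y) (hf.add hg) =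
          (a - basicFn Φ f hf) + (b - basicFn Φ g hg) := by
          have e0 : basicFn (F := F) Φ (fun y => f y + g y) (hf.add hg) =
            basicFn Φ f hf + basicFn Φ g hg := rfl
          rw [e0]; abel
        rw [e1, map_add]
        exact (congrArg₂ (· + ·) h2 h4).trans (add_zero 0)
      · rintro _ c a ⟨f, hf, h1, h2⟩
        refine ⟨fun y => c * f y, contMDiff_const.mul hf, fun y => congrArg (c * ·) (h1 y), ?_⟩
        have e1 : c • a - basicFn Φ (fun y => c * f y) (contMDiff_const.mul hf) =
          c • (a - basicFn Φ f hf) := by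
          rw [smul_sub]; rfl
        rw [e1, D.map_smul]
        exact (congrArg (c * ·) h2).trans (mul_zero c)
      · rintro _ X g - -
        refine ⟨fun _ => 0, contMDiff_const, fun y => ?_, ?_⟩
        · have h0 : linearFunction (F := F) Φ X ⟨y, 0⟩ = 0 := by
            unfold linearFunction; rw [map_zero]; rfl
          exact (congrArg (· * _) h0).trans (zero_mul _)
        · have e1 : linearFn F Φ X * g - basicFn Φ (fun _ => 0) contMDiff_const =
            linearFn F Φ X * g := sub_zero _
          have h0 : linearFunction (F := F) Φ X ⟨x, 0⟩ = 0 := by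
            unfold linearFunction; rw [map_zero]; rfl
          rw [e1, D.leibniz]
          have h2 : (D (linearFn F Φ X) : Bundle.TotalSpace F E → ℝ) ⟨x, 0⟩ = 0 :=
            hL _ ⟨X, rfl⟩ x
          change linearFunction (F := F) Φ X ⟨x, 0⟩ * _ + _ *
            (D (linearFn F Φ X) : Bundle.TotalSpace F E → ℝ) ⟨x, 0⟩ = 0
          rw [h0, h2, zero_mul, mul_zero, add_zero]
    obtain ⟨f, hf, hsf, hD⟩ := h1 d s hs
    rw [derivation_apply_eq D h rfl]
    -- `a` vanishes on the zero section, so the restriction `f` vanishes near `x` and does not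
    -- contribute by locality.
    have h2 : LocEq x (basicFn (F := F) Φ f hf : Bundle.TotalSpace F E → ℝ) (0 : polyAlgebra (F := F) Φ) := by
      refine h.mono fun y hy e he => ?_
      have h3 := hy ⟨y, 0⟩ rfl
      rw [ha y, hsf y] at h3
      change f e.proj = 0
      rw [he, ← h3]
    have h3 := derivation_apply_eq D h2 (e := ⟨x, 0⟩) rfl
    rw [map_sub] at hD
    have h4 : (D s : Bundle.TotalSpace F E → ℝ) ⟨x, 0⟩ -
      (D (basicFn Φ f hf) : Bundle.TotalSpace F E → ℝ) ⟨x, 0⟩ = 0 := hD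
    rw [h3, map_zero] at h4
    exact (sub_eq_zero.1 h4)
  filtration D c hB hL d a ha := by
    by_cases hd : d < 0
    · rw [ha.1 hd, map_zero]; exact zero_mem _
    have h1 : ∀ d, ∀ s ∈ polySubmodule F Φ d, D s ∈ polyFiltration F Φ (c + d - 1) := by
      refine polySubmodule_induction (P := fun d s => D s ∈ polyFiltration F Φ (c + d - 1)) ?_ ?_ ?_ ?_ ?_
      · intro a ha; simpa using hB a ha
      · exact fun d a h => polyFiltration_le (by push_cast; omega) h
      · intro d a b h h'; rw [map_add]; exact add_mem h h'
      · intro d c a h; rw [D.map_smul]; exact Submodule.smul_mem _ _ h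
      · intro d X g hg h
        rw [D.leibniz]
        refine add_mem ?_ ?_
        · have := polyFiltration_mul (linear_mem_polyFiltration X) h
          exact polyFiltration_le (by push_cast; omega) this
        · have := polyFiltration_mul (polySubmodule_le_polyFiltration d hg) (hL _ ⟨X, rfl⟩)
          exact polyFiltration_le (by push_cast; omega) this
    refine mem_polyFiltration_of_local fun x => ?_
    obtain ⟨s, hs, h⟩ := ha.2 x
    refine ⟨D s, ?_, derivation_locEq D h⟩
    have := h1 _ s hs
    rwa [Int.toNat_of_nonneg (by omega)] at this
  neg d hd := polyFiltration_neg hd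
  linear_mem := by
    rintro _ ⟨X, rfl⟩ x
    change linearFunction (F := F) Φ X ⟨x, 0⟩ = 0
    unfold linearFunction
    rw [map_zero]
    rfl
  disjoint a ha hI := by
    ext e
    obtain ⟨s, ⟨f, hf, rfl⟩, h⟩ := ha.2 e.proj
    have h1 := h.apply (e := ⟨e.proj, 0⟩) rfl
    rw [hI e.proj] at h1
    exact (h.apply rfl).trans h1.symm

end PolynomialFunctions

end OhPark

namespace OhPark

/-! ### The Poisson bivector as a multiderivation of locally polynomial functions. -/

section PoissonAlgebra

variable {n : ℕ} {C : Type*} [TopologicalSpace C] [ChartedSpace (Eu n) C]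
  [IsManifold (𝓡 n) ∞ C] [T2Space C]
  {F : Type*} [NormedAddCommGroup F] [NormedSpace ℝ F] [FiniteDimensional ℝ F]
  {E : C → Type*} [TopologicalSpace (Bundle.TotalSpace F E)]
  [∀ x, AddCommGroup (E x)] [∀ x, Module ℝ (E x)] [∀ x, TopologicalSpace (E x)]
  [FiberBundle F E] [VectorBundle ℝ F E] [ContMDiffVectorBundle ∞ F E (𝓡 n)]

theorem linearFunction_zero_section {K : ∀ x : C, Submodule ℝ (TangentSpace (𝓡 n) x)}
    (Φ : ∀ x, E x ≃ₗ[ℝ] Module.Dual ℝ (K x)) (X : sections K) (x : C) :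
    linearFunction (F := F) Φ X ⟨x, 0⟩ = 0 := by
  unfold linearFunction
  rw [map_zero]
  rfl

namespace IsPolarized

variable {α : DiffForm (𝓡 n) C 2} {G : ∀ x : C, Submodule ℝ (TangentSpace (𝓡 n) x)}
  (h : IsPolarized α G) (Φ : ∀ x, E x ≃ₗ[ℝ] Module.Dual ℝ (α.ker x)) (hΦ : IsSmoothIso F Φ)

theorem poisson_congr_right {f g g' : Bundle.TotalSpace F E → ℝ} {e : Bundle.TotalSpace F E}
    (hg : g =ᶠ[nhds e] g') : h.poisson Φ f g e = h.poisson Φ f g' e := by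
  unfold poisson
  rw [mvfderiv_congr hg]

theorem poisson_const_right (f : Bundle.TotalSpace F E → ℝ) (c : ℝ) :
    h.poisson Φ f (fun _ => c) = 0 := by
  funext e
  unfold poisson
  rw [mvfderiv_const]
  rfl

theorem poisson_add_right (f : Bundle.TotalSpace F E → ℝ) {g g' : Bundle.TotalSpace F E → ℝ}
    (hg : MDifferentiable (bundleModel n F) 𝓘(ℝ, ℝ) g)
    (hg' : MDifferentiable (bundleModel n F) 𝓘(ℝ, ℝ) g') :
    h.poisson Φ f (g + g') = h.poisson Φ f g + h.poisson Φ f g' := by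
  funext e
  exact congrArg (fun L => L (hamiltonianVector (modelForm α Φ h.compl) f e))
    (mvfderiv_add (hg e) (hg' e))

theorem poisson_mul_right (f : Bundle.TotalSpace F E → ℝ) {g g' : Bundle.TotalSpace F E → ℝ}
    (hg : MDifferentiable (bundleModel n F) 𝓘(ℝ, ℝ) g)
    (hg' : MDifferentiable (bundleModel n F) 𝓘(ℝ, ℝ) g') :
    h.poisson Φ f (g * g') = g * h.poisson Φ f g' + g' * h.poisson Φ f g := by
  funext e
  exact congrArg (fun L => L (hamiltonianVector (modelForm α Φ h.compl) f e))
    (mvfderiv_mul (hg e) (hg' e))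

include hΦ

theorem mdifferentiable_of_mem {g : Bundle.TotalSpace F E → ℝ} (hg : g ∈ polyAlgebra Φ) :
    MDifferentiable (bundleModel n F) 𝓘(ℝ, ℝ) g :=
  (contMDiff_of_mem_polyAlgebra hΦ hg).mdifferentiable (by simp)

theorem poisson_mem_of_generators {f g : Bundle.TotalSpace F E → ℝ} (hg : g ∈ polyAlgebra Φ)
    (hb : ∀ a ∈ polyGenerators Φ, h.poisson Φ f a ∈ polyAlgebra Φ) :
    h.poisson Φ f g ∈ polyAlgebra Φ := by
  have h1 : ∀ s ∈ Algebra.adjoin ℝ (polyGenerators Φ), h.poisson Φ f s ∈ polyAlgebra Φ := by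
    intro s hs
    induction hs using Algebra.adjoin_induction with
    | mem s hs => exact hb s hs
    | algebraMap c =>
      have h2 := h.poisson_const_right Φ f c
      exact h2 ▸ zero_mem (polyAlgebra Φ)
    | add a b ha hb iha ihb =>
      rw [h.poisson_add_right Φ f (mdifferentiable_of_mem Φ hΦ (adjoin_le_polyAlgebra ha))
        (mdifferentiable_of_mem Φ hΦ (adjoin_le_polyAlgebra hb))]
      exact add_mem iha ihb
    | mul a b ha hb iha ihb =>
      rw [h.poisson_mul_right Φ f (mdifferentiable_of_mem Φ hΦ (adjoin_le_polyAlgebra ha))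
        (mdifferentiable_of_mem Φ hΦ (adjoin_le_polyAlgebra hb))]
      exact add_mem (mul_mem (adjoin_le_polyAlgebra ha) ihb)
        (mul_mem (adjoin_le_polyAlgebra hb) iha)
  refine mem_polyAlgebra_of_local fun x => ?_
  obtain ⟨s, hs, hgs⟩ := hg x
  refine ⟨_, h1 s hs, hgs.eventually_nhds.mono fun y hy e he => ?_⟩
  subst he
  exact h.poisson_congr_right Φ (LocEq.eventuallyEq hy)

theorem exists_poisson_basic_basic {f g : C → ℝ} (hf : ContMDiff (𝓡 n) 𝓘(ℝ, ℝ) ∞ f)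
    (hg : ContMDiff (𝓡 n) 𝓘(ℝ, ℝ) ∞ g) :
    ∃ a ∈ polySubmodule F Φ 0,
      h.poisson Φ (fun e => f e.proj) (fun e => g e.proj) = (a : Bundle.TotalSpace F E → ℝ) := by
  obtain ⟨H, hH, hHf⟩ := h.exists_hamiltonian hf
  exact ⟨basicFn Φ _ (contMDiff_lieD H hg), ⟨_, _, rfl⟩,
    funext fun e => h.poisson_basic_basic Φ hΦ hf hg hH hHf e⟩

theorem exists_poisson_basic_linear {f : C → ℝ} (hf : ContMDiff (𝓡 n) 𝓘(ℝ, ℝ) ∞ f)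
    (X : sections α.ker) :
    ∃ a ∈ polySubmodule F Φ 1,
      h.poisson Φ (fun e => f e.proj) (linearFunction Φ X) = (a : Bundle.TotalSpace F E → ℝ) := by
  obtain ⟨H, hH, hHf⟩ := h.exists_hamiltonian hf
  exact ⟨basicFn Φ _ (contMDiff_lieD X.1 hf) + linearFn F Φ (h.projK (bracket H X.1)),
    add_mem (polySubmodule_le (Nat.zero_le 1) ⟨_, _, rfl⟩) (linear_mem_polySubmodule _),
    funext fun e => h.poisson_basic_linear Φ hΦ hf hH hHf X e⟩

/-- The quadratic expression needs coordinates on the base, so it is available only near `x`; this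
is why the algebra consists of locally polynomial functions. -/
theorem exists_poisson_linear_linear (X Z : sections α.ker) (x : C) :
    ∃ a ∈ polySubmodule F Φ 2, (a : Bundle.TotalSpace F E → ℝ) ⟨x, 0⟩ = 0 ∧
      LocEq x (h.poisson Φ (linearFunction Φ X) (linearFunction Φ Z))
        (a : Bundle.TotalSpace F E → ℝ) := by
  obtain ⟨q, T, hq⟩ := exists_local_coordinates (n := n) x
  choose H hH hHf using fun i => h.exists_hamiltonian (hq.smooth i)
  have h1 := h.poisson_linear_linear Φ hΦ hq hH hHf
  let a : polyAlgebra (F := F) Φ := -linearFn F Φ (h.projK (bracket X.1 Z.1)) +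
    ∑ i, linearFn F Φ (h.projK (bracket X.1 (H i))) *
      linearFn F Φ (h.projK (bracket (h.projG (T i)) Z.1))
  have ha : ∀ e, (a : Bundle.TotalSpace F E → ℝ) e =
      -linearFunction Φ (h.projK (bracket X.1 Z.1)) e +
        ∑ i, linearFunction Φ (h.projK (bracket X.1 (H i))) e *
          linearFunction Φ (h.projK (bracket (h.projG (T i)) Z.1)) e := by
    intro e
    refine congrArg (-linearFunction Φ (h.projK (bracket X.1 Z.1)) e + ·) ?_
    rw [AddSubmonoidClass.coe_finsetSum, Finset.sum_apply]
    rfl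
  refine ⟨a, ?_, ?_, h1.mono fun y hy e he => (hy e he X Z).trans (ha e).symm⟩
  · refine add_mem (neg_mem (polySubmodule_le one_le_two (linear_mem_polySubmodule _)))
      (Submodule.sum_mem _ fun i _ => ?_)
    exact linear_mul_mem _ (linear_mem_polySubmodule _)
  · rw [ha]
    simp [linearFunction_zero_section]

theorem poisson_mem {f g : Bundle.TotalSpace F E → ℝ} (hf : f ∈ polyAlgebra Φ)
    (hg : g ∈ polyAlgebra Φ) : h.poisson Φ f g ∈ polyAlgebra Φ := by
  have hs : ∀ f g : Bundle.TotalSpace F E → ℝ, h.poisson Φ f g ∈ polyAlgebra Φ →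
      h.poisson Φ g f ∈ polyAlgebra Φ := fun f g hfg => by
    rw [show h.poisson Φ g f = -h.poisson Φ f g from funext (h.poisson_swap Φ hΦ g f)]
    exact neg_mem hfg
  have h1 : ∀ a ∈ polyGenerators (F := F) Φ, ∀ b ∈ polyGenerators (F := F) Φ,
      h.poisson Φ a b ∈ polyAlgebra Φ := by
    rintro _ (⟨f, hf, rfl⟩ | ⟨X, rfl⟩) _ (⟨g, hg, rfl⟩ | ⟨Z, rfl⟩)
    · obtain ⟨a, -, ha⟩ := h.exists_poisson_basic_basic Φ hΦ hf hg
      exact ha ▸ a.2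
    · obtain ⟨a, -, ha⟩ := h.exists_poisson_basic_linear Φ hΦ hf Z
      exact ha ▸ a.2
    · obtain ⟨a, -, ha⟩ := h.exists_poisson_basic_linear Φ hΦ hg X
      exact hs _ _ (ha ▸ a.2)
    · refine mem_polyAlgebra_of_local fun x => ?_
      obtain ⟨a, -, -, ha⟩ := h.exists_poisson_linear_linear Φ hΦ X Z x
      exact ⟨a, a.2, ha⟩
  exact h.poisson_mem_of_generators Φ hΦ hg fun a ha =>
    hs _ _ (h.poisson_mem_of_generators Φ hΦ hf fun b hb => h1 a ha b hb)

omit hΦ in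
/-- The Poisson bracket of locally polynomial functions. -/
noncomputable def poissonFn (hΦ : IsSmoothIso F Φ) (a b : polyAlgebra (F := F) Φ) :
    polyAlgebra (F := F) Φ :=
  ⟨h.poisson Φ a b, h.poisson_mem Φ hΦ a.2 b.2⟩

omit hΦ in
/-- The Poisson bivector field, as an operation on locally polynomial functions. -/
noncomputable def poissonOp (hΦ : IsSmoothIso F Φ) : ListOp (polyAlgebra (F := F) Φ)
  | [a, b] => h.poissonFn Φ hΦ a b
  | _ => 0

omit hΦ
variable {Φ}
variable (hΦ : IsSmoothIso F Φ)

theorem poissonFn_swap (a b : polyAlgebra (F := F) Φ) :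
    h.poissonFn Φ hΦ a b = -h.poissonFn Φ hΦ b a :=
  Subtype.ext (funext (h.poisson_swap Φ hΦ _ _))

theorem poissonFn_mul_right (a b c : polyAlgebra (F := F) Φ) :
    h.poissonFn Φ hΦ a (b * c) = b * h.poissonFn Φ hΦ a c + c * h.poissonFn Φ hΦ a b :=
  Subtype.ext (h.poisson_mul_right Φ _ (mdifferentiable_of_mem Φ hΦ b.2)
    (mdifferentiable_of_mem Φ hΦ c.2))

theorem poissonFn_add_right (a b c : polyAlgebra (F := F) Φ) :
    h.poissonFn Φ hΦ a (b + c) = h.poissonFn Φ hΦ a b + h.poissonFn Φ hΦ a c :=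
  Subtype.ext (h.poisson_add_right Φ _ (mdifferentiable_of_mem Φ hΦ b.2)
    (mdifferentiable_of_mem Φ hΦ c.2))

theorem poissonFn_smul_right (r : ℝ) (a b : polyAlgebra (F := F) Φ) :
    h.poissonFn Φ hΦ a (r • b) = r • h.poissonFn Φ hΦ a b := by
  have h1 : h.poissonFn Φ hΦ a (algebraMap ℝ _ r) = 0 :=
    Subtype.ext (h.poisson_const_right Φ _ r)
  rw [Algebra.smul_def, h.poissonFn_mul_right, h1, mul_zero, add_zero, Algebra.smul_def]

theorem poissonOp_of_length {t : List (polyAlgebra (F := F) Φ)} (ht : t.length ≠ 2) :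
    h.poissonOp Φ hΦ t = 0 := by
  rcases t with _ | ⟨a, _ | ⟨b, _ | ⟨c, t⟩⟩⟩
  · rfl
  · rfl
  · exact absurd rfl ht
  · rfl

theorem multiDer_poissonOp : ListOp.MultiDer (h.poissonOp Φ hΦ) where
  alt s u v t := by
    by_cases hl : (s ++ u :: v :: t).length = 2
    · obtain rfl : s = [] := List.length_eq_zero_iff.1 (by simp at hl; omega)
      obtain rfl : t = [] := List.length_eq_zero_iff.1 (by simpa using hl)
      exact h.poissonFn_swap hΦ u v
    · rw [h.poissonOp_of_length hΦ hl, h.poissonOp_of_length hΦ (by simpa using hl), neg_zero]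
  add u v t := by
    by_cases hl : t.length = 1
    · obtain ⟨b, rfl⟩ := List.length_eq_one_iff.1 hl
      change h.poissonFn Φ hΦ _ _ = h.poissonFn Φ hΦ _ _ + h.poissonFn Φ hΦ _ _
      rw [h.poissonFn_swap, h.poissonFn_add_right, neg_add, ← h.poissonFn_swap, ← h.poissonFn_swap]
    · rw [h.poissonOp_of_length hΦ (by simpa using hl), h.poissonOp_of_length hΦ (by simpa using hl),
        h.poissonOp_of_length hΦ (by simpa using hl), add_zero]
  smul r v t := by
    by_cases hl : t.length = 1
    · obtain ⟨b, rfl⟩ := List.length_eq_one_iff.1 hl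
      change h.poissonFn Φ hΦ _ _ = r • h.poissonFn Φ hΦ _ _
      rw [h.poissonFn_swap, h.poissonFn_smul_right, ← smul_neg, ← h.poissonFn_swap]
    · rw [h.poissonOp_of_length hΦ (by simpa using hl), h.poissonOp_of_length hΦ (by simpa using hl),
        smul_zero]
  mul u v t := by
    by_cases hl : t.length = 1
    · obtain ⟨b, rfl⟩ := List.length_eq_one_iff.1 hl
      change h.poissonFn Φ hΦ _ _ = u * h.poissonFn Φ hΦ _ _ + v * h.poissonFn Φ hΦ _ _
      rw [h.poissonFn_swap, h.poissonFn_mul_right, h.poissonFn_swap hΦ b v,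
        h.poissonFn_swap hΦ b u]
      ring
    · rw [h.poissonOp_of_length hΦ (by simpa using hl), h.poissonOp_of_length hΦ (by simpa using hl),
        h.poissonOp_of_length hΦ (by simpa using hl), mul_zero, mul_zero, add_zero]

theorem hom_poissonOp : ListOp.Hom 2 (h.poissonOp Φ hΦ) :=
  fun _ ht => h.poissonOp_of_length hΦ (by exact_mod_cast ht)

theorem poissonFn_basic_basic_mem {a b : polyAlgebra (F := F) Φ} (ha : a ∈ basicSet F Φ)
    (hb : b ∈ basicSet F Φ) : h.poissonFn Φ hΦ a b ∈ polyFiltration F Φ 0 := by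
  obtain ⟨f, hf, rfl⟩ := ha
  obtain ⟨g, hg, rfl⟩ := hb
  obtain ⟨a, ha, hfg⟩ := h.exists_poisson_basic_basic Φ hΦ hf hg
  have h1 : h.poissonFn Φ hΦ (basicFn Φ f hf) (basicFn Φ g hg) = a := Subtype.ext hfg
  rw [h1]
  exact polySubmodule_le_polyFiltration 0 ha

theorem poissonFn_basic_linear_mem {a b : polyAlgebra (F := F) Φ} (ha : a ∈ basicSet F Φ)
    (hb : b ∈ linearSet F Φ) : h.poissonFn Φ hΦ a b ∈ polyFiltration F Φ 1 := by
  obtain ⟨f, hf, rfl⟩ := ha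
  obtain ⟨X, rfl⟩ := hb
  obtain ⟨a, ha, hfg⟩ := h.exists_poisson_basic_linear Φ hΦ hf X
  have h1 : h.poissonFn Φ hΦ (basicFn Φ f hf) (linearFn F Φ X) = a := Subtype.ext hfg
  rw [h1]
  exact polySubmodule_le_polyFiltration 1 ha

theorem poissonFn_linear_linear_mem {a b : polyAlgebra (F := F) Φ} (ha : a ∈ linearSet F Φ)
    (hb : b ∈ linearSet F Φ) : h.poissonFn Φ hΦ a b ∈ polyFiltration F Φ 2 := by
  obtain ⟨X, rfl⟩ := ha
  obtain ⟨Z, rfl⟩ := hb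
  refine mem_polyFiltration_of_local fun x => ?_
  obtain ⟨a, ha, -, hl⟩ := h.exists_poisson_linear_linear Φ hΦ X Z x
  exact ⟨a, polySubmodule_le_polyFiltration 2 ha, hl⟩

/-- Zero, one or two linear arguments among the two give fibre degree at most zero, one or two. -/
theorem deg_poissonOp :
    ListOp.Deg (basicSet F Φ) (linearSet F Φ) (polyFiltration F Φ) 2 (h.poissonOp Φ hΦ) := by
  intro k t ht
  by_cases hl : t.length = 2
  · obtain ⟨a, b, rfl⟩ := List.length_eq_two.1 hl
    change h.poissonFn Φ hΦ a b ∈ _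
    cases ht with
    | basic ha ht => cases ht with
      | basic hb ht =>
        cases ht
        exact h.poissonFn_basic_basic_mem hΦ ha hb
      | linear hb ht =>
        cases ht
        exact h.poissonFn_basic_linear_mem hΦ ha hb
    | linear ha ht => cases ht with
      | basic hb ht =>
        cases ht
        rw [h.poissonFn_swap]
        exact neg_mem (h.poissonFn_basic_linear_mem hΦ hb ha)
      | linear hb ht =>
        cases ht
        exact h.poissonFn_linear_linear_mem hΦ ha hb
  · rw [h.poissonOp_of_length hΦ hl]
    exact zero_mem _

/-- Brackets of linear functions have no constant term; this expresses that the zero section is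
coisotropic in `E`. -/
theorem tangent_poissonOp : ListOp.Tangent (zeroIdeal F Φ) (h.poissonOp Φ hΦ) := by
  refine ListOp.Tangent.of_linear isGeneratingSystem_poly (h.multiDer_poissonOp hΦ) fun t ht => ?_
  by_cases hl : t.length = 2
  · obtain ⟨a, b, rfl⟩ := List.length_eq_two.1 hl
    obtain ⟨X, rfl⟩ := ht a (by simp)
    obtain ⟨Z, rfl⟩ := ht b (by simp)
    intro x
    obtain ⟨c, -, hc, hl⟩ := h.exists_poisson_linear_linear Φ hΦ X Z x
    exact (hl.apply (e := ⟨x, 0⟩) rfl).trans hc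
  · rw [h.poissonOp_of_length hΦ hl]
    exact zero_mem _

theorem poissonFn_jacobi (a b c : polyAlgebra (F := F) Φ) :
    h.poissonFn Φ hΦ a (h.poissonFn Φ hΦ b c) + h.poissonFn Φ hΦ b (h.poissonFn Φ hΦ c a) +
      h.poissonFn Φ hΦ c (h.poissonFn Φ hΦ a b) = 0 := by
  refine Subtype.ext (funext fun e => ?_)
  have hm : ∀ i, (![a, b, c] i : Bundle.TotalSpace F E → ℝ) ∈ polyAlgebra Φ := fun i => Subtype.coe_prop _
  exact h.poisson_jacobi Φ hΦ (f := fun i => ![a, b, c] i)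
    (fun i => contMDiff_of_mem_polyAlgebra hΦ (hm i))
    (fun i j => mdifferentiable_of_mem Φ hΦ (h.poisson_mem Φ hΦ (hm i) (hm j))) e

/-- The bracket lives in arity three only, where it is a multiple of the cyclic sum in the Jacobi
identity. -/
theorem br_poissonOp : ListOp.br (h.poissonOp Φ hΦ) (h.poissonOp Φ hΦ) = 0 := by
  have hm := h.multiDer_poissonOp hΦ
  have hh := h.hom_poissonOp hΦ
  funext t
  by_cases hl : t.length = 3
  · obtain ⟨a, b, c, rfl⟩ := List.length_eq_three.1 hl
    have h2 : ∀ a b, h.poissonOp Φ hΦ [a, b] = h.poissonFn Φ hΦ a b := fun _ _ => rfl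
    have h1 := h.poissonFn_jacobi hΦ a b c
    have hz : ∀ a b c, h.poissonOp Φ hΦ [a, b, c] = 0 := fun _ _ _ => rfl
    rw [ListOp.br_eq hh.par hh.par hm.toAltLin]
    simp only [ListOp.comp, ListOp.ins, ListOp.fix, ListOp.tw, Pi.sub_apply, Pi.smul_apply,
      List.length, h2, hz]
    have hz1 : ∀ a, h.poissonOp Φ hΦ [a] = 0 := fun _ => rfl
    have hz4 : ∀ a b c d, h.poissonOp Φ hΦ [a, b, c, d] = 0 := fun _ _ _ _ => rfl
    norm_num
    rw [← h.poissonFn_swap hΦ c a, hz1, hz4]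
    linear_combination -2 * h1
  · exact hh.br hh hm.toAltLin hm.toAltLin t (by push_cast; omega)

theorem represents_poissonBivector {U : Set (Bundle.TotalSpace F E)} (hU : IsOpen U) :
    Represents U (poissonBivector (modelForm α Φ h.compl) U) (h.poissonOp Φ hΦ) where
  localized p f g hfg e he := by
    have h1 : ∀ i, f i =ᶠ[nhds e] g i := fun i => Filter.eventuallyEq_of_mem (hU.mem_nhds he) (hfg i)
    match p, f, g, hfg, h1 with
    | 0, _, _, _, _ => rfl
    | 1, _, _, _, _ => rfl
    | 2, f, g, _, h1 =>
      have h2 : ∀ f, poissonBivector (modelForm α Φ h.compl) U 2 f e = h.poisson Φ (f 0) (f 1) e :=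
        fun f => if_pos he
      -- Locality in the first argument follows from locality in the second by antisymmetry.
      rw [h2, h2, h.poisson_congr_right Φ (h1 1), h.poisson_swap Φ hΦ,
        h.poisson_congr_right Φ (h1 0), ← h.poisson_swap Φ hΦ]
    | _ + 3, _, _, _, _ => rfl
  eq p f e he := by
    match p, f with
    | 0, _ => rfl
    | 1, _ => rfl
    | 2, f => exact if_pos he
    | _ + 3, f =>
      rw [h.poissonOp_of_length hΦ (by simp)]
      rfl

end IsPolarized

end PoissonAlgebra

end OhPark

namespace OhPark

/-! ### Alternating forms evaluated on lists. -/

section EvalList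

variable {V : Type*} [AddCommGroup V] [Module ℝ V]

/-- The value of a family of alternating forms on a list of vectors. -/
def evalList (w : ∀ k : ℕ, V [⋀^Fin k]→ₗ[ℝ] ℝ) (l : List V) : ℝ := w l.length l.get

theorem evalList_ofFn (w : ∀ k : ℕ, V [⋀^Fin k]→ₗ[ℝ] ℝ) {k : ℕ} (f : Fin k → V) :
    evalList w (List.ofFn f) = w k f := by
  have h1 : ∀ (l : List V) (k : ℕ) (hk : l.length = k),
      evalList w l = w k fun i => l.get (i.cast hk.symm) := by
    rintro l _ rfl
    rfl
  rw [h1 _ k (by simp)]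
  congr 1
  funext i
  simp

theorem evalList_cons (w : ∀ k : ℕ, V [⋀^Fin k]→ₗ[ℝ] ℝ) (v : V) (l : List V) :
    evalList w (v :: l) = evalList (fun k => (w (k + 1)).curryLeft v) l := by
  have h1 : (v :: l).get = Matrix.vecCons v l.get :=
    funext (Fin.cases rfl fun _ => rfl)
  exact congrArg (w (l.length + 1)) h1

theorem evalList_swap (w : ∀ k : ℕ, V [⋀^Fin k]→ₗ[ℝ] ℝ) (s : List V) (u v : V) (t : List V) :
    evalList w (s ++ u :: v :: t) = -evalList w (s ++ v :: u :: t) := by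
  induction s generalizing w with
  | nil =>
    have h1 : ∀ u v, (u :: v :: t).get = Matrix.vecCons u (Matrix.vecCons v t.get) := fun u v =>
      funext (Fin.cases rfl (Fin.cases rfl fun _ => rfl))
    have h2 := (w (t.length + 2)).map_swap (v := (v :: u :: t).get) (i := 0) (j := 1) (by simp)
    refine Eq.trans (congrArg (w (t.length + 2)) ?_) h2
    change (u :: v :: t).get = _
    rw [h1, h1]
    refine funext (Fin.cases ?_ (Fin.cases ?_ fun i => ?_))
    · simp
    · simp
    · rw [Function.comp_apply, Equiv.swap_apply_of_ne_of_ne]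
      · rfl
      · exact Fin.succ_ne_zero _
      · exact fun h => Fin.succ_ne_zero i (Fin.succ_injective _ h)
  | cons c s ih =>
    rw [List.cons_append, List.cons_append, evalList_cons, evalList_cons, ih]

theorem evalList_cons_add (w : ∀ k : ℕ, V [⋀^Fin k]→ₗ[ℝ] ℝ) (u v : V) (t : List V) :
    evalList w ((u + v) :: t) = evalList w (u :: t) + evalList w (v :: t) := by
  simp only [evalList_cons, map_add]
  rfl

theorem evalList_cons_smul (w : ∀ k : ℕ, V [⋀^Fin k]→ₗ[ℝ] ℝ) (c : ℝ) (v : V) (t : List V) :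
    evalList w ((c • v) :: t) = c * evalList w (v :: t) := by
  simp only [evalList_cons, map_smul]
  rfl

theorem evalList_eq_zero (w : ∀ k : ℕ, V [⋀^Fin k]→ₗ[ℝ] ℝ) {t : List V} (h : (0 : V) ∈ t) :
    evalList w t = 0 := by
  obtain ⟨i, hi⟩ := List.mem_iff_get.1 h
  exact (w _).map_coord_zero i hi

end EvalList

/-! ### Sections of the exterior algebra as vertical multiderivations. -/

section Vertical

variable {n : ℕ} {C : Type*} [TopologicalSpace C] [ChartedSpace (Eu n) C]
  [IsManifold (𝓡 n) ∞ C] [T2Space C]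
  {F : Type*} [NormedAddCommGroup F] [NormedSpace ℝ F] [FiniteDimensional ℝ F]
  {E : C → Type*} [TopologicalSpace (Bundle.TotalSpace F E)]
  [∀ x, AddCommGroup (E x)] [∀ x, Module ℝ (E x)] [∀ x, TopologicalSpace (E x)]
  [FiberBundle F E] [VectorBundle ℝ F E] [ContMDiffVectorBundle ∞ F E (𝓡 n)]
  {K : ∀ x : C, Submodule ℝ (TangentSpace (𝓡 n) x)}
  (Φ : ∀ x, E x ≃ₗ[ℝ] Module.Dual ℝ (K x))

/-- The value of a section of `K`. -/
noncomputable def sectionAt (X : sections K) (x : C) : K x := ⟨X.1 x, X.2 x⟩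

theorem apply_fibreGradient (f : Bundle.TotalSpace F E → ℝ) (e : Bundle.TotalSpace F E)
    (ζ : E e.proj) : Φ e.proj ζ (fibreGradient Φ f e) =
      fderiv ℝ (fun y => f (fibreIncl e.proj y)) (fibreEquiv (F := F) e.proj e.2)
        (fibreEquiv (F := F) e.proj ζ) := by
  refine (Module.apply_evalEquiv_symm_apply ℝ (K e.proj) (Φ e.proj ζ) _).trans ?_
  change fibreDeriv f e ((Φ e.proj).symm (Φ e.proj ζ)) = _
  rw [LinearEquiv.symm_apply_apply]
  rfl

theorem eq_of_forall_fibre {x : C} {u v : K x} (h : ∀ ζ : E x, Φ x ζ u = Φ x ζ v) : u = v := by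
  rw [← sub_eq_zero]
  refine (Module.forall_dual_apply_eq_zero_iff ℝ _).1 fun ξ => ?_
  have h1 := h ((Φ x).symm ξ)
  rw [LinearEquiv.apply_symm_apply] at h1
  rw [map_sub, h1, sub_self]

theorem differentiable_fibre {f : Bundle.TotalSpace F E → ℝ}
    (hf : ContMDiff (bundleModel n F) 𝓘(ℝ, ℝ) ∞ f) (x : C) :
    Differentiable ℝ fun y : F => f (fibreIncl x y) :=
  (hf.comp (contMDiff_fibreIncl x)).contDiff.differentiable (by simp)

theorem fibreGradient_congr {f g : Bundle.TotalSpace F E → ℝ} {e : Bundle.TotalSpace F E}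
    (h : f =ᶠ[nhds e] g) : fibreGradient Φ f e = fibreGradient Φ g e := by
  refine eq_of_forall_fibre Φ fun ζ => ?_
  rw [apply_fibreGradient, apply_fibreGradient]
  have h1 : Filter.Tendsto (fibreIncl (E := E) e.proj) (nhds (fibreEquiv (F := F) e.proj e.2))
      (nhds e) := by
    have h2 := (contMDiff_fibreIncl (n := n) (F := F) (E := E) e.proj).continuous.tendsto
      (fibreEquiv (F := F) e.proj e.2)
    rwa [fibreIncl_fibreEquiv] at h2
  have h2 : (fun y => f (fibreIncl e.proj y)) =ᶠ[nhds (fibreEquiv (F := F) e.proj e.2)]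
    fun y => g (fibreIncl e.proj y) := h1.eventually h
  rw [h2.fderiv_eq]

theorem fibreGradient_basic (f : C → ℝ) (e : Bundle.TotalSpace F E) :
    fibreGradient Φ (fun e => f e.proj) e = 0 := by
  refine eq_of_forall_fibre Φ fun ζ => ?_
  rw [apply_fibreGradient, map_zero]
  have h1 : (fun y : F => f (fibreIncl (E := E) e.proj y).proj) = fun _ => f e.proj := rfl
  rw [h1, fderiv_const_apply]
  rfl

theorem fibreGradient_linear (X : sections K) (e : Bundle.TotalSpace F E) :
    fibreGradient Φ (linearFunction Φ X) e = sectionAt X e.proj := by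
  refine eq_of_forall_fibre Φ fun ζ => ?_
  rw [apply_fibreGradient, fderiv_linearFunction_fibreIncl, ContinuousLinearEquiv.symm_apply_apply]
  rfl

theorem fibreGradient_add {f g : Bundle.TotalSpace F E → ℝ}
    (hf : ContMDiff (bundleModel n F) 𝓘(ℝ, ℝ) ∞ f) (hg : ContMDiff (bundleModel n F) 𝓘(ℝ, ℝ) ∞ g)
    (e : Bundle.TotalSpace F E) :
    fibreGradient Φ (f + g) e = fibreGradient Φ f e + fibreGradient Φ g e := by
  refine eq_of_forall_fibre Φ fun ζ => ?_
  rw [map_add]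
  simp only [apply_fibreGradient]
  exact congrArg (fun L => L (fibreEquiv (F := F) e.proj ζ))
    (fderiv_add (differentiable_fibre hf e.proj _) (differentiable_fibre hg e.proj _))

theorem fibreGradient_mul {f g : Bundle.TotalSpace F E → ℝ}
    (hf : ContMDiff (bundleModel n F) 𝓘(ℝ, ℝ) ∞ f) (hg : ContMDiff (bundleModel n F) 𝓘(ℝ, ℝ) ∞ g)
    (e : Bundle.TotalSpace F E) :
    fibreGradient Φ (f * g) e = f e • fibreGradient Φ g e + g e • fibreGradient Φ f e := by
  refine eq_of_forall_fibre Φ fun ζ => ?_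
  rw [map_add, map_smul, map_smul]
  simp only [apply_fibreGradient]
  have h1 := congrArg (fun L => L (fibreEquiv (F := F) e.proj ζ))
    (fderiv_mul (differentiable_fibre hf e.proj (fibreEquiv (F := F) e.proj e.2))
      (differentiable_fibre hg e.proj (fibreEquiv (F := F) e.proj e.2)))
  simp only [fibreIncl_fibreEquiv] at h1
  exact h1

variable {Φ}

/-- The gradient of a basic function is zero and that of a linear one is its section; the Leibniz
rule gives polynomial coefficients in general. -/
theorem fibreGradient_expand (hΦ : IsSmoothIso F Φ) {s : Bundle.TotalSpace F E → ℝ}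
    (hs : s ∈ Algebra.adjoin ℝ (polyGenerators (F := F) Φ)) :
    ∃ (ι : Type) (_ : Fintype ι) (a : ι → polyAlgebra (F := F) Φ) (X : ι → sections K),
      ∀ e, fibreGradient Φ s e = ∑ j, (a j : Bundle.TotalSpace F E → ℝ) e • sectionAt (X j) e.proj := by
  induction hs using Algebra.adjoin_induction with
  | mem s hs =>
    rcases hs with ⟨f, hf, rfl⟩ | ⟨X, rfl⟩
    · exact ⟨Empty, inferInstance, fun _ => 0, fun _ => 0, fun e => fibreGradient_basic Φ f e⟩
    · refine ⟨Unit, inferInstance, fun _ => 1, fun _ => X, fun e => ?_⟩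
      rw [fibreGradient_linear, Fintype.sum_unique]
      exact (one_smul ℝ _).symm
  | algebraMap c =>
    exact ⟨Empty, inferInstance, fun _ => 0, fun _ => 0, fun e => fibreGradient_basic Φ (fun _ => c) e⟩
  | add a b ha hb iha ihb =>
    obtain ⟨ι, _, p, X, hX⟩ := iha
    obtain ⟨ι', _, p', X', hX'⟩ := ihb
    refine ⟨ι ⊕ ι', inferInstance, Sum.elim p p', Sum.elim X X', fun e => ?_⟩
    rw [fibreGradient_add Φ (contMDiff_of_mem_polyAlgebra hΦ (adjoin_le_polyAlgebra ha))
      (contMDiff_of_mem_polyAlgebra hΦ (adjoin_le_polyAlgebra hb)), Fintype.sum_sum_type, hX, hX']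
    rfl
  | mul a b ha hb iha ihb =>
    obtain ⟨ι, _, p, X, hX⟩ := iha
    obtain ⟨ι', _, p', X', hX'⟩ := ihb
    refine ⟨ι' ⊕ ι, inferInstance, Sum.elim (fun j => ⟨a, adjoin_le_polyAlgebra ha⟩ * p' j)
      (fun j => ⟨b, adjoin_le_polyAlgebra hb⟩ * p j), Sum.elim X' X, fun e => ?_⟩
    rw [fibreGradient_mul Φ (contMDiff_of_mem_polyAlgebra hΦ (adjoin_le_polyAlgebra ha))
      (contMDiff_of_mem_polyAlgebra hΦ (adjoin_le_polyAlgebra hb)), Fintype.sum_sum_type, hX, hX',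
      Finset.smul_sum, Finset.smul_sum]
    simp only [smul_smul]
    rfl

theorem contMDiff_foliatedForm {k : ℕ} (ξ : foliatedForms K k) (X : Fin k → sections K) :
    ContMDiff (𝓡 n) 𝓘(ℝ, ℝ) ∞ fun x => ξ.1 x fun i => sectionAt (X i) x := ξ.2 X

/-- Expanding multilinearly leaves products of polynomial coefficients with the functions `ξ(X₁, …,
X_k)` on the base, which are smooth by the definition of `foliatedForms`. -/
theorem foliatedForm_fibreGradient_mem (hΦ : IsSmoothIso F Φ) {k : ℕ} (ξ : foliatedForms K k)
    (f : Fin k → polyAlgebra (F := F) Φ) :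
    (fun e : Bundle.TotalSpace F E => ξ.1 e.proj fun i => fibreGradient Φ (f i) e) ∈ polyAlgebra Φ := by
  classical
  refine mem_polyAlgebra_of_local fun x => ?_
  choose s hs hfs using fun i => (f i).2 x
  choose ι hι a X haX using fun i => fibreGradient_expand hΦ (hs i)
  refine ⟨_, (∑ r : ∀ i, ι i, (∏ i, a i (r i)) *
    basicFn (F := F) Φ _ (contMDiff_foliatedForm ξ fun i => X i (r i))).2, ?_⟩
  have h1 : ∀ᶠ y in nhds x, ∀ i, ∀ᶠ z in nhds y, ∀ e : Bundle.TotalSpace F E, e.proj = z →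
      (f i : Bundle.TotalSpace F E → ℝ) e = s i e :=
    Filter.eventually_all.2 fun i => (hfs i).eventually_nhds
  refine h1.mono fun y hy e he => ?_
  subst he
  have h2 : ∀ i, fibreGradient Φ (f i) e = ∑ j, (a i j : Bundle.TotalSpace F E → ℝ) e •
      sectionAt (X i j) e.proj := fun i => by
    rw [fibreGradient_congr Φ (LocEq.eventuallyEq (hy i)), haX]
  simp only [h2]
  refine ((ξ.1 e.proj).toMultilinearMap.map_sum
    (fun i j => (a i j : Bundle.TotalSpace F E → ℝ) e • sectionAt (X i j) e.proj)).trans ?_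
  rw [AddSubmonoidClass.coe_finsetSum, Finset.sum_apply]
  refine Finset.sum_congr rfl fun r _ => ?_
  refine ((ξ.1 e.proj).toMultilinearMap.map_smul_univ _ _).trans ?_
  have h3 : ((∏ i, a i (r i) : polyAlgebra (F := F) Φ) : Bundle.TotalSpace F E → ℝ) e =
      ∏ i, (a i (r i) : Bundle.TotalSpace F E → ℝ) e := by
    rw [SubmonoidClass.coe_finsetProd, Finset.prod_apply]
  exact congrArg (· * _) h3.symm

variable (Φ) in
/-- The value on a list of functions of a vertical multivector field. -/
noncomputable def verticalValue (ξ : FoliatedForms K) (t : List (polyAlgebra (F := F) Φ))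
    (e : Bundle.TotalSpace F E) : ℝ :=
  evalList (fun k => (ξ k).1 e.proj) (t.map fun a : polyAlgebra (F := F) Φ => fibreGradient Φ (a : Bundle.TotalSpace F E → ℝ) e)

theorem verticalValue_ofFn (ξ : FoliatedForms K) {k : ℕ} (f : Fin k → polyAlgebra (F := F) Φ)
    (e : Bundle.TotalSpace F E) :
    verticalValue Φ ξ (List.ofFn f) e = (ξ k).1 e.proj fun i => fibreGradient Φ (f i) e := by
  unfold verticalValue
  rw [List.map_ofFn]
  exact evalList_ofFn _ _

theorem verticalValue_mem (hΦ : IsSmoothIso F Φ) (ξ : FoliatedForms K)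
    (t : List (polyAlgebra (F := F) Φ)) : verticalValue Φ ξ t ∈ polyAlgebra Φ := by
  rw [← List.ofFn_get t, show verticalValue Φ ξ (List.ofFn t.get) = _ from
    funext (verticalValue_ofFn ξ t.get)]
  exact foliatedForm_fibreGradient_mem hΦ (ξ t.length) t.get

/-- Sections of `⋀ E` as operations on locally polynomial functions. -/
noncomputable def verticalOp (hΦ : IsSmoothIso F Φ) :
    FoliatedForms K →ₗ[ℝ] ListOp (polyAlgebra (F := F) Φ) where
  toFun ξ t := ⟨verticalValue Φ ξ t, verticalValue_mem hΦ ξ t⟩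
  map_add' _ _ := rfl
  map_smul' _ _ := rfl

theorem verticalOp_apply (hΦ : IsSmoothIso F Φ) (ξ : FoliatedForms K)
    (t : List (polyAlgebra (F := F) Φ)) (e : Bundle.TotalSpace F E) :
    (verticalOp hΦ ξ t : Bundle.TotalSpace F E → ℝ) e = verticalValue Φ ξ t e := rfl

variable (hΦ : IsSmoothIso F Φ)

theorem multiDer_verticalOp (ξ : FoliatedForms K) : ListOp.MultiDer (verticalOp (F := F) hΦ ξ) where
  alt s u v t := by
    ext e
    change verticalValue Φ ξ _ e = -verticalValue Φ ξ _ e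
    simp only [verticalValue, List.map_append, List.map_cons]
    exact evalList_swap _ _ _ _ _
  add u v t := by
    ext e
    change verticalValue Φ ξ _ e = verticalValue Φ ξ _ e + verticalValue Φ ξ _ e
    simp only [verticalValue, List.map_cons]
    rw [← evalList_cons_add]
    congr 2
    exact fibreGradient_add Φ (contMDiff_of_mem_polyAlgebra hΦ u.2)
      (contMDiff_of_mem_polyAlgebra hΦ v.2) e
  smul r v t := by
    ext e
    change verticalValue Φ ξ _ e = r * verticalValue Φ ξ _ e
    simp only [verticalValue, List.map_cons]
    rw [← evalList_cons_smul]
    congr 2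
    have h1 := fibreGradient_mul Φ (f := fun _ => r) contMDiff_const
      (contMDiff_of_mem_polyAlgebra hΦ v.2) e
    rw [show fibreGradient (F := F) Φ (fun _ => r) e = 0 from fibreGradient_basic Φ (fun _ => r) e,
      smul_zero, add_zero] at h1
    exact h1
  mul u v t := by
    ext e
    change verticalValue Φ ξ _ e = (u : Bundle.TotalSpace F E → ℝ) e * verticalValue Φ ξ _ e +
      (v : Bundle.TotalSpace F E → ℝ) e * verticalValue Φ ξ _ e
    simp only [verticalValue, List.map_cons]
    rw [← evalList_cons_smul, ← evalList_cons_smul, ← evalList_cons_add]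
    congr 2
    exact fibreGradient_mul Φ (contMDiff_of_mem_polyAlgebra hΦ u.2)
      (contMDiff_of_mem_polyAlgebra hΦ v.2) e

theorem verticalOp_linear (ξ : FoliatedForms K) {k : ℕ} (X : Fin k → sections K) :
    verticalOp hΦ ξ (List.ofFn fun i => linearFn F Φ (X i)) =
      basicFn Φ _ (contMDiff_foliatedForm (ξ k) X) := by
  ext e
  rw [verticalOp_apply, verticalValue_ofFn]
  refine congrArg _ (funext fun i => fibreGradient_linear Φ (X i) e)

theorem exists_ofFn_linear {t : List (polyAlgebra (F := F) Φ)} (ht : ∀ a ∈ t, a ∈ linearSet F Φ) :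
    ∃ X : Fin t.length → sections K, t = List.ofFn fun i => linearFn F Φ (X i) := by
  choose X hX using fun i => ht (t.get i) (List.get_mem t i)
  refine ⟨X, ?_⟩
  simp only [hX, List.ofFn_get]

theorem verticalOp_basic (ξ : FoliatedForms K) {t : List (polyAlgebra (F := F) Φ)}
    {b : polyAlgebra (F := F) Φ} (hb : b ∈ basicSet F Φ) (ht : b ∈ t) : verticalOp hΦ ξ t = 0 := by
  obtain ⟨f, hf, rfl⟩ := hb
  ext e
  have h1 : fibreGradient (F := F) Φ (fun e => f e.proj) e = 0 := fibreGradient_basic Φ f e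
  have h2 := List.mem_map_of_mem (f := fun a : polyAlgebra (F := F) Φ =>
    fibreGradient Φ (a : Bundle.TotalSpace F E → ℝ) e) ht
  exact evalList_eq_zero (fun k => (ξ k).1 e.proj) (h1 ▸ h2)

/-- A basic argument makes the value zero, and on linear arguments the value is constant along the
fibres. -/
theorem deg_verticalOp (ξ : FoliatedForms K) :
    ListOp.Deg (basicSet F Φ) (linearSet F Φ) (polyFiltration F Φ) 0 (verticalOp hΦ ξ) := by
  intro k t ht
  by_cases hb : ∃ b ∈ t, b ∈ basicSet F Φ
  · obtain ⟨b, hbt, hb⟩ := hb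
    rw [verticalOp_basic hΦ ξ hb hbt]
    exact zero_mem _
  · have h1 : k = 0 ∧ ∀ a ∈ t, a ∈ linearSet F Φ := by
      push Not at hb
      induction ht with
      | nil => simp
      | basic h _ _ => exact absurd h (hb _ (by simp))
      | linear h _ ih =>
        have := ih fun b hbt => hb b (by simp [hbt])
        simpa [h] using this
    obtain ⟨rfl, hl⟩ := h1
    obtain ⟨X, hX⟩ := exists_ofFn_linear hl
    rw [hX, verticalOp_linear]
    exact polySubmodule_le_polyFiltration 0 ⟨_, _, rfl⟩

theorem hom_verticalOp (k : ℕ) (a : foliatedForms K k) :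
    ListOp.Hom k (verticalOp (F := F) hΦ (DirectSum.lof ℝ ℕ (fun k => foliatedForms K k) k a)) := by
  intro t ht
  ext e
  rw [verticalOp_apply, ← List.ofFn_get t, verticalValue_ofFn, DirectSum.lof_eq_of,
    DirectSum.of_eq_of_ne _ _ _ (by exact_mod_cast ht)]
  rfl

theorem eq_zero_of_verticalOp (hK : ∀ x, ∀ u ∈ K x, ∃ X : sections K, X.1 x = u)
    (ξ : FoliatedForms K) {k : ℕ} (h : ∀ t : List (polyAlgebra (F := F) Φ),
      (∀ a ∈ t, a ∈ linearSet F Φ) → t.length = k → verticalOp hΦ ξ t ∈ zeroIdeal F Φ) :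
    ξ k = 0 := by
  ext x u
  choose X hX using fun i => hK x (u i) (u i).2
  have h1 := h (List.ofFn fun i => linearFn F Φ (X i)) (fun a ha => by
    obtain ⟨i, rfl⟩ := (List.mem_ofFn).1 ha
    exact ⟨_, rfl⟩) (by simp) x
  rw [verticalOp_linear] at h1
  have h2 : (fun i => sectionAt (X i) x) = u := funext fun i => Subtype.ext (hX i)
  rw [← h2]
  exact h1

theorem homogeneous_of_verticalOp (hK : ∀ x, ∀ u ∈ K x, ∃ X : sections K, X.1 x = u) (k : ℕ)
    (ξ : FoliatedForms K) (h : ∀ t : List (polyAlgebra (F := F) Φ),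
      (∀ a ∈ t, a ∈ linearSet F Φ) → t.length ≠ k → verticalOp hΦ ξ t ∈ zeroIdeal F Φ) :
    ∃ a, ξ = DirectSum.lof ℝ ℕ (fun k => foliatedForms K k) k a := by
  refine ⟨ξ k, DFinsupp.ext fun j => ?_⟩
  by_cases hj : j = k
  · subst hj
    rw [DirectSum.lof_eq_of]
    exact (DirectSum.of_eq_same (β := fun k => foliatedForms K k) _ _).symm
  · rw [DirectSum.lof_eq_of]
    refine (eq_zero_of_verticalOp hΦ hK ξ fun t ht htj => h t ht (htj ▸ hj)).trans ?_
    exact (DirectSum.of_eq_of_ne (β := fun k => foliatedForms K k) _ _ _ hj).symm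

theorem represents_verticalLift {U : Set (Bundle.TotalSpace F E)} (hU : IsOpen U)
    (ξ : FoliatedForms K) : Represents U (verticalLift Φ ξ) (verticalOp hΦ ξ) where
  localized p _ _ hfg e he := congrArg ((ξ p).1 e.proj) <| funext fun i =>
    fibreGradient_congr Φ (Filter.eventuallyEq_of_mem (hU.mem_nhds he) (hfg i))
  eq _ f e _ := (verticalValue_ofFn ξ f e).symm

theorem IsPolarized.isDerivedBracketData {α : DiffForm (𝓡 n) C 2}
    {G : ∀ x : C, Submodule ℝ (TangentSpace (𝓡 n) x)} (h : IsPolarized α G)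
    {Φ : ∀ x, E x ≃ₗ[ℝ] Module.Dual ℝ (α.ker x)} (hΦ : IsSmoothIso F Φ) :
    IsDerivedBracketData (L := fun k => foliatedForms α.ker k) (basicSet F Φ) (linearSet F Φ)
      (zeroIdeal F Φ) (polyFiltration F Φ) (h.poissonOp Φ hΦ) (verticalOp hΦ) where
  toIsGeneratingSystem := isGeneratingSystem_poly
  multiDer := h.multiDer_poissonOp hΦ
  hom := h.hom_poissonOp hΦ
  deg := h.deg_poissonOp hΦ
  tangent := h.tangent_poissonOp hΦ
  poisson := h.br_poissonOp hΦ
  multiDer_vert := multiDer_verticalOp hΦ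
  deg_vert := deg_verticalOp hΦ
  hom_vert := hom_verticalOp hΦ
  homogeneous := homogeneous_of_verticalOp hΦ fun _ _ hu => h.exists_section hu
  injective ξ hξ := DFinsupp.ext fun _ =>
    eq_zero_of_verticalOp hΦ (fun _ _ hu => h.exists_section hu) ξ fun t ht _ => hξ t ht

end Vertical

end OhPark

namespace OhPark

/-! ### Existence and uniqueness of the projections, and the structure maps. -/

section Projection

variable {n : ℕ} {C : Type*} [TopologicalSpace C] [ChartedSpace (Eu n) C]
  [IsManifold (𝓡 n) ∞ C] [T2Space C]
  {F : Type*} [NormedAddCommGroup F] [NormedSpace ℝ F] [FiniteDimensional ℝ F]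
  {E : C → Type*} [TopologicalSpace (Bundle.TotalSpace F E)]
  [∀ x, AddCommGroup (E x)] [∀ x, Module ℝ (E x)] [∀ x, TopologicalSpace (E x)]
  [FiberBundle F E] [VectorBundle ℝ F E] [ContMDiffVectorBundle ∞ F E (𝓡 n)]

open ListOp

section

variable {K : ∀ x : C, Submodule ℝ (TangentSpace (𝓡 n) x)}
  {Φ : ∀ x, E x ≃ₗ[ℝ] Module.Dual ℝ (K x)}

/-- `ξ` is the projection to `Γ(⋀ E)` of the multiderivation `q`. -/
def IsOpProjection (q : ListOp (polyAlgebra (F := F) Φ)) (ξ : FoliatedForms K) : Prop :=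
  ∀ (k : ℕ) (X : Fin k → sections K) (x : C), (ξ k).1 x (fun i => sectionAt (X i) x) =
    (q (List.ofFn fun i => linearFn F Φ (X i)) : Bundle.TotalSpace F E → ℝ) ⟨x, 0⟩

variable {q q' : ListOp (polyAlgebra (F := F) Φ)} {ξ ξ' : FoliatedForms K}

/-- Sections pass through every vector of `K`, so the prescribed values determine the form. The
multilinearity of the structure maps is deduced from this. -/
theorem IsOpProjection.unique (hK : ∀ x, ∀ u ∈ K x, ∃ X : sections K, X.1 x = u)
    (h : IsOpProjection q ξ) (h' : IsOpProjection q ξ') : ξ = ξ' := by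
  refine DFinsupp.ext fun k => ?_
  ext x u
  choose X hX using fun i => hK x (u i) (u i).2
  have h2 : (fun i => sectionAt (X i) x) = u := funext fun i => Subtype.ext (hX i)
  rw [← h2]
  exact (h k X x).trans (h' k X x).symm

theorem IsOpProjection.add (h : IsOpProjection q ξ) (h' : IsOpProjection q' ξ') :
    IsOpProjection (q + q') (ξ + ξ') := fun k X x => congrArg₂ (· + ·) (h k X x) (h' k X x)

theorem IsOpProjection.smul (h : IsOpProjection q ξ) (c : ℝ) : IsOpProjection (c • q) (c • ξ) :=
  fun k X x => congrArg (c * ·) (h k X x)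

theorem isOpProjection_zero : IsOpProjection (0 : ListOp (polyAlgebra (F := F) Φ)) 0 :=
  fun _ _ _ => rfl

theorem IsOpProjection.sub_mem (hΦ : IsSmoothIso F Φ) (h : IsOpProjection q ξ)
    (t : List (polyAlgebra (F := F) Φ)) (ht : ∀ a ∈ t, a ∈ linearSet F Φ) :
    q t - verticalOp hΦ ξ t ∈ zeroIdeal F Φ := by
  intro x
  obtain ⟨X, hX⟩ := exists_ofFn_linear ht
  rw [hX, verticalOp_linear]
  exact sub_eq_zero.2 (h _ X x).symm

theorem Represents.isProjection_iff {U : Set (Bundle.TotalSpace F E)} (hU₀ : ∀ x : C, ⟨x, 0⟩ ∈ U)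
    {Q : MultiOp (Bundle.TotalSpace F E)} (hQ : Represents U Q q) :
    IsProjection Φ Q ξ ↔ IsOpProjection q ξ := by
  have h1 : ∀ k (X : Fin k → sections K) x, Q k (fun i => linearFunction Φ (X i)) ⟨x, 0⟩ =
      (q (List.ofFn fun i => linearFn F Φ (X i)) : Bundle.TotalSpace F E → ℝ) ⟨x, 0⟩ :=
    fun k X x => hQ.eq k (fun i => linearFn F Φ (X i)) (hU₀ x)
  exact forall_congr' fun k => forall_congr' fun X => forall_congr' fun x => by rw [h1]; rfl

/-- An element of the direct sum has finitely many components. The bound is carried through the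
brackets to ensure that their projections lie in the direct sum. -/
theorem exists_bdd_verticalOp (hΦ : IsSmoothIso F Φ) (ξ : FoliatedForms K) :
    ∃ N : ℤ, Bdd N (verticalOp (F := F) hΦ ξ) := by
  classical
  obtain ⟨N, hN⟩ : ∃ N : ℕ, ∀ k, N < k → ξ k = 0 := by
    refine ⟨(DFinsupp.support ξ).sup id, fun k hk => ?_⟩
    by_contra h0
    exact absurd (Finset.le_sup (f := id) (DFinsupp.mem_support_iff.2 h0)) (not_le.2 hk)
  refine ⟨N, fun t ht => ?_⟩
  ext e
  rw [verticalOp_apply, ← List.ofFn_get t, verticalValue_ofFn, hN t.length (by exact_mod_cast ht)]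
  rfl

end

namespace IsPolarized

variable {α : DiffForm (𝓡 n) C 2} {G : ∀ x : C, Submodule ℝ (TangentSpace (𝓡 n) x)}
  (h : IsPolarized α G) {Φ : ∀ x, E x ≃ₗ[ℝ] Module.Dual ℝ (α.ker x)}
  {q : ListOp (polyAlgebra (F := F) Φ)}

include h

/-- Near `x`, `ℓ_X = ∑ c_i ℓ_(T_i)` with coefficients vanishing at `x`, while every `ℓ_(T_i)`
vanishes on the zero section; so each summand vanishes to second order at the point. -/
theorem derivation_linear_eq_zero
    (D : Derivation ℝ (polyAlgebra (F := F) Φ) (polyAlgebra (F := F) Φ)) {X : sections α.ker}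
    {x : C} (hX : X.1 x = 0) : (D (linearFn F Φ X) : Bundle.TotalSpace F E → ℝ) ⟨x, 0⟩ = 0 := by
  obtain ⟨q, T, hq⟩ := exists_local_coordinates (n := n) x
  let c (i : Fin n) : polyAlgebra (F := F) Φ := basicFn Φ _ (contMDiff_lieD X.1 (hq.smooth i))
  have hc : ∀ i, (c i : Bundle.TotalSpace F E → ℝ) ⟨x, 0⟩ = 0 := fun i => by
    change mvfderiv (𝓡 n) (q i) x (X.1 x) = 0
    rw [hX, map_zero]
  have hs : ∀ (f : Fin n → polyAlgebra (F := F) Φ) e,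
      ((∑ i, f i : polyAlgebra (F := F) Φ) : Bundle.TotalSpace F E → ℝ) e =
        ∑ i, (f i : Bundle.TotalSpace F E → ℝ) e := fun f e => by
    rw [AddSubmonoidClass.coe_finsetSum, Finset.sum_apply]
  have h1 : LocEq x (linearFn F Φ X : Bundle.TotalSpace F E → ℝ)
      (∑ i, c i * linearFn F Φ (h.projK (T i)) : polyAlgebra (F := F) Φ) := by
    refine (h.linearFunction_projK_expand (F := F) Φ hq).mono fun y hy e he => ?_
    have h2 := hy X.1 e he
    rw [h.projK_of_mem] at h2
    rw [hs]
    exact h2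
  rw [derivation_apply_eq D h1 rfl, map_sum, hs]
  refine Finset.sum_eq_zero fun i _ => ?_
  rw [D.leibniz]
  change (c i : Bundle.TotalSpace F E → ℝ) ⟨x, 0⟩ * _ + linearFunction Φ (h.projK (T i)) ⟨x, 0⟩ * _ = 0
  rw [hc, linearFunction_zero_section, zero_mul, zero_mul, add_zero]

/-- Changing one section at a time reduces this to `derivation_linear_eq_zero`. It makes the
projection tensorial. -/
theorem apply_linear_congr (hq : MultiDer q) {x : C} {k : ℕ} {X Y : Fin k → sections α.ker}
    (hXY : ∀ i, (X i).1 x = (Y i).1 x) :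
    (q (List.ofFn fun i => linearFn F Φ (X i)) : Bundle.TotalSpace F E → ℝ) ⟨x, 0⟩ =
      (q (List.ofFn fun i => linearFn F Φ (Y i)) : Bundle.TotalSpace F E → ℝ) ⟨x, 0⟩ := by
  induction k generalizing q with
  | zero => simp only [List.ofFn_zero]
  | succ k ih =>
    rw [List.ofFn_succ, List.ofFn_succ]
    refine Eq.trans ?_ (ih (hq.fix (linearFn F Φ (Y 0))) (X := fun i => X i.succ)
      (Y := fun i => Y i.succ) fun i => hXY i.succ)
    have h0 : (X 0 - Y 0).1 x = 0 := sub_eq_zero.2 (hXY 0)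
    have h1 := h.derivation_linear_eq_zero
      (hq.derivation (List.ofFn fun i => linearFn F Φ (X i.succ))) h0
    rw [map_sub, map_sub] at h1
    exact sub_eq_zero.1 h1

theorem exists_isOpProjection (hΦ : IsSmoothIso F Φ) (hq : MultiDer q) (hb : ∃ N, Bdd N q) :
    ∃ ξ, IsOpProjection q ξ := by
  -- Extensions of vectors to sections are chosen linearly, so that the form below is multilinear by
  -- construction. No regularity in `x` is needed, because by `hw` the values on sections do not
  -- depend on the choice.
  have hsec : ∀ x, ∃ g : α.ker x →ₗ[ℝ] sections α.ker, ∀ u, (g u).1 x = u := by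
    intro x
    let ev : sections α.ker →ₗ[ℝ] α.ker x :=
      { toFun := fun X => sectionAt X x
        map_add' := fun _ _ => rfl
        map_smul' := fun _ _ => rfl }
    obtain ⟨g, hg⟩ := ev.exists_rightInverse_of_surjective (LinearMap.range_eq_top.2 fun u => by
      obtain ⟨X, hX⟩ := h.exists_section u.2
      exact ⟨X, Subtype.ext hX⟩)
    exact ⟨g, fun u => congrArg Subtype.val (LinearMap.congr_fun hg u)⟩
  choose g hg using hsec
  let evz (x : C) : polyAlgebra (F := F) Φ →ₗ[ℝ] ℝ :=
    { toFun := fun a => (a : Bundle.TotalSpace F E → ℝ) ⟨x, 0⟩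
      map_add' := fun _ _ => rfl
      map_smul' := fun _ _ => rfl }
  let w (k : ℕ) (x : C) : α.ker x [⋀^Fin k]→ₗ[ℝ] ℝ :=
    ((evz x).compAlternatingMap (hq.toAltLin.toAlternatingMap k)).compLinearMap
      ((linearFn F Φ).comp (g x))
  have hw : ∀ k (X : Fin k → sections α.ker) x, w k x (fun i => sectionAt (X i) x) =
      (q (List.ofFn fun i => linearFn F Φ (X i)) : Bundle.TotalSpace F E → ℝ) ⟨x, 0⟩ :=
    fun k X x => h.apply_linear_congr hq fun i => hg x _
  have hsm : ∀ k, w k ∈ foliatedForms α.ker k := fun k X => by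
    have h1 := (contMDiff_of_mem_polyAlgebra hΦ
      (q (List.ofFn fun i => linearFn F Φ (X i))).2).comp (Bundle.contMDiff_zeroSection ℝ E)
    exact h1.congr fun x => hw k X x
  obtain ⟨N, hN⟩ := hb
  refine ⟨DirectSum.mk (fun k => foliatedForms α.ker k) (Finset.range (N.toNat + 1))
    fun k => ⟨w k, hsm k⟩, fun k X x => ?_⟩
  by_cases hk : k ∈ Finset.range (N.toNat + 1)
  · rw [DirectSum.mk_apply_of_mem hk]
    exact hw k X x
  · rw [DirectSum.mk_apply_of_notMem hk, hN]
    · rfl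
    · rw [Finset.mem_range] at hk
      rw [List.length_ofFn]
      omega

variable (hΦ : IsSmoothIso F Φ)

theorem exists_bdd_br (hq : MultiDer q) (hb : ∃ N, Bdd N q) (ξ : FoliatedForms α.ker) :
    ∃ N, Bdd N (br q (verticalOp hΦ ξ)) := by
  obtain ⟨N, hN⟩ := hb
  obtain ⟨N', hN'⟩ := exists_bdd_verticalOp (F := F) hΦ ξ
  exact ⟨_, hN.br hN' hq.toAltLin (multiDer_verticalOp hΦ ξ).toAltLin⟩

theorem exists_bdd_poissonOp : ∃ N, Bdd N (h.poissonOp Φ hΦ) :=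
  ⟨2, fun t ht => h.poissonOp_of_length hΦ (by omega)⟩

omit h in
theorem represents_foldl {U : Set (Bundle.TotalSpace F E)} (hU : IsOpen U)
    (l : List (FoliatedForms α.ker)) {Q : MultiOp (Bundle.TotalSpace F E)}
    (hq : MultiDer q) (hQ : Represents U Q q) :
    Represents U (l.foldl (fun R ξ => schouten R (verticalLift Φ ξ)) Q)
      (l.foldl (fun r ξ => br r (verticalOp hΦ ξ)) q) := by
  induction l generalizing Q q with
  | nil => exact hQ
  | cons ξ l ih =>
    exact ih (hq.br (multiDer_verticalOp hΦ ξ)) (hQ.schouten (represents_verticalLift hΦ hU ξ)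
      hq.toAltLin (multiDer_verticalOp hΦ ξ).toAltLin)

theorem foldl_eq_zero {m : ℕ} (hm : 2 < m) (a : Fin m → FoliatedForms α.ker) :
    (List.ofFn a).foldl (fun r ξ => br r (verticalOp hΦ ξ)) (h.poissonOp Φ hΦ) = 0 := by
  obtain ⟨m, rfl⟩ := Nat.exists_eq_add_of_lt hm
  have hz : ∀ l : List (FoliatedForms α.ker),
      l.foldl (fun r ξ => br r (verticalOp hΦ ξ)) (0 : ListOp (polyAlgebra (F := F) Φ)) = 0 := by
    intro l
    induction l with
    | nil => rfl
    | cons ξ l ih =>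
      have h0 : br (0 : ListOp (polyAlgebra (F := F) Φ)) (verticalOp hΦ ξ) = 0 := by
        simpa using br_smul_left (P := (0 : ListOp (polyAlgebra (F := F) Φ)))
          (multiDer_verticalOp hΦ ξ).toAltLin 0
      rw [List.foldl_cons, h0, ih]
  obtain ⟨b, c, d, l, hl⟩ : ∃ b c d l, List.ofFn a = b :: c :: d :: l := by
    match hl : List.ofFn a with
    | b :: c :: d :: l => exact ⟨b, c, d, l, rfl⟩
    | [] | [_] | [_, _] =>
      have := congrArg List.length hl
      simp only [List.length_ofFn, List.length_cons, List.length_nil] at this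
      omega
  rw [hl, List.foldl_cons, List.foldl_cons, List.foldl_cons,
    (h.isDerivedBracketData hΦ).br_br_br, hz]

variable {U : Set (Bundle.TotalSpace F E)}

theorem isProjection_iteratedBracket_iff (hU : IsOpen U) (hU₀ : ∀ x : C, ⟨x, 0⟩ ∈ U) {m : ℕ}
    (a : Fin m → FoliatedForms α.ker) (ξ : FoliatedForms α.ker) :
    IsProjection Φ (iteratedBracket Φ (poissonBivector (modelForm α Φ h.compl) U) a) ξ ↔
      IsOpProjection ((List.ofFn a).foldl (fun r ξ => br r (verticalOp hΦ ξ))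
        (h.poissonOp Φ hΦ)) ξ :=
  (represents_foldl hΦ hU _ (h.multiDer_poissonOp hΦ)
    (h.represents_poissonBivector hΦ hU)).isProjection_iff hU₀

include hΦ

/-- The projections of the single and double brackets exist since these are multiderivations of
bounded arity; the bracket is linear and the projection unique, hence the maps are multilinear. -/
theorem exists_isOhParkAlgebra (hU : IsOpen U) (hU₀ : ∀ x : C, ⟨x, 0⟩ ∈ U) :
    ∃ lam, IsOhParkAlgebra Φ (poissonBivector (modelForm α Φ h.compl) U) lam := by
  set V := verticalOp (F := F) hΦ with hV
  set P := h.poissonOp Φ hΦ with hP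
  have hK : ∀ x, ∀ u ∈ α.ker x, ∃ X : sections α.ker, X.1 x = u := fun _ _ hu => h.exists_section hu
  have mP : MultiDer P := h.multiDer_poissonOp hΦ
  have mV : ∀ ξ, MultiDer (V ξ) := multiDer_verticalOp hΦ
  have b1 : ∀ ξ, ∃ N, Bdd N (br P (V ξ)) := h.exists_bdd_br hΦ mP (h.exists_bdd_poissonOp hΦ)
  choose p₁ hp₁ using fun ξ => h.exists_isOpProjection hΦ (mP.br (mV ξ)) (b1 ξ)
  choose p₂ hp₂ using fun ξ η => h.exists_isOpProjection hΦ ((mP.br (mV ξ)).br (mV η))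
    (h.exists_bdd_br hΦ (mP.br (mV ξ)) (b1 ξ) η)
  let l₁ : FoliatedForms α.ker →ₗ[ℝ] FoliatedForms α.ker :=
    { toFun := p₁
      map_add' := fun ξ η => (hp₁ _).unique hK <| by
        rw [map_add, br_add_right mP.toAltLin]
        exact (hp₁ ξ).add (hp₁ η)
      map_smul' := fun c ξ => (hp₁ _).unique hK <| by
        rw [map_smul, br_smul_right mP.toAltLin]
        exact (hp₁ ξ).smul c }
  let l₂ : FoliatedForms α.ker →ₗ[ℝ] FoliatedForms α.ker →ₗ[ℝ] FoliatedForms α.ker :=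
    LinearMap.mk₂ ℝ p₂
      (fun ξ ξ' η => (hp₂ _ _).unique hK <| by
        rw [map_add, br_add_right mP.toAltLin, br_add_left (mV η).toAltLin]
        exact (hp₂ ξ η).add (hp₂ ξ' η))
      (fun c ξ η => (hp₂ _ _).unique hK <| by
        rw [map_smul, br_smul_right mP.toAltLin, br_smul_left (mV η).toAltLin]
        exact (hp₂ ξ η).smul c)
      (fun ξ η η' => (hp₂ _ _).unique hK <| by
        rw [map_add, br_add_right (mP.br (mV ξ)).toAltLin]
        exact (hp₂ ξ η).add (hp₂ ξ η'))
      (fun c ξ η => (hp₂ _ _).unique hK <| by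
        rw [map_smul, br_smul_right (mP.br (mV ξ)).toAltLin]
        exact (hp₂ ξ η).smul c)
  let lam : ∀ m : ℕ, MultilinearMap ℝ (fun _ : Fin m => FoliatedForms α.ker) (FoliatedForms α.ker)
    | 1 => MultilinearMap.ofSubsingleton ℝ _ _ 0 l₁
    | 2 => MultilinearMap.mk' (fun a => l₂ (a 0) (a 1))
        (fun a i ξ η => by fin_cases i <;> simp)
        (fun a i c ξ => by fin_cases i <;> simp)
    -- Arity zero is not constrained, and from arity three on the iterated bracket vanishes.
    | _ => 0
  refine ⟨lam, fun m hm a => (h.isProjection_iteratedBracket_iff hΦ hU hU₀ a _).2 ?_⟩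
  match m, hm, a with
  | 1, _, a => exact hp₁ (a 0)
  | 2, _, a => exact hp₂ (a 0) (a 1)
  | m + 3, _, a =>
    rw [h.foldl_eq_zero hΦ (by omega)]
    exact isOpProjection_zero

theorem isOhParkAlgebra_spec (hU : IsOpen U) (hU₀ : ∀ x : C, ⟨x, 0⟩ ∈ U)
    {lam : ∀ m : ℕ, MultilinearMap ℝ (fun _ : Fin m => FoliatedForms α.ker) (FoliatedForms α.ker)}
    (hl : IsOhParkAlgebra Φ (poissonBivector (modelForm α Φ h.compl) U) lam) :
    (∀ k : ℕ, 2 < k → lam k = 0) ∧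
      IsDGLA (L := fun k => foliatedForms α.ker k)
        (differential (lam 1)) (shiftedBracket (lam 2)) := by
  have hp := fun m hm a => (h.isProjection_iteratedBracket_iff hΦ hU hU₀ a (lam m a)).1 (hl m hm a)
  refine ⟨fun k hk => MultilinearMap.ext fun a => ?_, (h.isDerivedBracketData hΦ).isDGLA ?_ ?_⟩
  · have h1 := hp k (by omega) a
    rw [h.foldl_eq_zero hΦ hk] at h1
    exact h1.unique (fun _ _ hu => h.exists_section hu) isOpProjection_zero
  · exact fun ξ t ht => (hp 1 le_rfl fun _ => ξ).sub_mem hΦ t ht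
  · exact fun ξ η t ht => (hp 2 one_le_two ![ξ, η]).sub_mem hΦ t ht

end IsPolarized

/-- A complement to the kernel of the pull-back of a symplectic form. -/
theorem isPolarized_pullback {m : ℕ} {M : Type*} [TopologicalSpace M] [ChartedSpace (Eu m) M]
    [IsManifold (𝓡 m) ∞ M] {om : DiffForm (𝓡 m) M 2} (hom : om.IsSymplectic) {f : C → M}
    (hf : ContMDiff (𝓡 n) (𝓡 m) ∞ f) {G : ∀ x : C, Submodule ℝ (TangentSpace (𝓡 n) x)}
    (hG : IsSubbundle G) (hKG : ∀ x, IsCompl ((om.pullback (𝓡 n) f).ker x) (G x))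
    (hGinv : IsInvolutive G) : IsPolarized (om.pullback (𝓡 n) f) G where
  contMDiffAt_pair := contMDiffAt_pair_pullback hom.smooth hf
  differentiableAt := DiffForm.differentiableAt_inChart_pullback hom.smooth hf
  closed := DiffForm.extDeriv_inChart_pullback hom.smooth hom.closed hf
  compl := hKG
  bundle := hG
  involutive := hGinv

end Projection

end OhPark

theorem mainTheorem7
    {m n : ℕ}
    {M : Type*} [TopologicalSpace M] [ChartedSpace (Eu m) M] [IsManifold (𝓡 m) ∞ M]
    [T2Space M] [SecondCountableTopology M]
    {C : Type*} [TopologicalSpace C] [ChartedSpace (Eu n) C] [IsManifold (𝓡 n) ∞ C]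
    [T2Space C] [SecondCountableTopology C]
    -- a symplectic manifold `(M, om)` and a coisotropic submanifold `ι : C → M`
    (om : DiffForm (𝓡 m) M 2) (hom : om.IsSymplectic)
    (ι : C → M) (hι : Manifold.IsSmoothEmbedding (𝓡 n) (𝓡 m) ∞ ι)
    (hC : om.IsCoisotropic (𝓡 n) ι)
    -- the induced presymplectic form `omC` and an involutive complement `G` of its kernel `K`
    (omC : DiffForm (𝓡 n) C 2) (homC : omC = om.pullback (𝓡 n) ι)
    (G : ∀ x : C, Submodule ℝ (TangentSpace (𝓡 n) x))
    (hG : IsSubbundle G) (hKG : ∀ x, IsCompl (omC.ker x) (G x)) (hGinv : IsInvolutive G)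
    -- a smooth vector bundle `E` with an isomorphism `Φ : E ≅ K*`
    {F : Type*} [NormedAddCommGroup F] [NormedSpace ℝ F] [FiniteDimensional ℝ F]
    {E : C → Type*} [TopologicalSpace (Bundle.TotalSpace F E)]
    [∀ x, AddCommGroup (E x)] [∀ x, Module ℝ (E x)] [∀ x, TopologicalSpace (E x)]
    [FiberBundle F E] [VectorBundle ℝ F E] [ContMDiffVectorBundle ∞ F E (𝓡 n)]
    (Φ : ∀ x, E x ≃ₗ[ℝ] Module.Dual ℝ (omC.ker x)) (hΦ : IsSmoothIso F Φ)
    -- the local symplectic model `(U, Ω)` determined by `G`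
    (U : Set (Bundle.TotalSpace F E)) (hU : IsOpen U) (hU₀ : ∀ x : C, ⟨x, 0⟩ ∈ U)
    (hΩ : ∀ e ∈ U, (modelForm omC Φ hKG).NondegenerateAt e) :
    (∃ lam, IsOhParkAlgebra Φ (poissonBivector (modelForm omC Φ hKG) U) lam) ∧
    ∀ lam, IsOhParkAlgebra Φ (poissonBivector (modelForm omC Φ hKG) U) lam →
      (∀ k : ℕ, 2 < k → lam k = 0) ∧
      IsDGLA (L := fun k => foliatedForms omC.ker k)
        (differential (lam 1)) (shiftedBracket (lam 2)) := by
  subst homC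
  have h := isPolarized_pullback hom hι.contMDiff hG hKG hGinv
  exact ⟨h.exists_isOhParkAlgebra hΦ hU hU₀, fun _ hl => h.isOhParkAlgebra_spec hΦ hU hU₀ hl⟩
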